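/- Let $M$ be a smooth $4$-manifold with a $\mathrm U(2)$-structure, given in local gauges by coframes $\Psi=(\alpha,\beta)^T$ of complex $1$-forms such that $e^1,\dots,e^4$ with $\alpha=e^1+ie^2$, $\beta=e^3+ie^4$ is a real coframe; on overlaps the $\Psi$'s differ by $\mathrm U(2)$-valued functions. Put $g=\alpha\odot\bar\alpha+\beta\odot\bar\beta=\sum_I (e^I)^2$, $\omega=\frac i2(\alpha\wedge\bar\alpha+\beta\wedge\bar\beta)=\frac1{2i}\Psi^\dagger\Psi$, $dV=e^1\wedge e^2\wedge e^3\wedge e^4$ (which fixes the orientation), and let $\Sigma=\Psi\Psi^\dagger+\frac12\mathbb I\,\Psi^\dagger\Psi$ be the trace-free part of $\Psi\wedge\Psi^\dagger$. Let $A$ and $a$ be the $\mathfrak{su}(2)$ (trace-free) part and the imaginary trace part of a $\mathrm U(2)$ connection, $F=dA+A\wedge A$, and let $\lambda,\mu,\nu\in\mathbb R$ satisfy $\lambda\ne0$ and $3\lambda-\mu+4\nu=0$; put $\tilde\mu=\mu/\lambda$. Consider $$S[A,a,\Psi]=\int_M \mathrm{Tr}\big(\lambda\,\Psi^\dagger F\Psi+\mu\,da\,\Psi^\dagger\Psi+\nu\,(\Psi^\dagger\Psi)^2\big).$$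 (i) For a smooth $\mathfrak{su}(2)$-valued variation $\delta A$ with compact support in a gauge patch, $\delta S=-\lambda\int \mathrm{Tr}\big(\delta A\wedge(d\Sigma+A\wedge\Sigma-\Sigma\wedge A)\big)$. Hence the Euler–Lagrange equation for $A$ is $d\Sigma+A\wedge\Sigma-\Sigma\wedge A=0$, an algebraic (pointwise linear) equation for $A$. Its unique solution at every point is $A=\mathbf w$, the anti-self-dual part of the Levi-Civita connection of $g$, acting on $\mathbb C^2$; the local forms $\mathbf w$ do define such a connection on $M$, and it is the only solution of the Euler–Lagrange equation. (ii) Let $s$ be the scalar curvature of $g$ in the normalisation $s\,dV=\frac14\epsilon_{IJKL}R^{IJ}\wedge e^K\wedge e^L$, that is, $s=\frac12 g^{\mu\nu}\mathrm{Ric}_{\mu\nu}$. Then $\Psi^\dagger F(\mathbf w)\Psi=-s\,dV$ and $(\Psi^\dagger\Psi)^2=-8\,dV$. Substituting $A=\mathbf w$ gives $$S[\mathbf w,a,\Psi]=-\lambda\int_M\Big(dV\,(s+2\tilde\mu-6)-2\tilde\mu\,\omega\wedge i\,da\Big),$$ also as an identity of integrands; the right-hand side depends only on $(g,\omega,a)$,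 where $M$ is oriented by $\omega\wedge\omega$. (iii) Here $g$ is a Riemannian metric and $\omega$ a $2$-form on $M$ subject to $\omega_{\mu\alpha}g^{\alpha\beta}\omega_{\beta\nu}=-g_{\mu\nu}$. Two coframes $\Psi$ give the same $(g,\omega)$ at a point exactly when they differ there by an element of $\mathrm U(2)$, and every smooth pair $(g,\omega)$ satisfying this condition arises locally from a smooth $\Psi$. -/

import Mathlib

open scoped Manifold ContDiff Matrix
open MeasureTheory

noncomputable section

namespace U2Gravity

/-! ### Differential forms in a coordinate domain, by components

A `k`-form with values in `X` on a domain of `ℝ⁴` is given by its components: a `1`-form is a map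
`α : E4 → Fin 4 → X`, where `α y μ` is the value of `α` at `y` on the coordinate vector `∂_μ`,
a `2`-form has components `σ y μ ν`, a `3`-form `θ y μ ν ρ`.  A `4`-form is given by its single
component on `(∂_0, ∂_1, ∂_2, ∂_3)`.  Values multiply by `*`, so the wedge products below apply to
real and complex forms and to matrices of forms (of any compatible sizes) alike. -/

/-- The coordinate space `ℝ⁴`. -/
abbrev E4 : Type := EuclideanSpace ℝ (Fin 4)

/-- The partial derivative `∂_μ f` at `y`. -/
def pd {V : Type*} [NormedAddCommGroup V] [NormedSpace ℝ V] (μ : Fin 4) (f : E4 → V) (y : E4) : V :=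
  fderiv ℝ f y (EuclideanSpace.single μ (1 : ℝ))

section Wedge

variable {X Y Z : Type*} [HMul X Y Z] [AddCommGroup Z]

/-- Wedge product of two `1`-forms (at a point). -/
def w11 (α : Fin 4 → X) (β : Fin 4 → Y) : Fin 4 → Fin 4 → Z :=
  fun μ ν => α μ * β ν - α ν * β μ

/-- Wedge product of a `1`-form and a `2`-form (at a point). -/
def w12 (α : Fin 4 → X) (σ : Fin 4 → Fin 4 → Y) : Fin 4 → Fin 4 → Fin 4 → Z :=
  fun μ ν ρ => α μ * σ ν ρ - α ν * σ μ ρ + α ρ * σ μ ν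

/-- Wedge product of a `2`-form and a `1`-form (at a point). -/
def w21 (σ : Fin 4 → Fin 4 → X) (α : Fin 4 → Y) : Fin 4 → Fin 4 → Fin 4 → Z :=
  fun μ ν ρ => σ μ ν * α ρ - σ μ ρ * α ν + σ ν ρ * α μ

/-- Wedge product of two `2`-forms (at a point), as the component on `(∂_0, ∂_1, ∂_2, ∂_3)`. -/
def w22 (σ : Fin 4 → Fin 4 → X) (τ : Fin 4 → Fin 4 → Y) : Z :=
  σ 0 1 * τ 2 3 - σ 0 2 * τ 1 3 + σ 0 3 * τ 1 2 + σ 1 2 * τ 0 3 - σ 1 3 * τ 0 2 + σ 2 3 * τ 0 1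

/-- Wedge product of a `1`-form and a `3`-form (at a point), on `(∂_0, ∂_1, ∂_2, ∂_3)`. -/
def w13 (α : Fin 4 → X) (θ : Fin 4 → Fin 4 → Fin 4 → Y) : Z :=
  α 0 * θ 1 2 3 - α 1 * θ 0 2 3 + α 2 * θ 0 1 3 - α 3 * θ 0 1 2

/-- Wedge product of a `3`-form and a `1`-form (at a point), on `(∂_0, ∂_1, ∂_2, ∂_3)`. -/
def w31 (θ : Fin 4 → Fin 4 → Fin 4 → X) (α : Fin 4 → Y) : Z :=
  θ 0 1 2 * α 3 - θ 0 1 3 * α 2 + θ 0 2 3 * α 1 - θ 1 2 3 * α 0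

end Wedge

/-- Exterior derivative of a scalar `1`-form. -/
def d1 {V : Type*} [NormedAddCommGroup V] [NormedSpace ℝ V] (α : E4 → Fin 4 → V) (y : E4) :
    Fin 4 → Fin 4 → V :=
  fun μ ν => pd μ (fun z => α z ν) y - pd ν (fun z => α z μ) y

/-- Exterior derivative of a scalar `2`-form. -/
def d2 {V : Type*} [NormedAddCommGroup V] [NormedSpace ℝ V] (σ : E4 → Fin 4 → Fin 4 → V) (y : E4) :
    Fin 4 → Fin 4 → Fin 4 → V :=
  fun μ ν ρ => pd μ (fun z => σ z ν ρ) y - pd ν (fun z => σ z μ ρ) y + pd ρ (fun z => σ z μ ν) y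

/-- Exterior derivative of a matrix of complex `1`-forms, entry by entry. -/
def d1M {p q : ℕ} (α : E4 → Fin 4 → Matrix (Fin p) (Fin q) ℂ) (y : E4) :
    Fin 4 → Fin 4 → Matrix (Fin p) (Fin q) ℂ :=
  fun μ ν => Matrix.of fun i j => d1 (fun z κ => α z κ i j) y μ ν

/-- Exterior derivative of a matrix of complex `2`-forms, entry by entry. -/
def d2M {p q : ℕ} (σ : E4 → Fin 4 → Fin 4 → Matrix (Fin p) (Fin q) ℂ) (y : E4) :
    Fin 4 → Fin 4 → Fin 4 → Matrix (Fin p) (Fin q) ℂ :=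
  fun μ ν ρ => Matrix.of fun i j => d2 (fun z κ ι => σ z κ ι i j) y μ ν ρ

/-- Pull-back of a `1`-form under `τ`. -/
def pull1 {X : Type*} [AddCommMonoid X] [Module ℝ X] (τ : E4 → E4) (α : E4 → Fin 4 → X) (y : E4) :
    Fin 4 → X :=
  fun μ => ∑ κ, pd μ (fun z => τ z κ) y • α (τ y) κ

/-- Pull-back of a covariant `2`-tensor under `τ`. -/
def pull2 {X : Type*} [AddCommMonoid X] [Module ℝ X] (τ : E4 → E4) (σ : E4 → Fin 4 → Fin 4 → X)
    (y : E4) : Fin 4 → Fin 4 → X :=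
  fun μ ν => ∑ κ, ∑ ι, (pd μ (fun z => τ z κ) y * pd ν (fun z => τ z ι) y) • σ (τ y) κ ι

/-! ### Riemannian geometry of a metric in coordinates -/

/-- Christoffel symbols `Γ^ρ_{μν}` of the metric `g`. -/
def christoffel (g : E4 → Matrix (Fin 4) (Fin 4) ℝ) (ρ μ ν : Fin 4) (y : E4) : ℝ :=
  (1 / 2) * ∑ σ, (g y)⁻¹ ρ σ *
    (pd μ (fun z => g z σ ν) y + pd ν (fun z => g z σ μ) y - pd σ (fun z => g z μ ν) y)

/-- Riemann curvature `R^ρ_{σμν}` of the metric `g`. -/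
def riemann (g : E4 → Matrix (Fin 4) (Fin 4) ℝ) (ρ σ μ ν : Fin 4) (y : E4) : ℝ :=
  pd μ (christoffel g ρ ν σ) y - pd ν (christoffel g ρ μ σ) y
    + ∑ κ, (christoffel g ρ μ κ y * christoffel g κ ν σ y
      - christoffel g ρ ν κ y * christoffel g κ μ σ y)

/-- Ricci tensor `Ric_{σν} = R^ρ_{σρν}` of the metric `g`. -/
def ricci (g : E4 → Matrix (Fin 4) (Fin 4) ℝ) (σ ν : Fin 4) (y : E4) : ℝ :=
  ∑ ρ, riemann g ρ σ ρ ν y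

/-- The trace `g^{σν} Ric_{σν}` of the Ricci tensor (`12` for the unit sphere `S⁴`). -/
def traceRicci (g : E4 → Matrix (Fin 4) (Fin 4) ℝ) (y : E4) : ℝ :=
  ∑ σ, ∑ ν, (g y)⁻¹ σ ν * ricci g σ ν y

/-- The scalar curvature in the normalisation `s dV = ¼ ε_{IJKL} R^{IJ} ∧ e^K ∧ e^L`, that is, half
of the trace of the Ricci tensor. -/
def scalarCurv (g : E4 → Matrix (Fin 4) (Fin 4) ℝ) (y : E4) : ℝ :=
  (1 / 2) * traceRicci g y

/-! ### The `ℂ²`-valued coframe `Ψ = (α, β)ᵀ` and its metric geometry -/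

/-- A `ℂ²`-valued `1`-form on `ℝ⁴`: `Ψ y μ` is the column `(α_μ(y), β_μ(y))ᵀ`. -/
abbrev C2Form : Type := E4 → Fin 4 → Matrix (Fin 2) (Fin 1) ℂ

/-- A `1`-form with values in complex `2 × 2` matrices. -/
abbrev M2Form : Type := E4 → Fin 4 → Matrix (Fin 2) (Fin 2) ℂ

/-- The real coframe `e^I` of `Ψ`: `α = e^1 + i e^2`, `β = e^3 + i e^4`.  Rows are the four
`1`-forms, columns their coordinate components. -/
def coframe (Ψ : C2Form) (y : E4) : Matrix (Fin 4) (Fin 4) ℝ :=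
  Matrix.of fun I μ => ![(Ψ y μ 0 0).re, (Ψ y μ 0 0).im, (Ψ y μ 1 0).re, (Ψ y μ 1 0).im] I

/-- `Ψ†`, as a row of `1`-forms. -/
def dag (Ψ : C2Form) : E4 → Fin 4 → Matrix (Fin 1) (Fin 2) ℂ := fun y μ => (Ψ y μ)ᴴ

/-- The `1 × 1` matrix `Ψ† ∧ Ψ` of `2`-forms. -/
def dagPsi (Ψ : C2Form) (y : E4) : Fin 4 → Fin 4 → Matrix (Fin 1) (Fin 1) ℂ :=
  w11 (dag Ψ y) (Ψ y)

/-- The trace-free part `Σ = Ψ ∧ Ψ† + ½ 𝕀 (Ψ† ∧ Ψ)` of `Ψ ∧ Ψ†`. -/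
def sigma (Ψ : C2Form) (y : E4) : Fin 4 → Fin 4 → Matrix (Fin 2) (Fin 2) ℂ :=
  fun μ ν => w11 (Ψ y) (dag Ψ y) μ ν
    + ((1 / 2 : ℂ) * dagPsi Ψ y μ ν 0 0) • (1 : Matrix (Fin 2) (Fin 2) ℂ)

/-- The metric `g = α ⊙ ᾱ + β ⊙ β̄` (with `α ⊙ ᾱ = ½ (α ⊗ ᾱ + ᾱ ⊗ α)`). -/
def metric (Ψ : C2Form) (y : E4) : Matrix (Fin 4) (Fin 4) ℝ :=
  Matrix.of fun μ ν => ∑ c, (Ψ y μ c 0 * star (Ψ y ν c 0)).re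

/-- The `2`-form `ω = (i/2) (α ∧ ᾱ + β ∧ β̄)`, which is real. -/
def omega (Ψ : C2Form) (y : E4) : Matrix (Fin 4) (Fin 4) ℝ :=
  Matrix.of fun μ ν =>
    ((Complex.I / 2) * ∑ c, (Ψ y μ c 0 * star (Ψ y ν c 0) - Ψ y ν c 0 * star (Ψ y μ c 0))).re

/-- The component of the volume form `dV = e^1 ∧ e^2 ∧ e^3 ∧ e^4`. -/
def volForm (Ψ : C2Form) (y : E4) : ℝ := (coframe Ψ y).det

/-- The orientation sign, relative to the coordinates, of the orientation in which
`e^1 ∧ e^2 ∧ e^3 ∧ e^4` (equivalently `ω ∧ ω`) is positive. -/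
def orient (Ψ : C2Form) (y : E4) : ℝ := Real.sign (volForm Ψ y)

/-- The Levi-Civita connection of `metric Ψ` in the orthonormal coframe `e^I`:
`w^I_J(∂_μ) = e^I(∇_μ E_J)`, where `E_J` is the frame dual to `e^I`. -/
def leviCivita (Ψ : C2Form) (y : E4) (μ : Fin 4) : Matrix (Fin 4) (Fin 4) ℝ :=
  Matrix.of fun I J => ∑ ν, coframe Ψ y I ν *
    (pd μ (fun z => (coframe Ψ z)⁻¹ ν J) y
      + ∑ ρ, christoffel (metric Ψ) ν μ ρ y * (coframe Ψ y)⁻¹ ρ J)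

/-- The curvature `R^{IJ} = dw^{IJ} + w^I_K ∧ w^{KJ}` of the Levi-Civita connection. -/
def lcCurv (Ψ : C2Form) (y : E4) (I J : Fin 4) : Fin 4 → Fin 4 → ℝ :=
  fun μ ν => d1 (fun z κ => leviCivita Ψ z κ I J) y μ ν
    + ∑ K, w11 (fun κ => leviCivita Ψ y κ I K) (fun κ => leviCivita Ψ y κ K J) μ ν

/-- The `2`-form `e^K ∧ e^L`. -/
def ee (Ψ : C2Form) (y : E4) (K L : Fin 4) : Fin 4 → Fin 4 → ℝ :=
  w11 (coframe Ψ y K) (coframe Ψ y L)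

/-- The Hodge star `½ ε_{IJKL} W_{KL}` of an antisymmetric matrix, in the orientation
`e^1 ∧ e^2 ∧ e^3 ∧ e^4`. -/
def hodge (W : Matrix (Fin 4) (Fin 4) ℝ) : Matrix (Fin 4) (Fin 4) ℝ :=
  !![0, W 2 3, -W 1 3, W 1 2;
     -W 2 3, 0, W 0 3, -W 0 2;
     W 1 3, -W 0 3, 0, W 0 1;
     -W 1 2, W 0 2, -W 0 1, 0]

/-- The complex `2 × 2` matrix of a complex-linear endomorphism of `ℝ⁴ ≅ ℂ²`,
`z¹ = x¹ + i x²`, `z² = x³ + i x⁴`. -/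
def toComplex (W : Matrix (Fin 4) (Fin 4) ℝ) : Matrix (Fin 2) (Fin 2) ℂ :=
  !![(W 0 0 : ℂ) + Complex.I * W 1 0, (W 0 2 : ℂ) + Complex.I * W 1 2;
     (W 2 0 : ℂ) + Complex.I * W 3 0, (W 2 2 : ℂ) + Complex.I * W 3 2]

/-- The anti-self-dual part `𝐰` of the Levi-Civita connection: the anti-self-dual part
`½ (w - ⋆w)` of the `𝔰𝔬(4)`-valued form `w` commutes with the complex structure and has no trace,
which makes it an `𝔰𝔲(2)`-valued form acting on `ℂ² ∋ (α, β)`. -/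
def asdLeviCivita (Ψ : C2Form) : M2Form := fun y μ =>
  toComplex ((1 / 2 : ℝ) • (leviCivita Ψ y μ - hodge (leviCivita Ψ y μ)))

/-! ### The Lagrangian and its variation -/

/-- `X ∈ 𝔰𝔲(2)`. -/
def IsSu2 (X : Matrix (Fin 2) (Fin 2) ℂ) : Prop := Xᴴ = -X ∧ X.trace = 0

/-- The curvature `F = dA + A ∧ A`. -/
def curv (A : M2Form) (y : E4) : Fin 4 → Fin 4 → Matrix (Fin 2) (Fin 2) ℂ :=
  fun μ ν => d1M A y μ ν + w11 (A y) (A y) μ ν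

/-- The `4`-form `Ψ† ∧ F ∧ Ψ` (a `1 × 1` matrix). -/
def psiFpsi (Ψ : C2Form) (A : M2Form) (y : E4) : Matrix (Fin 1) (Fin 1) ℂ :=
  w31 (w12 (dag Ψ y) (curv A y) : Fin 4 → Fin 4 → Fin 4 → Matrix (Fin 1) (Fin 2) ℂ) (Ψ y)

/-- The Lagrangian `4`-form `Tr(λ Ψ†FΨ + μ da Ψ†Ψ + ν (Ψ†Ψ)²)`, on `(∂_0, ∂_1, ∂_2, ∂_3)`. -/
def lagrangian (lam mu nu : ℝ) (Ψ : C2Form) (a : E4 → Fin 4 → ℂ) (A : M2Form) (y : E4) : ℂ :=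
  Matrix.trace ((lam : ℂ) • psiFpsi Ψ A y
    + (mu : ℂ) • (w22 (fun μ ν => !![d1 a y μ ν]) (dagPsi Ψ y) : Matrix (Fin 1) (Fin 1) ℂ)
    + (nu : ℂ) • (w22 (dagPsi Ψ y) (dagPsi Ψ y) : Matrix (Fin 1) (Fin 1) ℂ))

/-- The left hand side `dΣ + B ∧ Σ - Σ ∧ B` at the point `y`, where `B` is the value of an
`𝔰𝔲(2)`-connection at `y`; no derivative of the connection enters. -/
def elForm (Ψ : C2Form) (y : E4) (B : Fin 4 → Matrix (Fin 2) (Fin 2) ℂ) :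
    Fin 4 → Fin 4 → Fin 4 → Matrix (Fin 2) (Fin 2) ℂ :=
  fun μ ν ρ => d2M (sigma Ψ) y μ ν ρ + w12 B (sigma Ψ y) μ ν ρ - w21 (sigma Ψ y) B μ ν ρ

/-- `δ` is a variation of an `SU(2)` connection on the open set `V`: a smooth `𝔰𝔲(2)`-valued
`1`-form with compact support in `V`. -/
def IsVariation (V : Set E4) (δ : M2Form) : Prop :=
  (∀ μ c d, ContDiff ℝ ∞ fun y => δ y μ c d) ∧ (∀ y μ, IsSu2 (δ y μ)) ∧
    ∃ K : Set E4, IsCompact K ∧ K ⊆ V ∧ ∀ y, y ∉ K → ∀ μ, δ y μ = 0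

/-- The change `S[A + δ] - S[A]` of the action under a variation with support in `V`. -/
def actionChange (lam mu nu : ℝ) (V : Set E4) (Ψ : C2Form) (a : E4 → Fin 4 → ℂ) (A δ : M2Form) :
    ℂ :=
  ∫ y in V, (orient Ψ y : ℂ) *
    (lagrangian lam mu nu Ψ a (fun z μ => A z μ + δ z μ) y - lagrangian lam mu nu Ψ a A y)

/-! ### Global objects on a four-manifold -/

section Global

variable {M : Type*} [TopologicalSpace M]

/-- The transition function `φ_j ∘ φ_i⁻¹`. -/
def transition (chart : ℕ → OpenPartialHomeomorph M E4) (i j : ℕ) (y : E4) : E4 :=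
  chart j ((chart i).symm y)

/-- The image of `U_i ∩ U_j` under `φ_i`. -/
def overlap (chart : ℕ → OpenPartialHomeomorph M E4) (i j : ℕ) : Set E4 :=
  {y | y ∈ (chart i).target ∧ (chart i).symm y ∈ (chart j).source}

/-- The integral over `M` of a family of densities `f i` in the charts of a countable atlas: `M` is
cut into the disjoint measurable pieces `U_i \ (U_0 ∪ ⋯ ∪ U_{i-1})`.  When the `f i` are
`± (4-form on coordinate vectors)` with the sign of an orientation, this is the integral of the
`4`-form over the oriented manifold. -/
def atlasIntegral (chart : ℕ → OpenPartialHomeomorph M E4) (f : ℕ → E4 → ℂ) : ℂ :=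
  ∫ p in {p : ℕ × E4 | p.2 ∈ (chart p.1).target ∧
      ∀ m < p.1, (chart p.1).symm p.2 ∉ (chart m).source},
    f p.1 p.2 ∂((Measure.count : Measure ℕ).prod (volume : Measure E4))

/-- A `U(2)`-structure on the four-manifold `M`, in local gauges: a countable atlas by charts
`φ_i : U_i → ℝ⁴` of the smooth structure, on each of them a smooth `ℂ²`-valued coframe `Ψ_i`, and on
the overlaps smooth `U(2)`-valued functions with `Ψ_i = u_{ij} Ψ_j`. -/
structure U2Structure (M : Type*) [TopologicalSpace M] [ChartedSpace E4 M] where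
  chart : ℕ → OpenPartialHomeomorph M E4
  chart_mem : ∀ i, chart i ∈ IsManifold.maximalAtlas (𝓡 4) ∞ M
  cover : ∀ x, ∃ i, x ∈ (chart i).source
  Psi : ℕ → C2Form
  smooth : ∀ i μ c, ContDiffOn ℝ ∞ (fun y => Psi i y μ c 0) (chart i).target
  nondeg : ∀ i, ∀ y ∈ (chart i).target, (coframe (Psi i) y).det ≠ 0
  trans : ℕ → ℕ → E4 → Matrix (Fin 2) (Fin 2) ℂ
  trans_smooth : ∀ i j c d, ContDiffOn ℝ ∞ (fun y => trans i j y c d) (overlap chart i j)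
  trans_unitary : ∀ i j, ∀ y ∈ overlap chart i j, trans i j y ∈ Matrix.unitaryGroup (Fin 2) ℂ
  glue : ∀ i j, ∀ y ∈ overlap chart i j, ∀ μ,
    Psi i y μ = trans i j y * pull1 (transition chart i j) (Psi j) y μ

variable [ChartedSpace E4 M]

/-- The trace-free part of a `2 × 2` matrix. -/
def traceFree (X : Matrix (Fin 2) (Fin 2) ℂ) : Matrix (Fin 2) (Fin 2) ℂ :=
  X - (X.trace / 2) • (1 : Matrix (Fin 2) (Fin 2) ℂ)

/-- `A` is the `SU(2)` part of a smooth `U(2)` connection: in each gauge an `𝔰𝔲(2)`-valued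
`1`-form, and `A_i` is the trace-free part of `u A_j u⁻¹ - du u⁻¹`, `u = u_{ij}`, on overlaps. -/
def IsSU2Connection (P : U2Structure M) (A : ℕ → M2Form) : Prop :=
  (∀ i μ c d, ContDiffOn ℝ ∞ (fun y => A i y μ c d) (P.chart i).target) ∧
  (∀ i, ∀ y ∈ (P.chart i).target, ∀ μ, IsSu2 (A i y μ)) ∧
  ∀ i j, ∀ y ∈ overlap P.chart i j, ∀ μ,
    A i y μ = traceFree
      (P.trans i j y * pull1 (transition P.chart i j) (A j) y μ * (P.trans i j y)ᴴ
        - Matrix.of (fun c d => pd μ (fun z => P.trans i j z c d) y) * (P.trans i j y)ᴴ)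

/-- `a` is the `U(1)` part of a smooth `U(2)` connection, given by its local potentials: imaginary
`1`-forms that change by closed forms between gauges, so that the curvature `da` is a global
`2`-form. -/
def IsU1Connection (P : U2Structure M) (a : ℕ → E4 → Fin 4 → ℂ) : Prop :=
  (∀ i μ, ContDiffOn ℝ ∞ (fun y => a i y μ) (P.chart i).target) ∧
  (∀ i, ∀ y ∈ (P.chart i).target, ∀ μ, (a i y μ).re = 0) ∧
  ∀ i j, ∀ y ∈ overlap P.chart i j,
    d1 (a i) y = pull2 (transition P.chart i j) (d1 (a j)) y

/-- The action `S[A, a, Ψ] = ∫_M Tr(λ Ψ†FΨ + μ da Ψ†Ψ + ν (Ψ†Ψ)²)`. -/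
def action (lam mu nu : ℝ) (P : U2Structure M) (a : ℕ → E4 → Fin 4 → ℂ) (A : ℕ → M2Form) : ℂ :=
  atlasIntegral P.chart fun i y =>
    (orient (P.Psi i) y : ℂ) * lagrangian lam mu nu (P.Psi i) (a i) (A i) y

/-- `A` satisfies the Euler-Lagrange equation for variations of the `SU(2)` connection: the action
is stationary under every variation with compact support in one of the gauge patches. -/
def IsStationary (lam mu nu : ℝ) (P : U2Structure M) (a : ℕ → E4 → Fin 4 → ℂ) (A : ℕ → M2Form) :
    Prop :=
  ∀ i, ∀ δ, IsVariation (P.chart i).target δ →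
    HasDerivAt (fun t : ℝ => actionChange lam mu nu (P.chart i).target (P.Psi i) (a i) (A i)
      (fun y μ => (t : ℂ) • δ y μ)) 0 0

/-- The functional `S[g, ω, a] = -λ ∫_M (dV (s + 2 μ̃ - 6) - 2 μ̃ ω ∧ i da)` of a metric `g`, a
`2`-form `ω` and an imaginary `1`-form `a`, given by components in the charts of an atlas.  Here
`dV` is the Riemannian volume and `M` is oriented by `ω ∧ ω`. -/
def gwAction (chart : ℕ → OpenPartialHomeomorph M E4) (lam mt : ℝ)
    (g om : ℕ → E4 → Matrix (Fin 4) (Fin 4) ℝ) (a : ℕ → E4 → Fin 4 → ℂ) : ℂ :=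
  -(lam : ℂ) * atlasIntegral chart fun i y =>
    ((Real.sqrt (g i y).det * (scalarCurv (g i) y + 2 * mt - 6) : ℝ) : ℂ)
      - 2 * (mt : ℂ) * ((Real.sign (w22 (om i y) (om i y)) : ℝ) : ℂ)
        * w22 (fun μ ν => (om i y μ ν : ℂ)) (fun μ ν => Complex.I * d1 (a i) y μ ν)

end Global

/-- `(g, ω)` is a smooth compatible pair on `V`: `g` is a Riemannian metric and `ω` a `2`-form with
`ω_{μα} g^{αβ} ω_{βν} = -g_{μν}`. -/
structure IsCompatiblePair (V : Set E4) (g om : E4 → Matrix (Fin 4) (Fin 4) ℝ) : Prop where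
  smooth_g : ∀ μ ν, ContDiffOn ℝ ∞ (fun y => g y μ ν) V
  smooth_om : ∀ μ ν, ContDiffOn ℝ ∞ (fun y => om y μ ν) V
  posDef : ∀ y ∈ V, (g y).PosDef
  skew : ∀ y ∈ V, (om y)ᵀ = -om y
  compat : ∀ y ∈ V, om y * (g y)⁻¹ * om y = -g y

end U2Gravity

end

/-! Variation in `A`. For trace-free `F` one has `Tr Ψ†FΨ = -Tr(F ∧ Σ)`, and the curvature of `A +
tδ` is `F + t d_Aδ + t² δ∧δ`. Since `Tr(d_Aδ ∧ Σ) = d Tr(δ ∧ Σ) + Tr(δ ∧ (dΣ + A∧Σ - Σ∧A))`, Stokes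
on a gauge patch makes the change of the action an exact quadratic polynomial in `t`
(`actionChange_eq`). Bump-function variations and the definiteness of `Tr X²` on `𝔰𝔲(2)` then give
the Euler-Lagrange equation pointwise (`elForm_eq_zero_of_integral`).

Solving it. A skew real `4 × 4` matrix acts on `ℂ²` as its anti-self-dual part, which lies in
`𝔰𝔲(2)`, plus a map `v ↦ b v + c ε v̄` with `b` imaginary, which is its self-dual part (`skew_act`).
Hence the structure equation `de = -w∧e` becomes `dΨ = -(𝐰∧Ψ + b∧Ψ + c∧εΨ̄)`. The terms in `b` and
`c` drop out of `dΣ`, and the `𝔰𝔲(2)` term acts on `Σ` by the commutator, so `𝐰` is a solution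
(`TorsionFree.elForm_eq_zero`). In the frame dual to `e^I` the form `Σ` has constant components, and
the homogeneous equation is a system of twelve real equations in twelve real unknowns with only the
zero solution (`eq_zero_of_elLin`). This uniqueness also yields the gauge law of `𝐰`: the displayed
form of `dΨ` survives pull-back and `U(2)` gauge changes with modified `b` and `c`, so the
transformed potential solves the same equation as `𝐰` in the other gauge.

Substitution. The anti-self-dual projection is a Lie algebra homomorphism on `𝔰𝔬(4)`, so `F(𝐰)` is
the projection of the Riemann curvature (`curv_asdLeviCivita`), while `Σ` is twice the projection of
`e^I ∧ e^J`. Their pairing is the `ε`-contraction defining `s dV` minus `∑ R^{IJ} ∧ e^I ∧ e^J` over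
`I < J`; the first Bianchi identity kills the latter (`trace_psiFpsi`). The relation `8ν = 2μ - 6λ`
gives the constant term.

The pair `(g, ω)` is the real and imaginary part of the Hermitian matrix `H = g - iω`, and `H` is,
up to transposition, the Gram matrix of the `2 × 4` matrix of components of `Ψ`. Equal Gram matrices
differ by a unitary (`exists_unitary_of_herm_eq`). Conversely, compatibility says `H g⁻¹ H = 2H`, so
`½ g⁻¹ H` is an idempotent, of trace two; two Cholesky steps write `H` as a sum of two rank-one
terms depending smoothly on the point, and these are the rows of `Ψ`
(`IsCompatiblePair.exists_coframe`). -/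

namespace U2Gravity

/-! ### Calculus of coordinate partial derivatives. -/

section Calculus

variable {V : Type*} [NormedAddCommGroup V] [NormedSpace ℝ V]

theorem pd_congr {f g : E4 → V} {y : E4} (h : f =ᶠ[nhds y] g) (μ : Fin 4) :
    pd μ f y = pd μ g y := by
  unfold pd; rw [h.fderiv_eq]

theorem pd_congr_on {f g : E4 → V} {U : Set E4} (hU : IsOpen U) (h : ∀ z ∈ U, f z = g z) {y : E4}
    (hy : y ∈ U) (μ : Fin 4) : pd μ f y = pd μ g y :=
  pd_congr (Filter.eventuallyEq_of_mem (hU.mem_nhds hy) h) μ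

theorem pd_const (μ : Fin 4) (c : V) (y : E4) : pd μ (fun _ => c) y = 0 := by
  simp [pd]

theorem pd_add {f g : E4 → V} {y : E4} (hf : DifferentiableAt ℝ f y)
    (hg : DifferentiableAt ℝ g y) (μ : Fin 4) :
    pd μ (fun z => f z + g z) y = pd μ f y + pd μ g y := by
  unfold pd; rw [fderiv_fun_add hf hg]; rfl

theorem pd_sub {f g : E4 → V} {y : E4} (hf : DifferentiableAt ℝ f y)
    (hg : DifferentiableAt ℝ g y) (μ : Fin 4) :
    pd μ (fun z => f z - g z) y = pd μ f y - pd μ g y := by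
  unfold pd; rw [fderiv_fun_sub hf hg]; rfl

theorem pd_neg (f : E4 → V) (y : E4) (μ : Fin 4) :
    pd μ (fun z => -f z) y = -pd μ f y := by
  unfold pd; rw [fderiv_fun_neg]; rfl

theorem pd_sum {ι : Type*} (s : Finset ι) {f : ι → E4 → V} {y : E4}
    (hf : ∀ i ∈ s, DifferentiableAt ℝ (f i) y) (μ : Fin 4) :
    pd μ (fun z => ∑ i ∈ s, f i z) y = ∑ i ∈ s, pd μ (f i) y := by
  unfold pd; rw [fderiv_fun_sum hf]; simp

theorem pd_mul {𝔸 : Type*} [NormedCommRing 𝔸] [NormedAlgebra ℝ 𝔸] {f g : E4 → 𝔸} {y : E4}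
    (hf : DifferentiableAt ℝ f y) (hg : DifferentiableAt ℝ g y) (μ : Fin 4) :
    pd μ (fun z => f z * g z) y = pd μ f y * g y + f y * pd μ g y := by
  unfold pd; rw [fderiv_fun_mul hf hg]; simp [add_comm, mul_comm]

theorem pd_const_mul {𝔸 : Type*} [NormedCommRing 𝔸] [NormedAlgebra ℝ 𝔸] {g : E4 → 𝔸} {y : E4}
    (c : 𝔸) (hg : DifferentiableAt ℝ g y) (μ : Fin 4) :
    pd μ (fun z => c * g z) y = c * pd μ g y := by
  rw [pd_mul (differentiableAt_const c) hg, pd_const, zero_mul, zero_add]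

theorem pd_smul {f : E4 → ℝ} {g : E4 → V} {y : E4} (hf : DifferentiableAt ℝ f y)
    (hg : DifferentiableAt ℝ g y) (μ : Fin 4) :
    pd μ (fun z => f z • g z) y = pd μ f y • g y + f y • pd μ g y := by
  unfold pd; rw [fderiv_fun_smul hf hg]; simp [add_comm]

theorem pd_clm {W : Type*} [NormedAddCommGroup W] [NormedSpace ℝ W] (L : V →L[ℝ] W) {f : E4 → V}
    {y : E4} (hf : DifferentiableAt ℝ f y) (μ : Fin 4) :
    pd μ (fun z => L (f z)) y = L (pd μ f y) := by
  unfold pd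
  rw [show (fun z => L (f z)) = L ∘ f from rfl, fderiv_comp _ L.differentiableAt hf]
  simp

theorem pd_star {f : E4 → ℂ} {y : E4} (hf : DifferentiableAt ℝ f y) (μ : Fin 4) :
    pd μ (fun z => star (f z)) y = star (pd μ f y) :=
  pd_clm (Complex.conjCLE : ℂ →L[ℝ] ℂ) hf μ

theorem pd_re {f : E4 → ℂ} {y : E4} (hf : DifferentiableAt ℝ f y) (μ : Fin 4) :
    pd μ (fun z => (f z).re) y = (pd μ f y).re :=
  pd_clm Complex.reCLM hf μ

theorem pd_im {f : E4 → ℂ} {y : E4} (hf : DifferentiableAt ℝ f y) (μ : Fin 4) :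
    pd μ (fun z => (f z).im) y = (pd μ f y).im :=
  pd_clm Complex.imCLM hf μ

theorem pd_ofReal {f : E4 → ℝ} {y : E4} (hf : DifferentiableAt ℝ f y) (μ : Fin 4) :
    pd μ (fun z => (f z : ℂ)) y = ((pd μ f y : ℝ) : ℂ) :=
  pd_clm Complex.ofRealCLM hf μ

theorem pd_comp {f : E4 → V} {τ : E4 → E4} {y : E4} (hf : DifferentiableAt ℝ f (τ y))
    (hτ : DifferentiableAt ℝ τ y) (μ : Fin 4) :
    pd μ (fun z => f (τ z)) y = ∑ κ, pd μ (fun z => τ z κ) y • pd κ f (τ y) := by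
  have h1 : ∀ κ, pd μ (fun z => τ z κ) y = (fderiv ℝ τ y (EuclideanSpace.single μ 1)) κ := fun κ =>
    pd_clm (EuclideanSpace.proj κ : E4 →L[ℝ] ℝ) hτ μ
  have h2 : ∀ v : E4, fderiv ℝ f (τ y) v = ∑ κ, v κ • pd κ f (τ y) := by
    intro v
    conv_lhs => rw [show v = ∑ κ, v κ • EuclideanSpace.single κ (1 : ℝ) by
      ext i; simp [Finset.sum_apply, Pi.single_apply]]
    rw [map_sum]
    simp [pd]
  simp only [h1]
  rw [← h2]
  unfold pd
  rw [show (fun z => f (τ z)) = f ∘ τ from rfl, fderiv_comp _ hf hτ]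
  rfl

theorem pd_comm {f : E4 → V} {y : E4} (hf : ContDiffAt ℝ ∞ f y) (μ ν : Fin 4) :
    pd μ (pd ν f) y = pd ν (pd μ f) y := by
  have hs : IsSymmSndFDerivAt ℝ f y := hf.isSymmSndFDerivAt (by
    rw [minSmoothness_of_isRCLikeNormedField]; exact WithTop.coe_le_coe.2 (le_top : (2 : ℕ∞) ≤ ⊤))
  have hd : DifferentiableAt ℝ (fderiv ℝ f) y :=
    (hf.fderiv_right (m := 1) (WithTop.coe_le_coe.2 (le_top : (2 : ℕ∞) ≤ ⊤))).differentiableAt (by simp)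
  have key : ∀ μ ν : Fin 4, pd μ (pd ν f) y
      = fderiv ℝ (fderiv ℝ f) y (EuclideanSpace.single μ 1) (EuclideanSpace.single ν 1) := by
    intro μ ν
    exact pd_clm (ContinuousLinearMap.apply ℝ V (EuclideanSpace.single ν (1 : ℝ))) hd μ
  rw [key, key, hs]

theorem contDiffOn_pd {f : E4 → V} {U : Set E4} (hf : ContDiffOn ℝ ∞ f U) (hU : IsOpen U)
    (μ : Fin 4) : ContDiffOn ℝ ∞ (pd μ f) U :=
  (hf.fderiv_of_isOpen hU (by simp)).clm_apply contDiffOn_const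

theorem differentiableAt_of_contDiffOn {f : E4 → V} {U : Set E4} (hf : ContDiffOn ℝ ∞ f U)
    (hU : IsOpen U) {y : E4} (hy : y ∈ U) : DifferentiableAt ℝ f y :=
  (hf.contDiffAt (hU.mem_nhds hy)).differentiableAt (by simp)

end Calculus

/-! ### Entrywise calculus of matrix-valued functions. -/

section MatrixCalculus

variable {𝕜 : Type*} [RCLike 𝕜] {l m n : Type*} [Fintype m]

/-- The entrywise partial derivative of a matrix-valued function. -/
noncomputable def pdM (μ : Fin 4) (F : E4 → Matrix l n 𝕜) (y : E4) : Matrix l n 𝕜 :=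
  Matrix.of fun i j => pd μ (fun z => F z i j) y

/-- A matrix-valued function with smooth entries. -/
def SmoothM (U : Set E4) (F : E4 → Matrix l n 𝕜) : Prop :=
  ∀ i j, ContDiffOn ℝ ∞ (fun y => F y i j) U

/-- A matrix-valued function with differentiable entries. -/
def DiffM (y : E4) (F : E4 → Matrix l n 𝕜) : Prop :=
  ∀ i j, DifferentiableAt ℝ (fun y => F y i j) y

theorem SmoothM.diffM {U : Set E4} {F : E4 → Matrix l n 𝕜} (h : SmoothM U F) (hU : IsOpen U)
    {y : E4} (hy : y ∈ U) : DiffM y F := fun i j => differentiableAt_of_contDiffOn (h i j) hU hy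

theorem SmoothM.pdM {U : Set E4} {F : E4 → Matrix l n 𝕜} (h : SmoothM U F) (hU : IsOpen U)
    (μ : Fin 4) : SmoothM U (pdM μ F) := fun i j => contDiffOn_pd (h i j) hU μ

theorem SmoothM.mul {U : Set E4} {F : E4 → Matrix l m 𝕜} {G : E4 → Matrix m n 𝕜}
    (hF : SmoothM U F) (hG : SmoothM U G) : SmoothM U (fun y => F y * G y) := fun i j => by
  simp only [Matrix.mul_apply]
  exact ContDiffOn.sum fun k _ => (hF i k).mul (hG k j)

theorem SmoothM.add {U : Set E4} {F G : E4 → Matrix l n 𝕜}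
    (hF : SmoothM U F) (hG : SmoothM U G) : SmoothM U (fun y => F y + G y) := fun i j =>
  (hF i j).add (hG i j)

theorem SmoothM.sub {U : Set E4} {F G : E4 → Matrix l n 𝕜}
    (hF : SmoothM U F) (hG : SmoothM U G) : SmoothM U (fun y => F y - G y) := fun i j =>
  (hF i j).sub (hG i j)

theorem SmoothM.conjTranspose {U : Set E4} {F : E4 → Matrix l n ℂ} (hF : SmoothM U F) :
    SmoothM U (fun y => (F y)ᴴ) := fun i j =>
  (Complex.conjCLE : ℂ →L[ℝ] ℂ).contDiff.comp_contDiffOn (hF j i)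

theorem pdM_mul {y : E4} {F : E4 → Matrix l m 𝕜} {G : E4 → Matrix m n 𝕜} (hF : DiffM y F)
    (hG : DiffM y G) (μ : Fin 4) :
    pdM μ (fun z => F z * G z) y = pdM μ F y * G y + F y * pdM μ G y := by
  ext i j
  simp only [pdM, Matrix.of_apply, Matrix.mul_apply, Matrix.add_apply]
  rw [pd_sum Finset.univ (f := fun k z => F z i k * G z k j)
    (fun k _ => (hF i k).mul (hG k j)), ← Finset.sum_add_distrib]
  exact Finset.sum_congr rfl fun k _ => pd_mul (hF i k) (hG k j) μ

theorem pdM_sub {y : E4} {F G : E4 → Matrix l n 𝕜} (hF : DiffM y F)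
    (hG : DiffM y G) (μ : Fin 4) :
    pdM μ (fun z => F z - G z) y = pdM μ F y - pdM μ G y := by
  ext i j
  exact pd_sub (hF i j) (hG i j) μ

theorem pdM_congr_on {F G : E4 → Matrix l n 𝕜} {U : Set E4} (hU : IsOpen U)
    (h : ∀ z ∈ U, F z = G z) {y : E4} (hy : y ∈ U) (μ : Fin 4) : pdM μ F y = pdM μ G y := by
  ext i j
  exact pd_congr_on hU (fun z hz => by rw [h z hz]) hy μ

theorem pdM_const (C : Matrix l n 𝕜) (y : E4) (μ : Fin 4) : pdM μ (fun _ => C) y = 0 := by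
  ext i j
  exact pd_const μ _ y

theorem pdM_transpose (F : E4 → Matrix l n 𝕜) (y : E4) (μ : Fin 4) :
    pdM μ (fun z => (F z)ᵀ) y = (pdM μ F y)ᵀ := rfl

theorem pdM_conjTranspose {F : E4 → Matrix l n ℂ} {y : E4} (hF : DiffM y F) (μ : Fin 4) :
    pdM μ (fun z => (F z)ᴴ) y = (pdM μ F y)ᴴ := by
  ext i j
  exact pd_star (hF j i) μ

theorem pdM_comm {F : E4 → Matrix l n 𝕜} {U : Set E4} (h : SmoothM U F) (hU : IsOpen U) {y : E4}
    (hy : y ∈ U) (μ ν : Fin 4) : pdM μ (pdM ν F) y = pdM ν (pdM μ F) y := by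
  ext i j
  exact pd_comm ((h i j).contDiffAt (hU.mem_nhds hy)) μ ν

end MatrixCalculus

/-! ### Smoothness of the matrix inverse. -/

section SmoothInverse

variable {n : Type*} [Fintype n] [DecidableEq n]

theorem SmoothM.det {U : Set E4} {F : E4 → Matrix n n ℝ} (hF : SmoothM U F) :
    ContDiffOn ℝ ∞ (fun y => (F y).det) U := by
  simp only [Matrix.det_apply']
  exact ContDiffOn.sum fun σ _ => contDiffOn_const.mul (contDiffOn_prod fun i _ => hF _ _)

/-- Cramer's rule: each entry of the inverse is a cofactor, itself the determinant of a matrix with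
smooth entries, divided by the nowhere vanishing determinant. -/
theorem SmoothM.inv {U : Set E4} {F : E4 → Matrix n n ℝ} (hF : SmoothM U F)
    (hdet : ∀ y ∈ U, (F y).det ≠ 0) : SmoothM U (fun y => (F y)⁻¹) := by
  intro i j
  have hadj : ContDiffOn ℝ ∞ (fun y => (F y).adjugate i j) U := by
    simp only [Matrix.adjugate_apply]
    refine SmoothM.det fun k m => ?_
    by_cases hk : k = j
    · subst hk
      simp only [Matrix.updateRow_self]
      exact contDiffOn_const
    · simp only [Matrix.updateRow_ne hk]
      exact hF k m
  refine (hadj.div hF.det hdet).congr fun y _ => ?_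
  simp [Matrix.inv_def, Ring.inverse_eq_inv', div_eq_inv_mul]

end SmoothInverse

/-! ### Christoffel symbols -/

section Christoffel

variable {U : Set E4} {g : E4 → Matrix (Fin 4) (Fin 4) ℝ}

/-- The Christoffel symbols as a matrix-valued `1`-form. -/
noncomputable def gam (g : E4 → Matrix (Fin 4) (Fin 4) ℝ) (μ : Fin 4) (y : E4) :
    Matrix (Fin 4) (Fin 4) ℝ :=
  Matrix.of fun ν ρ => christoffel g ν μ ρ y

/-- Christoffel symbols of the first kind. -/
noncomputable def chris1 (g : E4 → Matrix (Fin 4) (Fin 4) ℝ) (μ : Fin 4) (y : E4) :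
    Matrix (Fin 4) (Fin 4) ℝ :=
  Matrix.of fun σ ν => (1 / 2) * (pd μ (fun z => g z σ ν) y + pd ν (fun z => g z σ μ) y
    - pd σ (fun z => g z μ ν) y)

theorem gam_eq (g : E4 → Matrix (Fin 4) (Fin 4) ℝ) (μ : Fin 4) (y : E4) :
    gam g μ y = (g y)⁻¹ * chris1 g μ y := by
  ext ν ρ
  simp only [gam, chris1, christoffel, Matrix.mul_apply, Matrix.of_apply, Finset.mul_sum]
  exact Finset.sum_congr rfl fun σ _ => by ring

theorem gam_symm (hg : ∀ z, (g z)ᵀ = g z) (ν μ ρ : Fin 4) (y : E4) :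
    gam g μ y ν ρ = gam g ρ y ν μ := by
  have h : ∀ z, g z μ ρ = g z ρ μ := fun z => by
    conv_lhs => rw [← hg z]
    rfl
  simp only [gam, christoffel, Matrix.of_apply, h]
  congr 1
  exact Finset.sum_congr rfl fun σ _ => by ring

/-- Metric compatibility `∇g = 0`. Lowering the upper index of `Γ` gives the symbols of the first
kind, in whose symmetrisation everything but `∂_μ g` cancels. -/
theorem pdM_metric (hg : ∀ z, (g z)ᵀ = g z) {y : E4} (hdet : (g y).det ≠ 0) (μ : Fin 4) :
    pdM μ g y = (gam g μ y)ᵀ * g y + g y * gam g μ y := by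
  have h : ∀ i j, (fun z => g z i j) = fun z => g z j i := fun i j => by
    funext z
    conv_lhs => rw [← hg z]
    rfl
  have hu : IsUnit (g y).det := isUnit_iff_ne_zero.2 hdet
  have h1 : g y * gam g μ y = chris1 g μ y := by
    rw [gam_eq, Matrix.mul_nonsing_inv_cancel_left _ _ hu]
  have h2 : (gam g μ y)ᵀ * g y = (chris1 g μ y)ᵀ := by
    rw [← h1, Matrix.transpose_mul, hg]
  rw [h1, h2]
  ext i j
  simp only [pdM, chris1, Matrix.of_apply, Matrix.add_apply, Matrix.transpose_apply]
  rw [h j i, h j μ, h i μ]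
  ring

theorem SmoothM.gam (hg : SmoothM U g) (hdet : ∀ y ∈ U, (g y).det ≠ 0) (hU : IsOpen U)
    (μ : Fin 4) : SmoothM U (gam g μ) := by
  have hc : SmoothM U (chris1 g μ) := fun i j =>
    contDiffOn_const.mul (((contDiffOn_pd (hg _ _) hU _).add (contDiffOn_pd (hg _ _) hU _)).sub
      (contDiffOn_pd (hg _ _) hU _))
  have := (hg.inv hdet).mul hc
  intro i j
  exact (this i j).congr fun y _ => by rw [gam_eq]

/-- The Riemann tensor as a matrix-valued `2`-form. -/
noncomputable def riemM (g : E4 → Matrix (Fin 4) (Fin 4) ℝ) (μ ν : Fin 4) (y : E4) :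
    Matrix (Fin 4) (Fin 4) ℝ :=
  Matrix.of fun ρ σ => riemann g ρ σ μ ν y

theorem riemM_eq (g : E4 → Matrix (Fin 4) (Fin 4) ℝ) (μ ν : Fin 4) (y : E4) :
    riemM g μ ν y = pdM μ (gam g ν) y - pdM ν (gam g μ) y
      + (gam g μ y * gam g ν y - gam g ν y * gam g μ y) := by
  ext ρ σ
  simp only [riemM, riemann, Matrix.of_apply, Matrix.add_apply, Matrix.sub_apply, Matrix.mul_apply,
    ← Finset.sum_sub_distrib]
  rfl

/-- The symmetry of `Γ` in its lower indices, as an identity of functions, cancels the derivative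
terms in pairs, and cancels the quadratic terms in pairs for each summation index. -/
theorem riemann_cyclic (hg : ∀ z, (g z)ᵀ = g z) (ρ σ μ ν : Fin 4) (y : E4) :
    riemann g ρ σ μ ν y + riemann g ρ μ ν σ y + riemann g ρ ν σ μ y = 0 := by
  have h : ∀ a b c, christoffel g a b c = christoffel g a c b := fun a b c => by
    funext z
    exact gam_symm hg a b c z
  have hs : ∀ κ : Fin 4,
      (christoffel g ρ μ κ y * christoffel g κ ν σ y
        - christoffel g ρ ν κ y * christoffel g κ μ σ y)
      + (christoffel g ρ ν κ y * christoffel g κ σ μ y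
        - christoffel g ρ σ κ y * christoffel g κ ν μ y)
      + (christoffel g ρ σ κ y * christoffel g κ μ ν y
        - christoffel g ρ μ κ y * christoffel g κ σ ν y) = 0 := fun κ => by
    rw [h κ ν σ, h κ μ σ, h κ ν μ]; ring
  have hsum := Finset.sum_congr (s₁ := Finset.univ) rfl fun κ _ => hs κ
  rw [Finset.sum_add_distrib, Finset.sum_add_distrib, Finset.sum_const_zero] at hsum
  simp only [riemann]
  rw [h ρ ν σ, h ρ μ σ, h ρ ν μ]
  linear_combination hsum

end Christoffel

/-! ### The Levi-Civita connection in an orthonormal coframe -/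

/-- `Ψ` is a smooth `ℂ²`-valued coframe on the open set `U`. -/
structure IsSmoothCoframe (U : Set E4) (Ψ : C2Form) : Prop where
  isOpen : IsOpen U
  smooth : ∀ μ c, ContDiffOn ℝ ∞ (fun y => Ψ y μ c 0) U
  nondeg : ∀ y ∈ U, (coframe Ψ y).det ≠ 0

theorem metric_eq (Ψ : C2Form) (y : E4) : metric Ψ y = (coframe Ψ y)ᵀ * coframe Ψ y := by
  ext μ ν
  simp [metric, coframe, Matrix.mul_apply, Fin.sum_univ_four]
  ring

theorem metric_symm (Ψ : C2Form) (y : E4) : (metric Ψ y)ᵀ = metric Ψ y := by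
  rw [metric_eq, Matrix.transpose_mul, Matrix.transpose_transpose]

theorem det_metric (Ψ : C2Form) (y : E4) : (metric Ψ y).det = (coframe Ψ y).det ^ 2 := by
  rw [metric_eq, Matrix.det_mul, Matrix.det_transpose, sq]

section LeviCivita

variable {U : Set E4} {Ψ : C2Form}

theorem leviCivita_eq (Ψ : C2Form) (y : E4) (μ : Fin 4) :
    leviCivita Ψ y μ = coframe Ψ y * (pdM μ (fun z => (coframe Ψ z)⁻¹) y
      + gam (metric Ψ) μ y * (coframe Ψ y)⁻¹) := by
  ext I J
  simp only [leviCivita, Matrix.of_apply, Matrix.mul_apply, Matrix.add_apply]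
  rfl

namespace IsSmoothCoframe

variable (h : IsSmoothCoframe U Ψ)
include h

theorem smooth_coframe : SmoothM U (coframe Ψ) := by
  intro I μ
  have hre : ∀ c, ContDiffOn ℝ ∞ (fun y => (Ψ y μ c 0).re) U := fun c =>
    Complex.reCLM.contDiff.comp_contDiffOn (h.smooth μ c)
  have him : ∀ c, ContDiffOn ℝ ∞ (fun y => (Ψ y μ c 0).im) U := fun c =>
    Complex.imCLM.contDiff.comp_contDiffOn (h.smooth μ c)
  fin_cases I
  exacts [hre 0, him 0, hre 1, him 1]

theorem smooth_inv : SmoothM U (fun y => (coframe Ψ y)⁻¹) := h.smooth_coframe.inv h.nondeg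

theorem smooth_metric : SmoothM U (metric Ψ) := by
  have ht : SmoothM U fun y => (coframe Ψ y)ᵀ := fun i j => h.smooth_coframe j i
  intro i j
  exact (ht.mul h.smooth_coframe i j).congr fun y _ => by rw [metric_eq]

theorem det_metric_ne {y : E4} (hy : y ∈ U) : (metric Ψ y).det ≠ 0 := by
  rw [det_metric]; exact pow_ne_zero _ (h.nondeg y hy)

theorem smooth_gam (μ : Fin 4) : SmoothM U (gam (metric Ψ) μ) :=
  h.smooth_metric.gam (fun _ hy => h.det_metric_ne hy) h.isOpen μ

theorem smooth_leviCivita (μ : Fin 4) : SmoothM U (fun y => leviCivita Ψ y μ) := by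
  have := h.smooth_coframe.mul ((h.smooth_inv.pdM h.isOpen μ).add
    ((h.smooth_gam μ).mul h.smooth_inv))
  intro i j
  exact (this i j).congr fun y _ => congrFun₂ (leviCivita_eq Ψ y μ) i j

theorem mul_inv {y : E4} (hy : y ∈ U) : coframe Ψ y * (coframe Ψ y)⁻¹ = 1 :=
  Matrix.mul_nonsing_inv _ (isUnit_iff_ne_zero.2 (h.nondeg y hy))

theorem inv_mul {y : E4} (hy : y ∈ U) : (coframe Ψ y)⁻¹ * coframe Ψ y = 1 :=
  Matrix.nonsing_inv_mul _ (isUnit_iff_ne_zero.2 (h.nondeg y hy))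

theorem coframe_mul_pdM_inv {y : E4} (hy : y ∈ U) (μ : Fin 4) :
    coframe Ψ y * pdM μ (fun z => (coframe Ψ z)⁻¹) y
      = -(pdM μ (coframe Ψ) y * (coframe Ψ y)⁻¹) := by
  have h1 := pdM_mul (h.smooth_coframe.diffM h.isOpen hy) (h.smooth_inv.diffM h.isOpen hy) μ
  rw [pdM_congr_on h.isOpen (fun z hz => h.mul_inv hz) hy, pdM_const] at h1
  exact eq_neg_of_add_eq_zero_right h1.symm

/-- The total covariant derivative of the coframe vanishes: `∂e + w e - e Γ = 0`. Skewness,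
vanishing torsion and the comparison of curvatures all start from this form. -/
theorem leviCivita_mul_coframe {y : E4} (hy : y ∈ U) (μ : Fin 4) :
    leviCivita Ψ y μ * coframe Ψ y
      = coframe Ψ y * gam (metric Ψ) μ y - pdM μ (coframe Ψ) y := by
  rw [leviCivita_eq, Matrix.mul_add, h.coframe_mul_pdM_inv hy, Matrix.add_mul, Matrix.neg_mul,
    Matrix.mul_assoc, h.inv_mul hy, Matrix.mul_one, ← Matrix.mul_assoc, Matrix.mul_assoc _ _
    (coframe Ψ y), h.inv_mul hy, Matrix.mul_one]
  abel

/-- Comparing `∂(eᵀe)`, computed by the product rule, with `∂g = Γᵀg + gΓ` gives `eᵀ(w + wᵀ)e = 0`,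
and `e` is invertible. -/
theorem leviCivita_skew {y : E4} (hy : y ∈ U) (μ : Fin 4) :
    (leviCivita Ψ y μ)ᵀ = -leviCivita Ψ y μ := by
  have hw := h.leviCivita_mul_coframe hy μ
  have hg := pdM_metric (metric_symm Ψ) (h.det_metric_ne hy) μ
  have hd := h.smooth_coframe.diffM h.isOpen hy
  have hdt : DiffM y fun z => (coframe Ψ z)ᵀ := fun i j => hd j i
  have hg' : pdM μ (metric Ψ) y = (pdM μ (coframe Ψ) y)ᵀ * coframe Ψ y
      + (coframe Ψ y)ᵀ * pdM μ (coframe Ψ) y := by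
    rw [show metric Ψ = fun z => (coframe Ψ z)ᵀ * coframe Ψ z from funext (metric_eq Ψ),
      pdM_mul hdt hd, pdM_transpose]
  rw [hg', metric_eq] at hg
  set e := coframe Ψ y
  set w := leviCivita Ψ y μ
  have key : eᵀ * (w + wᵀ) * e = 0 := by
    have ht : eᵀ * wᵀ = (gam (metric Ψ) μ y)ᵀ * eᵀ - (pdM μ (coframe Ψ) y)ᵀ := by
      rw [← Matrix.transpose_mul, hw, Matrix.transpose_sub, Matrix.transpose_mul]
    rw [Matrix.mul_add, Matrix.add_mul, ht, Matrix.mul_assoc, hw, Matrix.mul_sub, Matrix.sub_mul,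
      ← Matrix.mul_assoc, Matrix.mul_assoc _ eᵀ e]
    rw [← Matrix.mul_assoc] at hg
    have := sub_eq_zero.2 hg
    rw [← neg_eq_zero, ← this]
    simp only [Matrix.mul_assoc]
    abel
  have hi := h.mul_inv hy
  have hit : (e⁻¹)ᵀ * eᵀ = 1 := by rw [← Matrix.transpose_mul, hi, Matrix.transpose_one]
  have : w + wᵀ = (e⁻¹)ᵀ * (eᵀ * (w + wᵀ) * e) * e⁻¹ := by
    rw [Matrix.mul_assoc eᵀ, ← Matrix.mul_assoc (e⁻¹)ᵀ, hit, Matrix.one_mul, Matrix.mul_assoc, hi,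
      Matrix.mul_one]
  rw [key, Matrix.mul_zero, Matrix.zero_mul] at this
  exact eq_neg_of_add_eq_zero_right this

/-- Antisymmetrising `∂e + w e - e Γ = 0` in the form indices removes the symmetric `Γ`. -/
theorem torsion_free {y : E4} (hy : y ∈ U) (μ ν I : Fin 4) :
    pd μ (fun z => coframe Ψ z I ν) y - pd ν (fun z => coframe Ψ z I μ) y
      = -((leviCivita Ψ y μ * coframe Ψ y) I ν - (leviCivita Ψ y ν * coframe Ψ y) I μ) := by
  have hs : (coframe Ψ y * gam (metric Ψ) μ y) I ν = (coframe Ψ y * gam (metric Ψ) ν y) I μ := by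
    simp only [Matrix.mul_apply]
    exact Finset.sum_congr rfl fun κ _ => by rw [gam_symm (metric_symm Ψ)]
  rw [h.leviCivita_mul_coframe hy, h.leviCivita_mul_coframe hy, Matrix.sub_apply,
    Matrix.sub_apply, hs]
  simp [pdM]

end IsSmoothCoframe

/-- The curvature of the Levi-Civita connection as a matrix-valued `2`-form. -/
noncomputable def lcCurvM (Ψ : C2Form) (y : E4) (μ ν : Fin 4) : Matrix (Fin 4) (Fin 4) ℝ :=
  Matrix.of fun I J => lcCurv Ψ y I J μ ν

theorem lcCurvM_eq (Ψ : C2Form) (y : E4) (μ ν : Fin 4) :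
    lcCurvM Ψ y μ ν = pdM μ (fun z => leviCivita Ψ z ν) y - pdM ν (fun z => leviCivita Ψ z μ) y
      + (leviCivita Ψ y μ * leviCivita Ψ y ν - leviCivita Ψ y ν * leviCivita Ψ y μ) := by
  ext I J
  simp only [lcCurvM, lcCurv, w11, d1, pdM, Matrix.of_apply, Matrix.add_apply, Matrix.sub_apply,
    Matrix.mul_apply, Finset.sum_sub_distrib]

theorem lcCurvM_antisymm (Ψ : C2Form) (y : E4) (μ ν : Fin 4) :
    lcCurvM Ψ y μ ν = -lcCurvM Ψ y ν μ := by
  rw [lcCurvM_eq, lcCurvM_eq]; abel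

namespace IsSmoothCoframe

variable (h : IsSmoothCoframe U Ψ)
include h

theorem lcCurvM_skew {y : E4} (hy : y ∈ U) (μ ν : Fin 4) :
    (lcCurvM Ψ y μ ν)ᵀ = -lcCurvM Ψ y μ ν := by
  have hp : ∀ μ ν, (pdM μ (fun z => leviCivita Ψ z ν) y)ᵀ = -pdM μ (fun z => leviCivita Ψ z ν) y := by
    intro μ ν
    rw [← pdM_transpose, pdM_congr_on h.isOpen (fun z hz => h.leviCivita_skew hz ν) hy]
    ext i j
    exact pd_neg _ _ _
  rw [lcCurvM_eq]
  simp only [Matrix.transpose_add, Matrix.transpose_sub, Matrix.transpose_mul, hp,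
    h.leviCivita_skew hy]
  simp only [Matrix.neg_mul, Matrix.mul_neg, neg_neg]
  abel

/-- Differentiating `w e = e Γ - ∂e` once more and antisymmetrising, the mixed second derivatives of
`e` cancel. So the frame curvature is the coordinate Riemann tensor conjugated by `e`. -/
theorem lcCurvM_mul_coframe {y : E4} (hy : y ∈ U) (μ ν : Fin 4) :
    lcCurvM Ψ y μ ν * coframe Ψ y = coframe Ψ y * riemM (metric Ψ) μ ν y := by
  have hd := h.smooth_coframe.diffM h.isOpen hy
  have key : ∀ μ ν, pdM μ (fun z => leviCivita Ψ z ν) y * coframe Ψ y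
      = pdM μ (coframe Ψ) y * gam (metric Ψ) ν y + coframe Ψ y * pdM μ (gam (metric Ψ) ν) y
        - pdM μ (pdM ν (coframe Ψ)) y - leviCivita Ψ y ν * pdM μ (coframe Ψ) y := by
    intro μ ν
    have h1 := pdM_mul ((h.smooth_leviCivita ν).diffM h.isOpen hy) hd μ
    rw [pdM_congr_on h.isOpen (fun z hz => h.leviCivita_mul_coframe hz ν) hy,
      pdM_sub ((h.smooth_coframe.mul (h.smooth_gam ν)).diffM h.isOpen hy)
        ((h.smooth_coframe.pdM h.isOpen ν).diffM h.isOpen hy),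
      pdM_mul hd ((h.smooth_gam ν).diffM h.isOpen hy)] at h1
    rw [h1]; abel
  have hw := fun μ => h.leviCivita_mul_coframe hy μ
  have hww : ∀ μ ν, leviCivita Ψ y μ * leviCivita Ψ y ν * coframe Ψ y
      = coframe Ψ y * (gam (metric Ψ) μ y * gam (metric Ψ) ν y)
        - pdM μ (coframe Ψ) y * gam (metric Ψ) ν y - leviCivita Ψ y μ * pdM ν (coframe Ψ) y := by
    intro μ ν
    rw [Matrix.mul_assoc, hw, Matrix.mul_sub, ← Matrix.mul_assoc, hw, Matrix.sub_mul,
      Matrix.mul_assoc]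
  rw [lcCurvM_eq, riemM_eq, Matrix.add_mul, Matrix.sub_mul, Matrix.sub_mul, key, key, hww, hww,
    pdM_comm h.smooth_coframe h.isOpen hy μ ν]
  simp only [Matrix.mul_add, Matrix.mul_sub]
  abel

/-- The first Bianchi identity `R^I_J ∧ e^J = 0`. -/
theorem bianchi {y : E4} (hy : y ∈ U) (I μ ν ρ : Fin 4) :
    (lcCurvM Ψ y μ ν * coframe Ψ y) I ρ + (lcCurvM Ψ y ν ρ * coframe Ψ y) I μ
      + (lcCurvM Ψ y ρ μ * coframe Ψ y) I ν = 0 := by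
  rw [h.lcCurvM_mul_coframe hy, h.lcCurvM_mul_coframe hy, h.lcCurvM_mul_coframe hy]
  simp only [Matrix.mul_apply, ← Finset.sum_add_distrib]
  refine Finset.sum_eq_zero fun κ _ => ?_
  have := riemann_cyclic (metric_symm Ψ) κ ρ μ ν y
  simp only [riemM, Matrix.of_apply]
  linear_combination coframe Ψ y I κ * this

end IsSmoothCoframe

end LeviCivita

/-! ### The Euler-Lagrange expression in terms of the torsion -/

/-- Coordinates on `𝔰𝔲(2)`: an imaginary `X 0 0` and a complex `X 0 1` determine `X`. Eliminating
the other entries turns identities for `𝔰𝔲(2)`-valued forms into commutative polynomial identities.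
-/
theorem IsSu2.entries {X : Matrix (Fin 2) (Fin 2) ℂ} (h : IsSu2 X) :
    X 1 1 = -X 0 0 ∧ star (X 0 0) = -X 0 0 ∧ X 1 0 = -star (X 0 1) := by
  obtain ⟨h1, h2⟩ := h
  rw [Matrix.trace_fin_two] at h2
  have h00 : star (X 0 0) = -X 0 0 := congrFun₂ h1 0 0
  have h10 : star (X 0 1) = -X 1 0 := congrFun₂ h1 1 0
  exact ⟨eq_neg_of_add_eq_zero_right h2, h00, by rw [h10, neg_neg]⟩

theorem isSu2_of_entries {X : Matrix (Fin 2) (Fin 2) ℂ} (h11 : X 1 1 = -X 0 0)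
    (h00 : star (X 0 0) = -X 0 0) (h10 : X 1 0 = -star (X 0 1)) : IsSu2 X := by
  constructor
  · ext i j
    fin_cases i <;> fin_cases j
    · exact h00
    · change star (X 1 0) = -X 0 1
      simp [h10]
    · change star (X 0 1) = -X 1 0
      simp [h10]
    · change star (X 1 1) = -X 1 1
      rw [h11, star_neg, h00]
  · rw [Matrix.trace_fin_two, h11, add_neg_cancel]

theorem matrix_ext_two {X Y : Matrix (Fin 2) (Fin 2) ℂ} (h00 : X 0 0 = Y 0 0)
    (h01 : X 0 1 = Y 0 1) (h10 : X 1 0 = Y 1 0) (h11 : X 1 1 = Y 1 1) : X = Y := by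
  ext i j
  fin_cases i <;> fin_cases j <;> assumption

/-- The antilinear map `v ↦ ε v̄` of `ℂ²` that commutes with `SU(2)`. -/
def epsConj (v : Matrix (Fin 2) (Fin 1) ℂ) : Matrix (Fin 2) (Fin 1) ℂ :=
  !![star (v 1 0); -star (v 0 0)]

/-- `dΨ = -(A ∧ Ψ + b ∧ Ψ + c ∧ ε Ψ̄)` at the point `y`: the general torsion-free connection that
preserves the metric. -/
def TorsionFree (Ψ : C2Form) (y : E4) (A : Fin 4 → Matrix (Fin 2) (Fin 2) ℂ) (b c : Fin 4 → ℂ) :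
    Prop :=
  ∀ μ ν, d1M Ψ y μ ν = -((A μ * Ψ y ν + b μ • Ψ y ν + c μ • epsConj (Ψ y ν))
    - (A ν * Ψ y μ + b ν • Ψ y μ + c ν • epsConj (Ψ y μ)))

theorem sigma_apply (Ψ : C2Form) (y : E4) (μ ν : Fin 4) (i j : Fin 2) :
    sigma Ψ y μ ν i j = Ψ y μ i 0 * star (Ψ y ν j 0) - Ψ y ν i 0 * star (Ψ y μ j 0)
      + 1 / 2 * (∑ k, (star (Ψ y μ k 0) * Ψ y ν k 0 - star (Ψ y ν k 0) * Ψ y μ k 0))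
        * (1 : Matrix (Fin 2) (Fin 2) ℂ) i j := by
  simp [sigma, dagPsi, dag, w11, Matrix.mul_apply, Fin.sum_univ_two]

theorem sigma_antisymm (Ψ : C2Form) (y : E4) (μ ν : Fin 4) : sigma Ψ y μ ν = -sigma Ψ y ν μ := by
  ext i j
  rw [Matrix.neg_apply, sigma_apply, sigma_apply]
  simp only [Fin.sum_univ_two]
  ring

theorem sigma_isSu2 (Ψ : C2Form) (y : E4) (μ ν : Fin 4) : IsSu2 (sigma Ψ y μ ν) := by
  apply isSu2_of_entries <;> simp [sigma_apply, Fin.sum_univ_two]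
  all_goals ring

theorem pd_sigma {Ψ : C2Form} {y : E4} (hd : ∀ μ c, DifferentiableAt ℝ (fun z => Ψ z μ c 0) y)
    (κ μ ν : Fin 4) (i j : Fin 2) :
    pd κ (fun z => sigma Ψ z μ ν i j) y
      = (pd κ (fun z => Ψ z μ i 0) y * star (Ψ y ν j 0)
          + Ψ y μ i 0 * star (pd κ (fun z => Ψ z ν j 0) y))
        - (pd κ (fun z => Ψ z ν i 0) y * star (Ψ y μ j 0)
          + Ψ y ν i 0 * star (pd κ (fun z => Ψ z μ j 0) y))
        + 1 / 2 * (∑ k, ((star (pd κ (fun z => Ψ z μ k 0) y) * Ψ y ν k 0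
            + star (Ψ y μ k 0) * pd κ (fun z => Ψ z ν k 0) y)
          - (star (pd κ (fun z => Ψ z ν k 0) y) * Ψ y μ k 0
            + star (Ψ y ν k 0) * pd κ (fun z => Ψ z μ k 0) y)))
          * (1 : Matrix (Fin 2) (Fin 2) ℂ) i j := by
  have hs : ∀ μ c, DifferentiableAt ℝ (fun z => star (Ψ z μ c 0)) y := fun μ c => (hd μ c).star
  have h1 : ∀ μ ν i j, DifferentiableAt ℝ (fun z => Ψ z μ i 0 * star (Ψ z ν j 0)) y :=
    fun μ ν i j => (hd μ i).mul (hs ν j)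
  have h2 : ∀ μ ν i j, DifferentiableAt ℝ (fun z => star (Ψ z μ i 0) * Ψ z ν j 0) y :=
    fun μ ν i j => (hs μ i).mul (hd ν j)
  have e1 : ∀ μ ν i j, pd κ (fun z => Ψ z μ i 0 * star (Ψ z ν j 0)) y
      = pd κ (fun z => Ψ z μ i 0) y * star (Ψ y ν j 0)
        + Ψ y μ i 0 * star (pd κ (fun z => Ψ z ν j 0) y) := fun μ ν i j => by
    rw [pd_mul (hd μ i) (hs ν j), pd_star (hd ν j)]
  have e2 : ∀ μ ν i j, pd κ (fun z => star (Ψ z μ i 0) * Ψ z ν j 0) y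
      = star (pd κ (fun z => Ψ z μ i 0) y) * Ψ y ν j 0
        + star (Ψ y μ i 0) * pd κ (fun z => Ψ z ν j 0) y := fun μ ν i j => by
    rw [pd_mul (hs μ i) (hd ν j), pd_star (hd μ i)]
  have h3 : ∀ k, DifferentiableAt ℝ
      (fun z => star (Ψ z μ k 0) * Ψ z ν k 0 - star (Ψ z ν k 0) * Ψ z μ k 0) y :=
    fun k => (h2 μ ν k k).sub (h2 ν μ k k)
  have h4 := DifferentiableAt.fun_sum (u := Finset.univ) fun k _ => h3 k
  simp only [sigma_apply]
  have e3 := pd_mul (h4.const_mul (1 / 2 : ℂ))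
    (differentiableAt_const ((1 : Matrix (Fin 2) (Fin 2) ℂ) i j)) κ
  have e4 := pd_add ((h1 μ ν i j).sub (h1 ν μ i j)) ((h4.const_mul (1 / 2 : ℂ)).mul
    (differentiableAt_const ((1 : Matrix (Fin 2) (Fin 2) ℂ) i j))) κ
  have e5 := pd_sub (h1 μ ν i j) (h1 ν μ i j) κ
  refine e4.trans ?_
  refine congrArg₂ (· + ·) (e5.trans (by rw [e1, e1])) (e3.trans ?_)
  rw [pd_const, mul_zero, add_zero, pd_const_mul _ h4, pd_sum Finset.univ fun k _ => h3 k]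
  congr 2
  exact Finset.sum_congr rfl fun k _ => by
    rw [pd_sub (h2 μ ν k k) (h2 ν μ k k), e2, e2]

/-- The derivatives of `Ψ` recombine so that only `dΨ` occurs, which is why a condition prescribing
`dΨ` determines `dΣ`. -/
theorem d2M_sigma {Ψ : C2Form} {y : E4} (hd : ∀ μ c, DifferentiableAt ℝ (fun z => Ψ z μ c 0) y)
    (μ ν ρ : Fin 4) (i j : Fin 2) :
    d2M (sigma Ψ) y μ ν ρ i j
      = (d1M Ψ y μ ν i 0 * star (Ψ y ρ j 0) - d1M Ψ y μ ρ i 0 * star (Ψ y ν j 0)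
          + d1M Ψ y ν ρ i 0 * star (Ψ y μ j 0))
        - (Ψ y μ i 0 * star (d1M Ψ y ν ρ j 0) - Ψ y ν i 0 * star (d1M Ψ y μ ρ j 0)
          + Ψ y ρ i 0 * star (d1M Ψ y μ ν j 0))
        + 1 / 2 * (∑ k, ((star (d1M Ψ y μ ν k 0) * Ψ y ρ k 0 - star (d1M Ψ y μ ρ k 0) * Ψ y ν k 0
            + star (d1M Ψ y ν ρ k 0) * Ψ y μ k 0)
          - (star (Ψ y μ k 0) * d1M Ψ y ν ρ k 0 - star (Ψ y ν k 0) * d1M Ψ y μ ρ k 0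
            + star (Ψ y ρ k 0) * d1M Ψ y μ ν k 0)))
          * (1 : Matrix (Fin 2) (Fin 2) ℂ) i j := by
  simp only [d2M, d2, d1M, d1, Matrix.of_apply, pd_sigma hd, star_sub, Fin.sum_univ_two]
  ring

/-- Infinitesimally, `Σ` is invariant under `Ψ ↦ bΨ` with `b` imaginary and under `Ψ ↦ c εΨ̄` with
`c` arbitrary, while `Ψ ↦ AΨ` acts on it by the commutator with `A`. Hence `dΣ` is exactly minus the
commutator term, whatever `b` and `c` are. -/
theorem TorsionFree.elForm_eq_zero {Ψ : C2Form} {y : E4}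
    {A : Fin 4 → Matrix (Fin 2) (Fin 2) ℂ} {b c : Fin 4 → ℂ} (hT : TorsionFree Ψ y A b c)
    (hd : ∀ μ c, DifferentiableAt ℝ (fun z => Ψ z μ c 0) y) (hA : ∀ μ, IsSu2 (A μ))
    (hb : ∀ μ, star (b μ) = -b μ) : elForm Ψ y A = 0 := by
  have h11 := fun μ => (hA μ).entries.1
  have h00 := fun μ => (hA μ).entries.2.1
  have h10 := fun μ => (hA μ).entries.2.2
  have t0 : ∀ μ ν, d1M Ψ y μ ν 0 0 = -((A μ 0 0 * Ψ y ν 0 0 + A μ 0 1 * Ψ y ν 1 0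
      + b μ * Ψ y ν 0 0 + c μ * star (Ψ y ν 1 0)) - (A ν 0 0 * Ψ y μ 0 0 + A ν 0 1 * Ψ y μ 1 0
      + b ν * Ψ y μ 0 0 + c ν * star (Ψ y μ 1 0))) := fun μ ν => by
    rw [hT μ ν]; simp [Matrix.mul_apply, Fin.sum_univ_two, epsConj]
  have t1 : ∀ μ ν, d1M Ψ y μ ν 1 0 = -((-star (A μ 0 1) * Ψ y ν 0 0 - A μ 0 0 * Ψ y ν 1 0
      + b μ * Ψ y ν 1 0 - c μ * star (Ψ y ν 0 0)) - (-star (A ν 0 1) * Ψ y μ 0 0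
      - A ν 0 0 * Ψ y μ 1 0 + b ν * Ψ y μ 1 0 - c ν * star (Ψ y μ 0 0))) := fun μ ν => by
    rw [hT μ ν]; simp [Matrix.mul_apply, Fin.sum_univ_two, epsConj, h11, h10]; ring
  funext μ ν ρ
  apply matrix_ext_two <;>
  · simp only [elForm, w12, w21, Matrix.add_apply, Matrix.sub_apply, Matrix.mul_apply,
      Fin.sum_univ_two, d2M_sigma hd, sigma_apply, Pi.zero_apply, Matrix.zero_apply]
    simp only [Fin.isValue, t0, t1, h11, h10, star_add, star_sub,
      star_neg, star_mul, star_star, h00, hb, Matrix.one_apply_eq, ne_eq, zero_ne_one, one_ne_zero,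
      not_false_eq_true, Matrix.one_apply_ne]
    ring

/-! ### Uniqueness -/

/-- The part `B ∧ Σ - Σ ∧ B` of the Euler-Lagrange expression. -/
def elLin (S : Fin 4 → Fin 4 → Matrix (Fin 2) (Fin 2) ℂ) (B : Fin 4 → Matrix (Fin 2) (Fin 2) ℂ)
    (μ ν ρ : Fin 4) : Matrix (Fin 2) (Fin 2) ℂ :=
  w12 B S μ ν ρ - w21 S B μ ν ρ

theorem elLin_eq (S : Fin 4 → Fin 4 → Matrix (Fin 2) (Fin 2) ℂ)
    (B : Fin 4 → Matrix (Fin 2) (Fin 2) ℂ) (μ ν ρ : Fin 4) :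
    elLin S B μ ν ρ = (B μ * S ν ρ - S ν ρ * B μ) - (B ν * S μ ρ - S μ ρ * B ν)
      + (B ρ * S μ ν - S μ ν * B ρ) := by
  simp only [elLin, w12, w21]
  abel

/-- The expression is tensorial, so it may be evaluated in any frame; this allows the passage to the
frame in which `Σ` is constant. -/
theorem elLin_contract (S : Fin 4 → Fin 4 → Matrix (Fin 2) (Fin 2) ℂ)
    (B : Fin 4 → Matrix (Fin 2) (Fin 2) ℂ) (E : Matrix (Fin 4) (Fin 4) ℝ) (I J K : Fin 4) :
    elLin (fun J K => ∑ ν, ∑ ρ, (E ν J * E ρ K) • S ν ρ) (fun I => ∑ μ, E μ I • B μ) I J K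
      = ∑ μ, ∑ ν, ∑ ρ, (E μ I * E ν J * E ρ K) • elLin S B μ ν ρ := by
  have p : ∀ I J K, (∑ μ, E μ I • B μ) * (∑ ν, ∑ ρ, (E ν J * E ρ K) • S ν ρ)
        - (∑ ν, ∑ ρ, (E ν J * E ρ K) • S ν ρ) * (∑ μ, E μ I • B μ)
      = ∑ μ, ∑ ν, ∑ ρ, (E μ I * E ν J * E ρ K) • (B μ * S ν ρ - S ν ρ * B μ) := fun I J K => by
    rw [Finset.sum_mul, Finset.mul_sum, ← Finset.sum_sub_distrib]
    refine Finset.sum_congr rfl fun μ _ => ?_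
    rw [Finset.sum_mul, Finset.mul_sum, ← Finset.sum_sub_distrib]
    refine Finset.sum_congr rfl fun ν _ => ?_
    rw [Finset.sum_mul, Finset.mul_sum, ← Finset.sum_sub_distrib]
    refine Finset.sum_congr rfl fun ρ _ => ?_
    rw [smul_mul_smul_comm, smul_mul_smul_comm, smul_sub, mul_comm (E ν J * E ρ K), mul_assoc]
  rw [elLin_eq, p, p, p]
  simp only [elLin_eq]
  -- With the commutator abstracted to `T`, only a relabelling of summation indices is left.
  obtain ⟨T, hT⟩ : ∃ T : Fin 4 → Fin 4 → Fin 4 → Matrix (Fin 2) (Fin 2) ℂ,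
    ∀ μ ν ρ, B μ * S ν ρ - S ν ρ * B μ = T μ ν ρ := ⟨_, fun _ _ _ => rfl⟩
  simp only [hT, smul_add, smul_sub, Finset.sum_add_distrib, Finset.sum_sub_distrib]
  congr 1
  · congr 1
    rw [Finset.sum_comm]
    exact Finset.sum_congr rfl fun μ _ => Finset.sum_congr rfl fun ν _ =>
      Finset.sum_congr rfl fun ρ _ => by rw [mul_comm (E μ I)]
  · rw [Finset.sum_comm]
    refine Finset.sum_congr rfl fun μ _ => ?_
    rw [Finset.sum_comm]
    exact Finset.sum_congr rfl fun ν _ => Finset.sum_congr rfl fun ρ _ => by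
      rw [mul_comm (E μ I * E ν J), mul_assoc]

/-- The vector of `ℂ²` whose real components are the `I`-th standard basis vector of `ℝ⁴`. -/
noncomputable def stdVec (I : Fin 4) (c : Fin 2) : ℂ :=
  !![1, 0; Complex.I, 0; 0, 1; 0, Complex.I] I c

/-- The columns of `e⁻¹` are the dual frame, on which the real and imaginary parts of `Ψ` take the
values `0` and `1`. -/
theorem sum_inv_mul_Psi {Ψ : C2Form} {y : E4} (hdet : (coframe Ψ y).det ≠ 0) (I : Fin 4)
    (c : Fin 2) : ∑ μ, ((coframe Ψ y)⁻¹ μ I : ℂ) * Ψ y μ c 0 = stdVec I c := by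
  have h1 : coframe Ψ y * (coframe Ψ y)⁻¹ = 1 :=
    Matrix.mul_nonsing_inv _ (isUnit_iff_ne_zero.2 hdet)
  have h2 : ∀ J, ∑ μ, coframe Ψ y J μ * (coframe Ψ y)⁻¹ μ I
      = (1 : Matrix (Fin 4) (Fin 4) ℝ) J I := fun J => by
    rw [← h1, Matrix.mul_apply]
  have hc : ∀ J K : Fin 4, (∀ μ, Ψ y μ c 0 = coframe Ψ y J μ + Complex.I * coframe Ψ y K μ) →
      ∑ μ, ((coframe Ψ y)⁻¹ μ I : ℂ) * Ψ y μ c 0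
        = ((1 : Matrix (Fin 4) (Fin 4) ℝ) J I : ℝ)
          + Complex.I * ((1 : Matrix (Fin 4) (Fin 4) ℝ) K I : ℝ) := by
    intro J K h
    rw [← h2, ← h2]
    push_cast
    rw [Finset.mul_sum, ← Finset.sum_add_distrib]
    exact Finset.sum_congr rfl fun μ _ => by rw [h]; ring
  have hri : ∀ z : ℂ, z = z.re + Complex.I * z.im := fun z => by
    conv_lhs => rw [← Complex.re_add_im z]
    ring
  fin_cases c
  · refine (hc 0 1 fun μ => hri _).trans ?_
    fin_cases I <;> simp [stdVec, Matrix.one_apply]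
  · refine (hc 2 3 fun μ => hri _).trans ?_
    fin_cases I <;> simp [stdVec, Matrix.one_apply]

/-- `Σ` in the frame in which `e^I` is the standard coframe. -/
noncomputable def stdSigma (J K : Fin 4) : Matrix (Fin 2) (Fin 2) ℂ :=
  Matrix.of fun i j => stdVec J i * star (stdVec K j) - stdVec K i * star (stdVec J j)
    + 1 / 2 * (∑ k, (star (stdVec J k) * stdVec K k - star (stdVec K k) * stdVec J k))
      * (1 : Matrix (Fin 2) (Fin 2) ℂ) i j

theorem sigma_frame {Ψ : C2Form} {y : E4} (hdet : (coframe Ψ y).det ≠ 0) (J K : Fin 4) :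
    ∑ ν, ∑ ρ, ((coframe Ψ y)⁻¹ ν J * (coframe Ψ y)⁻¹ ρ K) • sigma Ψ y ν ρ = stdSigma J K := by
  have h := sum_inv_mul_Psi hdet
  have hs : ∀ I c, ∑ μ, ((coframe Ψ y)⁻¹ μ I : ℂ) * star (Ψ y μ c 0) = star (stdVec I c) :=
    fun I c => by
      rw [← h, star_sum]
      exact Finset.sum_congr rfl fun μ _ => by simp
  set E := (coframe Ψ y)⁻¹
  have h1 : ∀ i j, ∑ ν, ∑ ρ, ((E ν J : ℂ) * E ρ K) * (Ψ y ν i 0 * star (Ψ y ρ j 0))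
      = stdVec J i * star (stdVec K j) := fun i j => by
    rw [← h, ← hs, Finset.sum_mul_sum]
    exact Finset.sum_congr rfl fun μ _ => Finset.sum_congr rfl fun ν _ => by ring
  have h2 : ∀ i j, ∑ ν, ∑ ρ, ((E ν J : ℂ) * E ρ K) * (Ψ y ρ i 0 * star (Ψ y ν j 0))
      = stdVec K i * star (stdVec J j) := fun i j => by
    rw [← h, ← hs, Finset.sum_mul_sum, Finset.sum_comm]
    exact Finset.sum_congr rfl fun μ _ => Finset.sum_congr rfl fun ν _ => by ring
  ext i j
  simp only [stdSigma, Matrix.of_apply, Fin.sum_univ_two, ← h1, ← h2,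
    mul_comm (star (stdVec _ _)), Matrix.sum_apply, Matrix.smul_apply, sigma_apply,
    Complex.real_smul]
  simp only [← Finset.sum_sub_distrib, ← Finset.sum_add_distrib, Finset.mul_sum, Finset.sum_mul]
  exact Finset.sum_congr rfl fun μ _ => Finset.sum_congr rfl fun ν _ => by push_cast; ring

/-- An `𝔰𝔲(2)`-valued `1`-form has twelve real coordinates and an `𝔰𝔲(2)`-valued `3`-form has twelve
real components. For the standard `Σ` the resulting square linear system has explicit numerical
coefficients and is nonsingular. -/
theorem eq_zero_of_elLin_stdSigma {D : Fin 4 → Matrix (Fin 2) (Fin 2) ℂ}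
    (hD : ∀ I, IsSu2 (D I)) (h : ∀ I J K, elLin stdSigma D I J K = 0) (I : Fin 4) : D I = 0 := by
  have h11 := fun μ => (hD μ).entries.1
  have h00 := fun μ => (hD μ).entries.2.1
  have h10 := fun μ => (hD μ).entries.2.2
  have hre : ∀ μ, (D μ 0 0).re = 0 := fun μ => by
    have := congrArg Complex.re (h00 μ)
    simp at this
    linarith
  have e : ∀ I J K i j, elLin stdSigma D I J K i j = 0 := fun I J K i j => by rw [h]; rfl
  -- The four independent components of a `3`-form. The entry `0 0` gives one real equation, being
  -- imaginary, and the entry `0 1` gives two.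
  have a1 := e 0 1 2 0 0
  have a2 := e 0 1 2 0 1
  have b1 := e 0 1 3 0 0
  have b2 := e 0 1 3 0 1
  have c1 := e 0 2 3 0 0
  have c2 := e 0 2 3 0 1
  have d1 := e 1 2 3 0 0
  have d2 := e 1 2 3 0 1
  simp [elLin, w12, w21, stdSigma, stdVec, Matrix.mul_apply, Fin.sum_univ_two, h11, h10,
    Complex.ext_iff, hre] at a1 a2 b1 b2 c1 c2 d1 d2
  have f : (D 0 0 0).im = 0 ∧ (D 1 0 0).im = 0 ∧ (D 2 0 0).im = 0 ∧ (D 3 0 0).im = 0 ∧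
    (D 0 0 1).re = 0 ∧ (D 1 0 1).re = 0 ∧ (D 2 0 1).re = 0 ∧ (D 3 0 1).re = 0 ∧
    (D 0 0 1).im = 0 ∧ (D 1 0 1).im = 0 ∧ (D 2 0 1).im = 0 ∧ (D 3 0 1).im = 0 := by
    refine ⟨?_, ?_, ?_, ?_, ?_, ?_, ?_, ?_, ?_, ?_, ?_, ?_⟩ <;> linarith
  have g0 : D I 0 0 = 0 := Complex.ext (hre I) (by fin_cases I <;> simp [f])
  have g1 : D I 0 1 = 0 := Complex.ext (by fin_cases I <;> simp [f]) (by fin_cases I <;> simp [f])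
  apply matrix_ext_two <;> simp [h11, h10, g0, g1]

theorem IsSu2.add {X Y : Matrix (Fin 2) (Fin 2) ℂ} (hX : IsSu2 X) (hY : IsSu2 Y) :
    IsSu2 (X + Y) :=
  ⟨by rw [Matrix.conjTranspose_add, hX.1, hY.1, neg_add], by
    rw [Matrix.trace_add, hX.2, hY.2, add_zero]⟩

theorem IsSu2.sub {X Y : Matrix (Fin 2) (Fin 2) ℂ} (hX : IsSu2 X) (hY : IsSu2 Y) :
    IsSu2 (X - Y) :=
  ⟨by rw [Matrix.conjTranspose_sub, hX.1, hY.1]; abel, by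
    rw [Matrix.trace_sub, hX.2, hY.2, sub_zero]⟩

theorem IsSu2.real_smul {X : Matrix (Fin 2) (Fin 2) ℂ} (hX : IsSu2 X) (r : ℝ) :
    IsSu2 (r • X) :=
  ⟨by rw [Matrix.conjTranspose_smul, hX.1]; simp, by rw [Matrix.trace_smul, hX.2, smul_zero]⟩

theorem isSu2_zero : IsSu2 0 := ⟨by simp, by simp⟩

theorem isSu2_sum {ι : Type*} (s : Finset ι) {X : ι → Matrix (Fin 2) (Fin 2) ℂ}
    (hX : ∀ i ∈ s, IsSu2 (X i)) : IsSu2 (∑ i ∈ s, X i) :=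
  Finset.sum_induction X IsSu2 (fun _ _ => IsSu2.add) isSu2_zero hX

theorem eq_zero_of_elLin {Ψ : C2Form} {y : E4} (hdet : (coframe Ψ y).det ≠ 0)
    {D : Fin 4 → Matrix (Fin 2) (Fin 2) ℂ} (hD : ∀ μ, IsSu2 (D μ))
    (h : ∀ μ ν ρ, elLin (sigma Ψ y) D μ ν ρ = 0) : D = 0 := by
  have hinv : (coframe Ψ y)⁻¹ * coframe Ψ y = 1 :=
    Matrix.nonsing_inv_mul _ (isUnit_iff_ne_zero.2 hdet)
  set E := (coframe Ψ y)⁻¹ with hE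
  have hf : ∀ I, ∑ μ, E μ I • D μ = 0 := by
    refine eq_zero_of_elLin_stdSigma (fun I => isSu2_sum _ fun μ _ => (hD μ).real_smul _) ?_
    intro I J K
    have := elLin_contract (sigma Ψ y) D E I J K
    simp only [h, smul_zero, Finset.sum_const_zero] at this
    rw [← this]
    congr 1
    funext J K
    exact (sigma_frame hdet J K).symm
  -- `D` is recovered from its frame components, all zero by `hf`, through `E * coframe Ψ y = 1`.
  funext μ
  have hμ : D μ = ∑ ν, (E * coframe Ψ y) ν μ • D ν := by
    rw [hinv]
    simp [Matrix.one_apply]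
  rw [hμ]
  simp only [Matrix.mul_apply, Finset.sum_smul]
  rw [Finset.sum_comm]
  refine Finset.sum_eq_zero fun I _ => ?_
  simp only [mul_comm (E _ I), mul_smul]
  rw [← Finset.smul_sum, hf, smul_zero]

theorem elForm_eq (Ψ : C2Form) (y : E4) (B : Fin 4 → Matrix (Fin 2) (Fin 2) ℂ) (μ ν ρ : Fin 4) :
    elForm Ψ y B μ ν ρ = d2M (sigma Ψ) y μ ν ρ + elLin (sigma Ψ y) B μ ν ρ := by
  rw [elForm, elLin, add_sub_assoc]

/-- The equation is affine in the connection: the inhomogeneous term `dΣ` cancels in the difference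
of two solutions, which therefore lies in the kernel of the injective linear part. -/
theorem elForm_unique {Ψ : C2Form} {y : E4} (hdet : (coframe Ψ y).det ≠ 0)
    {A B : Fin 4 → Matrix (Fin 2) (Fin 2) ℂ} (hA : ∀ μ, IsSu2 (A μ)) (hB : ∀ μ, IsSu2 (B μ))
    (eA : elForm Ψ y A = 0) (eB : elForm Ψ y B = 0) : B = A := by
  refine sub_eq_zero.1 (eq_zero_of_elLin hdet (fun μ => (hB μ).sub (hA μ)) fun μ ν ρ => ?_)
  have h1 : elForm Ψ y B μ ν ρ - elForm Ψ y A μ ν ρ = 0 := by rw [eA, eB, sub_self]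
  rw [elForm_eq, elForm_eq, add_sub_add_left_eq_sub] at h1
  rw [← h1]
  simp only [elLin_eq, Pi.sub_apply, sub_mul, mul_sub]
  abel

/-! ### The anti-self-dual part of the Levi-Civita connection -/

section AntiSelfDual

/-- The anti-self-dual part of an antisymmetric matrix, as a complex matrix. -/
noncomputable def asd (W : Matrix (Fin 4) (Fin 4) ℝ) : Matrix (Fin 2) (Fin 2) ℂ :=
  toComplex ((1 / 2 : ℝ) • (W - hodge W))

variable {W : Matrix (Fin 4) (Fin 4) ℝ}

theorem skew_apply (hW : Wᵀ = -W) (i j : Fin 4) : W i j = -W j i := by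
  rw [← Matrix.neg_apply, ← hW, Matrix.transpose_apply]

theorem skew_diag (hW : Wᵀ = -W) (i : Fin 4) : W i i = 0 := by
  have := skew_apply hW i i
  linarith

/-- The coordinates of the anti-self-dual part are `W 2 3 - W 0 1`, `W 0 2 + W 1 3` and `W 1 2 - W 0
3`; the opposite signs give the self-dual part. -/
theorem asd_eq (hW : Wᵀ = -W) : asd W =
    !![Complex.I * ((W 2 3 - W 0 1) / 2), ((W 0 2 + W 1 3) + Complex.I * (W 1 2 - W 0 3)) / 2;
      (-(W 0 2 + W 1 3) + Complex.I * (W 1 2 - W 0 3)) / 2, -(Complex.I * ((W 2 3 - W 0 1) / 2))] := by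
  have s := skew_apply hW
  have d := skew_diag hW
  apply matrix_ext_two <;> simp [asd, toComplex, hodge, d, s 1 0, s 2 0, s 3 0, s 3 2]
  all_goals ring

theorem asd_isSu2 (hW : Wᵀ = -W) : IsSu2 (asd W) := by
  rw [asd_eq hW]
  apply isSu2_of_entries <;> simp [Complex.ext_iff]
  constructor <;> ring

/-- A skew real `4 × 4` matrix acts on `ℂ²` by its anti-self-dual part and by `v ↦ b v + c ε v̄`. -/
theorem skew_act (hW : Wᵀ = -W) (x : Fin 4 → ℝ) (v : Matrix (Fin 2) (Fin 1) ℂ)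
    (h0 : v 0 0 = x 0 + Complex.I * x 1) (h1 : v 1 0 = x 2 + Complex.I * x 3) :
    (!![(((W *ᵥ x) 0 : ℝ) : ℂ) + Complex.I * ((W *ᵥ x) 1 : ℝ);
        (((W *ᵥ x) 2 : ℝ) : ℂ) + Complex.I * ((W *ᵥ x) 3 : ℝ)] : Matrix (Fin 2) (Fin 1) ℂ)
      = asd W * v + (-(Complex.I * ((W 0 1 + W 2 3) / 2))) • v
        + (((W 0 2 - W 1 3) + Complex.I * (W 1 2 + W 0 3)) / 2) • epsConj v := by
  have s := skew_apply hW
  have d := skew_diag hW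
  ext i j
  fin_cases j
  rw [asd_eq hW, Matrix.add_apply, Matrix.add_apply, Matrix.mul_apply, Fin.sum_univ_two]
  fin_cases i <;>
  · simp [epsConj, Matrix.mulVec, dotProduct,
      Fin.sum_univ_four, h0, h1, d, s 1 0, s 2 0, s 3 0, s 3 2, s 3 1, s 2 1, Complex.ext_iff]
    constructor <;> ring

end AntiSelfDual

theorem coframe_re_im (Ψ : C2Form) (y : E4) (μ : Fin 4) :
    Ψ y μ 0 0 = coframe Ψ y 0 μ + Complex.I * coframe Ψ y 1 μ ∧
      Ψ y μ 1 0 = coframe Ψ y 2 μ + Complex.I * coframe Ψ y 3 μ := by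
  constructor <;> apply Complex.ext <;> simp [coframe]

theorem asdLeviCivita_eq (Ψ : C2Form) (y : E4) (μ : Fin 4) :
    asdLeviCivita Ψ y μ = asd (leviCivita Ψ y μ) := rfl

namespace IsSmoothCoframe

variable {U : Set E4} {Ψ : C2Form} (h : IsSmoothCoframe U Ψ)
include h

theorem diff {y : E4} (hy : y ∈ U) (μ : Fin 4) (c : Fin 2) :
    DifferentiableAt ℝ (fun z => Ψ z μ c 0) y :=
  differentiableAt_of_contDiffOn (h.smooth μ c) h.isOpen hy

theorem asd_isSu2 {y : E4} (hy : y ∈ U) (μ : Fin 4) : IsSu2 (asdLeviCivita Ψ y μ) :=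
  U2Gravity.asd_isSu2 (h.leviCivita_skew hy μ)

/-- The real structure equation `de = -w∧e` read in complex coordinates through `skew_act`; `b` and
`c` are the self-dual coordinates of `w`. -/
theorem exists_torsionFree {y : E4} (hy : y ∈ U) :
    ∃ b c : Fin 4 → ℂ, (∀ μ, star (b μ) = -b μ) ∧ TorsionFree Ψ y (asdLeviCivita Ψ y) b c := by
  refine ⟨fun μ => -(Complex.I * ((leviCivita Ψ y μ 0 1 + leviCivita Ψ y μ 2 3) / 2)),
    fun μ => ((leviCivita Ψ y μ 0 2 - leviCivita Ψ y μ 1 3)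
      + Complex.I * (leviCivita Ψ y μ 1 2 + leviCivita Ψ y μ 0 3)) / 2, fun μ => ?_, fun μ ν => ?_⟩
  · simp
  · have hact := fun μ ν => skew_act (h.leviCivita_skew hy μ)
      (fun J => coframe Ψ y J ν) (Ψ y ν) (coframe_re_im Ψ y ν).1 (coframe_re_im Ψ y ν).2
    have hmul : ∀ μ ν I, (leviCivita Ψ y μ *ᵥ fun J => coframe Ψ y J ν) I
        = (leviCivita Ψ y μ * coframe Ψ y) I ν := fun μ ν I => rfl
    simp only [asdLeviCivita_eq]
    rw [← hact μ ν, ← hact ν μ]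
    simp only [hmul]
    have ht := h.torsion_free hy μ ν
    have hpd : ∀ μ ν c, pd μ (fun z => Ψ z ν c 0) y
        = ((pd μ (fun z => (Ψ z ν c 0).re) y : ℝ) : ℂ)
          + Complex.I * ((pd μ (fun z => (Ψ z ν c 0).im) y : ℝ) : ℂ) := fun μ ν c => by
      rw [pd_re (h.diff hy ν c), pd_im (h.diff hy ν c)]
      apply Complex.ext <;> simp
    -- The rows of the coframe are by definition the real and imaginary parts of `α` and `β`, so the
    -- four torsion identities hold for these directly.
    have t0 : pd μ (fun z => (Ψ z ν 0 0).re) y - pd ν (fun z => (Ψ z μ 0 0).re) y = _ := ht 0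
    have t1 : pd μ (fun z => (Ψ z ν 0 0).im) y - pd ν (fun z => (Ψ z μ 0 0).im) y = _ := ht 1
    have t2 : pd μ (fun z => (Ψ z ν 1 0).re) y - pd ν (fun z => (Ψ z μ 1 0).re) y = _ := ht 2
    have t3 : pd μ (fun z => (Ψ z ν 1 0).im) y - pd ν (fun z => (Ψ z μ 1 0).im) y = _ := ht 3
    ext i j
    fin_cases j
    fin_cases i
    · simp [d1M, d1, hpd, Complex.ext_iff]
      constructor <;> linarith
    · simp [d1M, d1, hpd, Complex.ext_iff]
      constructor <;> linarith

theorem elForm_asdLeviCivita {y : E4} (hy : y ∈ U) : elForm Ψ y (asdLeviCivita Ψ y) = 0 := by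
  obtain ⟨b, c, hb, hT⟩ := h.exists_torsionFree hy
  exact hT.elForm_eq_zero (h.diff hy) (h.asd_isSu2 hy) hb

theorem elForm_eq_zero_iff {y : E4} (hy : y ∈ U) {B : Fin 4 → Matrix (Fin 2) (Fin 2) ℂ}
    (hB : ∀ μ, IsSu2 (B μ)) : elForm Ψ y B = 0 ↔ B = asdLeviCivita Ψ y :=
  ⟨fun e => elForm_unique (h.nondeg y hy) (h.asd_isSu2 hy) hB (h.elForm_asdLeviCivita hy) e,
    fun e => e ▸ h.elForm_asdLeviCivita hy⟩

end IsSmoothCoframe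

/-! ### Naturality and gauge covariance of the torsion-free condition -/

theorem d1M_eq {p q : ℕ} (Φ : E4 → Fin 4 → Matrix (Fin p) (Fin q) ℂ) (y : E4) (μ ν : Fin 4) :
    d1M Φ y μ ν = pdM μ (fun z => Φ z ν) y - pdM ν (fun z => Φ z μ) y := rfl

theorem pdM_pull1 {p q : ℕ} {Φ : E4 → Fin 4 → Matrix (Fin p) (Fin q) ℂ} {τ : E4 → E4} {y : E4}
    (hτ : ContDiffAt ℝ ∞ τ y) (hΦ : ∀ κ, DiffM (τ y) fun z => Φ z κ) (μ ν : Fin 4) :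
    pdM μ (fun z => pull1 τ Φ z ν) y
      = ∑ κ, pd μ (pd ν (fun z => τ z κ)) y • Φ (τ y) κ
        + ∑ κ, ∑ ι, (pd μ (fun z => τ z κ) y * pd ν (fun z => τ z ι) y)
          • pdM κ (fun z => Φ z ι) (τ y) := by
  have hd : DifferentiableAt ℝ τ y := hτ.differentiableAt (by simp)
  have hτi : ∀ κ, ContDiffAt ℝ ∞ (fun z => τ z κ) y := fun κ =>
    (EuclideanSpace.proj κ : E4 →L[ℝ] ℝ).contDiff.contDiffAt.comp y hτ
  have hJ : ∀ κ, DifferentiableAt ℝ (pd ν (fun z => τ z κ)) y := fun κ =>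
    (((hτi κ).fderiv_right (m := 1) (WithTop.coe_le_coe.2 (le_top : (2 : ℕ∞) ≤ ⊤))).clm_apply
      contDiffAt_const).differentiableAt (by simp)
  have hc : ∀ κ i j, DifferentiableAt ℝ (fun z => Φ (τ z) κ i j) y := fun κ i j =>
    DifferentiableAt.comp y (hΦ κ i j) hd
  ext i j
  have h1 : (fun z => pull1 τ Φ z ν i j) = fun z =>
      ∑ κ, pd ν (fun z => τ z κ) z • Φ (τ z) κ i j := by
    funext z
    simp [pull1, Matrix.sum_apply]
  simp only [pdM, Matrix.of_apply, Matrix.add_apply, Matrix.sum_apply, Matrix.smul_apply]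
  rw [show (fun z => pull1 τ Φ z ν i j) = _ from h1,
    pd_sum Finset.univ (f := fun κ z => pd ν (fun z => τ z κ) z • Φ (τ z) κ i j)
      (fun κ _ => (hJ κ).smul (hc κ i j))]
  rw [Finset.sum_comm (f := fun κ ι => (pd μ (fun z => τ z κ) y * pd ν (fun z => τ z ι) y)
    • pd κ (fun z => Φ z ι i j) (τ y)), ← Finset.sum_add_distrib]
  refine Finset.sum_congr rfl fun κ _ => ?_
  rw [pd_smul (hJ κ) (hc κ i j), pd_comp (f := fun z => Φ z κ i j) (hΦ κ i j) hd, Finset.smul_sum]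
  congr 1
  exact Finset.sum_congr rfl fun ι _ => by rw [smul_smul, mul_comm]

/-- Naturality of `d`: the second derivatives of `τ` in `pdM_pull1` are symmetric in the two form
indices and disappear. -/
theorem d1M_pull1 {p q : ℕ} {Φ : E4 → Fin 4 → Matrix (Fin p) (Fin q) ℂ} {τ : E4 → E4} {y : E4}
    (hτ : ContDiffAt ℝ ∞ τ y) (hΦ : ∀ κ, DiffM (τ y) fun z => Φ z κ) :
    d1M (pull1 τ Φ) y = pull2 τ (d1M Φ) y := by
  have hτi : ∀ κ, ContDiffAt ℝ ∞ (fun z => τ z κ) y := fun κ =>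
    (EuclideanSpace.proj κ : E4 →L[ℝ] ℝ).contDiff.contDiffAt.comp y hτ
  funext μ ν
  rw [d1M_eq, pdM_pull1 hτ hΦ, pdM_pull1 hτ hΦ]
  simp only [fun κ => pd_comm (hτi κ) μ ν, add_sub_add_left_eq_sub, pull2, d1M_eq, smul_sub,
    Finset.sum_sub_distrib]
  congr 1
  rw [Finset.sum_comm]
  exact Finset.sum_congr rfl fun κ _ => Finset.sum_congr rfl fun ι _ => by rw [mul_comm]

theorem epsConj_add (v w : Matrix (Fin 2) (Fin 1) ℂ) :
    epsConj (v + w) = epsConj v + epsConj w := by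
  ext i j; fin_cases i <;> fin_cases j <;> simp [epsConj]
  ring

theorem epsConj_smul (r : ℝ) (v : Matrix (Fin 2) (Fin 1) ℂ) :
    epsConj (r • v) = r • epsConj v := by
  ext i j; fin_cases i <;> fin_cases j <;> simp [epsConj]

theorem epsConj_sum {ι : Type*} (s : Finset ι) (v : ι → Matrix (Fin 2) (Fin 1) ℂ) :
    epsConj (∑ i ∈ s, v i) = ∑ i ∈ s, epsConj (v i) := by
  classical
  induction s using Finset.induction_on with
  | empty => ext i j; fin_cases i <;> fin_cases j <;> simp [epsConj]
  | insert a s ha ih => rw [Finset.sum_insert ha, Finset.sum_insert ha, epsConj_add, ih]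

/-- Both sides are natural under pull-back. The antilinear `epsConj` causes no trouble because the
Jacobian coefficients are real. -/
theorem TorsionFree.pull {Ψ : C2Form} {τ : E4 → E4} {y : E4} (hτ : ContDiffAt ℝ ∞ τ y)
    (hΨ : ∀ μ, DiffM (τ y) fun z => Ψ z μ) {A : Fin 4 → Matrix (Fin 2) (Fin 2) ℂ}
    {b c : Fin 4 → ℂ} (hT : TorsionFree Ψ (τ y) A b c) :
    TorsionFree (pull1 τ Ψ) y (fun μ => ∑ κ, pd μ (fun z => τ z κ) y • A κ)
      (fun μ => ∑ κ, pd μ (fun z => τ z κ) y • b κ)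
      (fun μ => ∑ κ, pd μ (fun z => τ z κ) y • c κ) := by
  have key : ∀ μ ν, ∑ κ, ∑ ι, (pd μ (fun z => τ z κ) y * pd ν (fun z => τ z ι) y)
        • (A κ * Ψ (τ y) ι + b κ • Ψ (τ y) ι + c κ • epsConj (Ψ (τ y) ι))
      = (∑ κ, pd μ (fun z => τ z κ) y • A κ) * pull1 τ Ψ y ν
        + (∑ κ, pd μ (fun z => τ z κ) y • b κ) • pull1 τ Ψ y ν
        + (∑ κ, pd μ (fun z => τ z κ) y • c κ) • epsConj (pull1 τ Ψ y ν) := by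
    intro μ ν
    have s1 : (∑ κ, pd μ (fun z => τ z κ) y • A κ) * pull1 τ Ψ y ν
        = ∑ κ, ∑ ι, (pd μ (fun z => τ z κ) y * pd ν (fun z => τ z ι) y)
          • (A κ * Ψ (τ y) ι) := by
      rw [pull1, Matrix.sum_mul]
      refine Finset.sum_congr rfl fun κ _ => ?_
      rw [Matrix.mul_sum]
      exact Finset.sum_congr rfl fun ι _ => by rw [Matrix.smul_mul, Matrix.mul_smul, smul_smul]
    have s2 : ∀ (f : Fin 4 → ℂ) (v : Fin 4 → Matrix (Fin 2) (Fin 1) ℂ),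
        (∑ κ, pd μ (fun z => τ z κ) y • f κ) • (∑ ι, pd ν (fun z => τ z ι) y • v ι)
        = ∑ κ, ∑ ι, (pd μ (fun z => τ z κ) y * pd ν (fun z => τ z ι) y) • (f κ • v ι) := by
      intro f v
      rw [Finset.sum_smul_sum]
      exact Finset.sum_congr rfl fun κ _ => Finset.sum_congr rfl fun ι _ => by
        rw [smul_smul_smul_comm, smul_eq_mul]
    rw [s1, pull1, epsConj_sum, s2]
    simp only [epsConj_smul]
    rw [s2]
    simp only [smul_add, Finset.sum_add_distrib]
  intro μ ν
  rw [d1M_pull1 hτ hΨ, ← key, ← key ν μ, Finset.sum_comm (f := fun κ ι =>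
    (pd ν (fun z => τ z κ) y * pd μ (fun z => τ z ι) y)
      • (A κ * Ψ (τ y) ι + b κ • Ψ (τ y) ι + c κ • epsConj (Ψ (τ y) ι))), ← Finset.sum_sub_distrib,
    ← Finset.sum_neg_distrib]
  refine Finset.sum_congr rfl fun κ _ => ?_
  rw [← Finset.sum_sub_distrib, ← Finset.sum_neg_distrib]
  refine Finset.sum_congr rfl fun ι _ => ?_
  rw [hT κ ι, mul_comm (pd ν (fun z => τ z ι) y), ← smul_sub, smul_neg]

/-- For unitary `u` the adjugate is `det u` times `u†`. Thus `v ↦ ε v̄` commutes with `U(2)` up to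
the phase `det u`, which is the factor acquired by `c` under a gauge change. -/
theorem epsConj_unitary {u : Matrix (Fin 2) (Fin 2) ℂ} (hu : u * uᴴ = 1)
    (v : Matrix (Fin 2) (Fin 1) ℂ) : u * epsConj v = u.det • epsConj (u * v) := by
  have h : u.det • uᴴ = u.adjugate := by
    rw [← Matrix.mul_one u.adjugate, ← hu, ← Matrix.mul_assoc, Matrix.adjugate_mul,
      Matrix.smul_mul, Matrix.one_mul]
  have e : ∀ i j, u.det * star (u j i) = u.adjugate i j := fun i j => by
    rw [← h]; rfl
  have e00 := e 0 0
  have e01 := e 0 1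
  have e10 := e 1 0
  have e11 := e 1 1
  simp only [Matrix.adjugate_fin_two, Matrix.of_apply,
    Matrix.cons_val', Matrix.cons_val_zero, Matrix.cons_val_one, Matrix.cons_val_fin_one]
    at e00 e01 e10 e11
  generalize u.det = d at *
  ext i j
  fin_cases j
  fin_cases i
  · simp only [epsConj, Matrix.mul_apply, Fin.sum_univ_two, Matrix.smul_apply, smul_eq_mul]
    simp [star_add, star_mul] at *
    linear_combination (-(starRingEnd ℂ) (v 0 0)) * e01 - (starRingEnd ℂ) (v 1 0) * e11
  · simp only [epsConj, Matrix.mul_apply, Fin.sum_univ_two, Matrix.smul_apply, smul_eq_mul]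
    simp [star_add, star_mul] at *
    linear_combination ((starRingEnd ℂ) (v 0 0)) * e00 + (starRingEnd ℂ) (v 1 0) * e10

theorem traceFree_isSu2 {X : Matrix (Fin 2) (Fin 2) ℂ} (hX : Xᴴ = -X) : IsSu2 (traceFree X) := by
  have ht : star X.trace = -X.trace := by
    rw [← Matrix.trace_conjTranspose, hX, Matrix.trace_neg]
  constructor
  · rw [traceFree, Matrix.conjTranspose_sub, Matrix.conjTranspose_smul, hX,
      Matrix.conjTranspose_one, star_div₀, ht]
    simp [neg_div]
    abel
  · rw [traceFree, Matrix.trace_sub, Matrix.trace_smul, Matrix.trace_one]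
    simp

/-- Differentiating `Ψ = uΦ` replaces `A` by `u A u⁻¹ - du u⁻¹`. Its trace part is a multiple of the
identity and moves into `b`, so only the trace-free part remains as the new potential. -/
theorem TorsionFree.gauge {Ψ Φ : C2Form} {u : E4 → Matrix (Fin 2) (Fin 2) ℂ} {y : E4}
    (hΦ : ∀ μ, DiffM y fun z => Φ z μ) (hu : DiffM y u) (hy : u y * (u y)ᴴ = 1)
    (hglue : ∀ᶠ z in nhds y, ∀ μ, Ψ z μ = u z * Φ z μ) {A : Fin 4 → Matrix (Fin 2) (Fin 2) ℂ}
    {b c : Fin 4 → ℂ} (hT : TorsionFree Φ y A b c) :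
    TorsionFree Ψ y (fun μ => traceFree (u y * A μ * (u y)ᴴ - pdM μ u y * (u y)ᴴ))
      (fun μ => b μ + (u y * A μ * (u y)ᴴ - pdM μ u y * (u y)ᴴ).trace / 2)
      (fun μ => c μ * (u y).det) := by
  have hy' : (u y)ᴴ * u y = 1 := mul_eq_one_comm.1 hy
  have hg : ∀ μ, Ψ y μ = u y * Φ y μ := hglue.self_of_nhds
  have hpd : ∀ μ ν, pdM μ (fun z => Ψ z ν) y = pdM μ u y * Φ y ν + u y * pdM μ (fun z => Φ z ν) y := by
    intro μ ν
    rw [← pdM_mul hu (hΦ ν)]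
    ext i j
    exact pd_congr (hglue.mono fun z hz => congrFun₂ (hz ν) i j) μ
  have key : ∀ μ ν, traceFree (u y * A μ * (u y)ᴴ - pdM μ u y * (u y)ᴴ) * Ψ y ν
        + (b μ + (u y * A μ * (u y)ᴴ - pdM μ u y * (u y)ᴴ).trace / 2) • Ψ y ν
        + (c μ * (u y).det) • epsConj (Ψ y ν)
      = u y * (A μ * Φ y ν + b μ • Φ y ν + c μ • epsConj (Φ y ν)) - pdM μ u y * Φ y ν := by
    intro μ ν
    rw [mul_smul, hg ν, ← epsConj_unitary hy, traceFree, Matrix.sub_mul, Matrix.sub_mul,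
      Matrix.smul_mul, Matrix.one_mul]
    have e1 : ∀ X : Matrix (Fin 2) (Fin 2) ℂ, X * (u y)ᴴ * (u y * Φ y ν) = X * Φ y ν := fun X => by
      rw [Matrix.mul_assoc, ← Matrix.mul_assoc (u y)ᴴ, hy', Matrix.one_mul]
    rw [e1, e1, Matrix.mul_add, Matrix.mul_add, Matrix.mul_smul, Matrix.mul_smul, add_smul,
      Matrix.mul_assoc]
    abel
  intro μ ν
  rw [key, key, d1M_eq, hpd, hpd]
  have := hT μ ν
  rw [d1M_eq] at this
  have h2 := congrArg (u y * ·) this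
  simp only [Matrix.mul_sub, Matrix.mul_neg] at h2
  rw [add_sub_add_comm, h2]
  abel

/-- Differentiating `u u† = 1` shows that `du u†` is anti-Hermitian. -/
theorem unitary_antiHermitian {u : E4 → Matrix (Fin 2) (Fin 2) ℂ} {U : Set E4} (hU : IsOpen U)
    (hs : SmoothM U u) (hu : ∀ z ∈ U, u z * (u z)ᴴ = 1) {y : E4} (hy : y ∈ U) (μ : Fin 4)
    {A : Matrix (Fin 2) (Fin 2) ℂ} (hA : Aᴴ = -A) :
    (u y * A * (u y)ᴴ - pdM μ u y * (u y)ᴴ)ᴴ = -(u y * A * (u y)ᴴ - pdM μ u y * (u y)ᴴ) := by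
  have hd := hs.diffM hU hy
  have h1 := pdM_mul hd (hs.conjTranspose.diffM hU hy) μ
  rw [pdM_congr_on hU hu hy, pdM_const, pdM_conjTranspose hd] at h1
  have h2 := eq_neg_of_add_eq_zero_right h1.symm
  rw [Matrix.conjTranspose_sub, Matrix.conjTranspose_mul, Matrix.conjTranspose_mul,
    Matrix.conjTranspose_conjTranspose, hA, Matrix.conjTranspose_mul,
    Matrix.conjTranspose_conjTranspose, h2]
  simp only [Matrix.mul_assoc, Matrix.neg_mul, Matrix.mul_neg]
  abel

/-! ### The Hermitian form of a coframe -/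

/-- The Hermitian form `∑_c Ψ_μ^c conj(Ψ_ν^c) = g_{μν} - i ω_{μν}`. -/
def herm (Ψ : C2Form) (y : E4) : Matrix (Fin 4) (Fin 4) ℂ :=
  Matrix.of fun μ ν => ((Ψ y ν)ᴴ * Ψ y μ) 0 0

theorem metric_eq_re (Ψ : C2Form) (y : E4) (μ ν : Fin 4) :
    metric Ψ y μ ν = (herm Ψ y μ ν).re := by
  simp [metric, herm, Matrix.mul_apply]
  ring

theorem omega_eq_im (Ψ : C2Form) (y : E4) (μ ν : Fin 4) :
    omega Ψ y μ ν = -(herm Ψ y μ ν).im := by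
  simp [omega, herm, Matrix.mul_apply]
  ring

theorem herm_eq (Ψ : C2Form) (y : E4) (μ ν : Fin 4) :
    herm Ψ y μ ν = metric Ψ y μ ν - Complex.I * omega Ψ y μ ν := by
  rw [metric_eq_re, omega_eq_im]
  apply Complex.ext <;> simp

theorem herm_eq_iff (Ψ Φ : C2Form) (y : E4) :
    (metric Ψ y = metric Φ y ∧ omega Ψ y = omega Φ y) ↔ herm Ψ y = herm Φ y := by
  constructor
  · rintro ⟨h1, h2⟩
    ext μ ν
    rw [herm_eq, herm_eq, h1, h2]
  · intro h
    constructor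
    · ext μ ν
      rw [metric_eq_re, metric_eq_re, h]
    · ext μ ν
      rw [omega_eq_im, omega_eq_im, h]

theorem herm_unitary {Ψ Φ : C2Form} {y : E4} {u : Matrix (Fin 2) (Fin 2) ℂ} (hu : uᴴ * u = 1)
    (h : ∀ μ, Ψ y μ = u * Φ y μ) : herm Ψ y = herm Φ y := by
  ext μ ν
  simp only [herm, Matrix.of_apply]
  rw [h, h, Matrix.conjTranspose_mul, Matrix.mul_assoc, ← Matrix.mul_assoc uᴴ, hu, Matrix.one_mul]

theorem herm_pull (τ : E4 → E4) (Ψ : C2Form) (y : E4) :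
    herm (pull1 τ Ψ) y = Matrix.of (pull2 τ (herm Ψ) y) := by
  ext μ ν
  simp only [herm, pull1, pull2, Matrix.of_apply, Matrix.conjTranspose_sum, Matrix.sum_mul,
    Matrix.mul_sum, Matrix.conjTranspose_smul, star_trivial, Matrix.sum_apply]
  exact Finset.sum_congr rfl fun κ _ => Finset.sum_congr rfl fun ι _ => by
    rw [Matrix.smul_mul, Matrix.mul_smul, smul_smul, mul_comm (pd ν _ _)]
    rfl

theorem metric_pull (τ : E4 → E4) (Ψ : C2Form) (y : E4) :
    metric (pull1 τ Ψ) y = Matrix.of (pull2 τ (fun z => metric Ψ z) y) := by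
  ext μ ν
  rw [metric_eq_re, herm_pull]
  simp [pull2, metric_eq_re]

theorem omega_pull (τ : E4 → E4) (Ψ : C2Form) (y : E4) :
    omega (pull1 τ Ψ) y = Matrix.of (pull2 τ (fun z => omega Ψ z) y) := by
  ext μ ν
  rw [omega_eq_im, herm_pull]
  simp [pull2, omega_eq_im]

/-! ### `U(2)`-structures on a manifold -/

section Global

variable {M : Type*} [TopologicalSpace M]

theorem isOpen_overlap (chart : ℕ → OpenPartialHomeomorph M E4) (i j : ℕ) :
    IsOpen (overlap chart i j) :=
  ((chart i).symm.trans (chart j)).open_source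

variable [ChartedSpace E4 M] (P : U2Structure M)

namespace U2Structure

theorem isSmoothCoframe (i : ℕ) : IsSmoothCoframe (P.chart i).target (P.Psi i) :=
  ⟨(P.chart i).open_target, P.smooth i, P.nondeg i⟩

theorem contDiffOn_transition (i j : ℕ) :
    ContDiffOn ℝ ∞ (transition P.chart i j) (overlap P.chart i j) := by
  have h := StructureGroupoid.compatible_of_mem_maximalAtlas (P.chart_mem i) (P.chart_mem j)
  rw [contDiffGroupoid, mem_groupoid_of_pregroupoid] at h
  have h1 := h.1
  simp only [contDiffPregroupoid, modelWithCornersSelf_coe, modelWithCornersSelf_coe_symm] at h1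
  simp only [Set.preimage_id, Set.range_id, Set.inter_univ, Function.comp_id, Function.id_comp] at h1
  exact h1

theorem transition_mem {i j : ℕ} {y : E4} (hy : y ∈ overlap P.chart i j) :
    transition P.chart i j y ∈ (P.chart j).target := (P.chart j).map_source hy.2

theorem herm_overlap {i j : ℕ} {y : E4} (hy : y ∈ overlap P.chart i j) :
    herm (P.Psi i) y = herm (pull1 (transition P.chart i j) (P.Psi j)) y :=
  herm_unitary (Matrix.mem_unitaryGroup_iff'.1 (P.trans_unitary i j y hy)) (P.glue i j y hy)

/-- The transformation law needs no computation with Christoffel symbols. The potential transported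
from gauge `j` satisfies a torsion-free equation for `Ψ_i`, hence the Euler-Lagrange equation there,
and the pointwise solution is unique. -/
theorem isSU2Connection_asd : IsSU2Connection P fun i => asdLeviCivita (P.Psi i) := by
  refine ⟨fun i μ c d => ?_, fun i y hy μ => (P.isSmoothCoframe i).asd_isSu2 hy μ,
    fun i j y hy μ => ?_⟩
  · have hs := (P.isSmoothCoframe i).smooth_leviCivita μ
    have hw : ∀ I J, ContDiffOn ℝ ∞ (fun y => ((leviCivita (P.Psi i) y μ I J : ℝ) : ℂ))
        (P.chart i).target := fun I J =>
      Complex.ofRealCLM.contDiff.comp_contDiffOn (hs I J)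
    have hX : ∀ I J, ContDiffOn ℝ ∞ (fun y => ((((1 / 2 : ℝ) • (leviCivita (P.Psi i) y μ
        - hodge (leviCivita (P.Psi i) y μ))) I J : ℝ) : ℂ)) (P.chart i).target := by
      intro I J
      simp only [Matrix.smul_apply, Matrix.sub_apply, smul_eq_mul, Complex.ofReal_mul,
        Complex.ofReal_sub]
      refine contDiffOn_const.mul ((hw I J).sub ?_)
      fin_cases I <;> fin_cases J <;> simp [hodge] <;>
        first | exact contDiffOn_const | exact hw _ _ | exact (hw _ _).neg
    fin_cases c <;> fin_cases d
    all_goals exact (hX _ _).add (contDiffOn_const.mul (hX _ _))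
  · have hO := isOpen_overlap P.chart i j
    have hτy := P.transition_mem hy
    have hj := P.isSmoothCoframe j
    have hτ : ContDiffAt ℝ ∞ (transition P.chart i j) y :=
      (P.contDiffOn_transition i j).contDiffAt (hO.mem_nhds hy)
    have huu : ∀ z ∈ overlap P.chart i j, P.trans i j z * (P.trans i j z)ᴴ = 1 := fun z hz =>
      Matrix.mem_unitaryGroup_iff.1 (P.trans_unitary i j z hz)
    have hus : SmoothM (overlap P.chart i j) (P.trans i j) := P.trans_smooth i j
    have hΨ : ∀ μ, DiffM (transition P.chart i j y) fun z => P.Psi j z μ := fun μ c d => by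
      fin_cases d
      exact hj.diff hτy μ c
    obtain ⟨b, c, hb, hT⟩ := hj.exists_torsionFree hτy
    have hΦ : ∀ μ, DiffM y fun z => pull1 (transition P.chart i j) (P.Psi j) z μ := by
      have hsm : ∀ μ, SmoothM (overlap P.chart i j)
          fun z => pull1 (transition P.chart i j) (P.Psi j) z μ := by
        intro μ c d
        fin_cases d
        have : (fun z => pull1 (transition P.chart i j) (P.Psi j) z μ c 0) = fun z =>
            ∑ κ, pd μ (fun z => transition P.chart i j z κ) z
              • P.Psi j (transition P.chart i j z) κ c 0 := by
          funext z
          simp [pull1, Matrix.sum_apply]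
        change ContDiffOn ℝ ∞ (fun z => pull1 (transition P.chart i j) (P.Psi j) z μ c 0) _
        rw [this]
        refine ContDiffOn.sum fun κ _ => ?_
        have h1 := contDiffOn_pd ((EuclideanSpace.proj κ : E4 →L[ℝ] ℝ).contDiff.comp_contDiffOn
          (P.contDiffOn_transition i j)) hO μ
        have h2 := (P.smooth j κ c).comp (P.contDiffOn_transition i j) fun z hz =>
          P.transition_mem hz
        exact h1.smul h2
      exact fun μ => (hsm μ).diffM hO hy
    have hT' := (hT.pull hτ hΨ).gauge hΦ (hus.diffM hO hy) (huu y hy)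
      (Filter.eventually_of_mem (hO.mem_nhds hy) fun z hz => P.glue i j z hz)
    have hA : ∀ μ, IsSu2 (∑ κ, pd μ (fun z => transition P.chart i j z κ) y
        • asdLeviCivita (P.Psi j) (transition P.chart i j y) κ) := fun μ =>
      isSu2_sum _ fun κ _ => (hj.asd_isSu2 hτy κ).real_smul _
    have hX := fun μ => unitary_antiHermitian hO hus huu hy μ (hA μ).1
    have hb' : ∀ μ, star (∑ κ, pd μ (fun z => transition P.chart i j z κ) y • b κ)
        = -∑ κ, pd μ (fun z => transition P.chart i j z κ) y • b κ := fun μ => by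
      simp only [star_sum, star_smul, star_trivial, hb, smul_neg, Finset.sum_neg_distrib]
    have hi := P.isSmoothCoframe i
    have hel := hT'.elForm_eq_zero (hi.diff hy.1) (fun μ => traceFree_isSu2 (hX μ)) fun μ => by
      rw [star_add, hb', star_div₀, ← Matrix.trace_conjTranspose, hX, Matrix.trace_neg]
      simp
      ring
    have := (hi.elForm_eq_zero_iff hy.1 fun μ => traceFree_isSu2 (hX μ)).1 hel
    exact (congrFun this μ).symm

end U2Structure

end Global

/-! ### Algebra and calculus of `𝔰𝔲(2)`-valued forms -/

theorem IsSu2.comm {X Y : Matrix (Fin 2) (Fin 2) ℂ} (hX : IsSu2 X) (hY : IsSu2 Y) :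
    IsSu2 (X * Y - Y * X) :=
  ⟨by rw [Matrix.conjTranspose_sub, Matrix.conjTranspose_mul, Matrix.conjTranspose_mul, hX.1, hY.1]
      simp, by rw [Matrix.trace_sub, Matrix.trace_mul_comm, sub_self]⟩

-- For anti-Hermitian `X` the number `-Tr X²` is the sum of the squared moduli of the entries.
open scoped ComplexOrder in
theorem IsSu2.eq_zero_of_trace_sq {X : Matrix (Fin 2) (Fin 2) ℂ} (hX : IsSu2 X)
    (h : (X * X).trace = 0) : X = 0 := by
  have h' : (Xᴴ * X).trace = 0 := by rw [hX.1, Matrix.neg_mul, Matrix.trace_neg, h, neg_zero]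
  exact Matrix.trace_conjTranspose_mul_self_eq_zero_iff.1 h'

theorem isSu2_pdM {U : Set E4} (hU : IsOpen U) {F : E4 → Matrix (Fin 2) (Fin 2) ℂ} {y : E4}
    (hy : y ∈ U) (hd : DiffM y F) (hF : ∀ z ∈ U, IsSu2 (F z)) (μ : Fin 4) :
    IsSu2 (pdM μ F y) := by
  constructor
  · rw [← pdM_conjTranspose hd, pdM_congr_on hU (fun z hz => (hF z hz).1) hy]
    ext i j
    exact pd_neg _ _ _
  · rw [Matrix.trace_fin_two]
    have : pdM μ F y 1 1 = -pdM μ F y 0 0 :=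
      (pd_congr_on hU (fun z hz => (hF z hz).entries.1) hy μ).trans (pd_neg _ _ _)
    rw [this, add_neg_cancel]

theorem elLin_isSu2 {S : Fin 4 → Fin 4 → Matrix (Fin 2) (Fin 2) ℂ}
    {B : Fin 4 → Matrix (Fin 2) (Fin 2) ℂ} (hS : ∀ μ ν, IsSu2 (S μ ν)) (hB : ∀ μ, IsSu2 (B μ))
    (μ ν ρ : Fin 4) : IsSu2 (elLin S B μ ν ρ) := by
  rw [elLin_eq]
  exact (((hB _).comm (hS _ _)).sub ((hB _).comm (hS _ _))).add ((hB _).comm (hS _ _))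

/-- Components with a repeated index equal their own negatives, and every other one is, up to sign,
one of the four listed. The complex scalars serve only for division by two. -/
theorem eq_zero_of_antisymm {X : Type*} [AddCommGroup X] [Module ℂ X]
    {θ : Fin 4 → Fin 4 → Fin 4 → X}
    (h1 : ∀ μ ν ρ, θ μ ν ρ = -θ ν μ ρ) (h2 : ∀ μ ν ρ, θ μ ν ρ = -θ μ ρ ν)
    (h012 : θ 0 1 2 = 0) (h013 : θ 0 1 3 = 0) (h023 : θ 0 2 3 = 0) (h123 : θ 1 2 3 = 0) :
    θ = 0 := by
  have hz : ∀ x : X, x = -x → x = 0 := fun x hx => by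
    have h : (2 : ℂ) • x = 0 := by
      rw [two_smul]; nth_rewrite 1 [hx]; exact neg_add_cancel x
    exact (smul_eq_zero.1 h).resolve_left two_ne_zero
  have a : ∀ μ ν ρ, θ μ ν ρ = 0 → θ ν μ ρ = 0 := fun μ ν ρ h => by rw [h1, h, neg_zero]
  have b : ∀ μ ν ρ, θ μ ν ρ = 0 → θ μ ρ ν = 0 := fun μ ν ρ h => by rw [h2, h, neg_zero]
  have d : ∀ μ ρ, θ μ μ ρ = 0 := fun μ ρ => hz _ (h1 μ μ ρ)
  have e : ∀ μ ρ, θ μ ρ ρ = 0 := fun μ ρ => hz _ (h2 μ ρ ρ)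
  have f : ∀ μ ρ, θ μ ρ μ = 0 := fun μ ρ => b _ _ _ (d μ ρ)
  funext μ ν ρ
  change θ μ ν ρ = 0
  fin_cases μ <;> fin_cases ν <;> fin_cases ρ <;>
  first
  | exact d _ _
  | exact e _ _
  | exact f _ _
  | assumption
  | exact a _ _ _ (by assumption)
  | exact b _ _ _ (by assumption)
  | exact a _ _ _ (b _ _ _ (by assumption))
  | exact b _ _ _ (a _ _ _ (by assumption))
  | exact a _ _ _ (b _ _ _ (a _ _ _ (by assumption)))

theorem d2M_eq {p q : ℕ} (σ : E4 → Fin 4 → Fin 4 → Matrix (Fin p) (Fin q) ℂ) (y : E4)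
    (μ ν ρ : Fin 4) : d2M σ y μ ν ρ = pdM μ (fun z => σ z ν ρ) y - pdM ν (fun z => σ z μ ρ) y
      + pdM ρ (fun z => σ z μ ν) y := rfl

theorem pdM_sigma_antisymm (Ψ : C2Form) (y : E4) (μ ν ρ : Fin 4) :
    pdM μ (fun z => sigma Ψ z ν ρ) y = -pdM μ (fun z => sigma Ψ z ρ ν) y := by
  simp only [sigma_antisymm Ψ _ ν ρ]
  ext i j
  exact pd_neg _ _ _

theorem elForm_antisymm (Ψ : C2Form) (y : E4) (B : Fin 4 → Matrix (Fin 2) (Fin 2) ℂ) :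
    (∀ μ ν ρ, elForm Ψ y B μ ν ρ = -elForm Ψ y B ν μ ρ) ∧
      ∀ μ ν ρ, elForm Ψ y B μ ν ρ = -elForm Ψ y B μ ρ ν := by
  constructor
  · intro μ ν ρ
    rw [elForm_eq, elForm_eq, d2M_eq, d2M_eq, elLin_eq, elLin_eq, pdM_sigma_antisymm Ψ y ρ ν μ,
      sigma_antisymm Ψ y ν μ]
    simp only [Matrix.mul_neg, Matrix.neg_mul]
    abel
  · intro μ ν ρ
    rw [elForm_eq, elForm_eq, d2M_eq, d2M_eq, elLin_eq, elLin_eq, pdM_sigma_antisymm Ψ y μ ρ ν,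
      sigma_antisymm Ψ y ρ ν]
    simp only [Matrix.mul_neg, Matrix.neg_mul]
    abel

/-- `Tr Ψ†FΨ = -Tr (F ∧ Σ)` for trace-free `F`. -/
theorem trace_psi_F_psi (Ψ : C2Form) (y : E4) (F : Fin 4 → Fin 4 → Matrix (Fin 2) (Fin 2) ℂ)
    (hF : ∀ μ ν, (F μ ν).trace = 0) :
    Matrix.trace (w31 (w12 (dag Ψ y) F : Fin 4 → Fin 4 → Fin 4 → Matrix (Fin 1) (Fin 2) ℂ) (Ψ y)
        : Matrix (Fin 1) (Fin 1) ℂ)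
      = -Matrix.trace (w22 F (sigma Ψ y) : Matrix (Fin 2) (Fin 2) ℂ) := by
  have h11 : ∀ μ ν, F μ ν 1 1 = -F μ ν 0 0 := fun μ ν => by
    have := hF μ ν
    rw [Matrix.trace_fin_two] at this
    exact eq_neg_of_add_eq_zero_right this
  simp only [w31, w12, w22, Matrix.trace_fin_one, Matrix.trace_fin_two, Matrix.add_apply,
    Matrix.sub_apply, Matrix.mul_apply, Fin.sum_univ_two, sigma_apply, h11, dag,
    Matrix.conjTranspose_apply, Matrix.one_apply_eq, ne_eq, zero_ne_one, one_ne_zero,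
    not_false_eq_true, Matrix.one_apply_ne]
  ring

/-- Cyclicity of the trace, with the signs of graded commutation: it moves `δ` to the front of
`Tr((A∧δ + δ∧A) ∧ Σ)`. -/
theorem trace_w22_w13 (A δ : Fin 4 → Matrix (Fin 2) (Fin 2) ℂ)
    (S : Fin 4 → Fin 4 → Matrix (Fin 2) (Fin 2) ℂ) :
    Matrix.trace (w22 (fun μ ν => (w11 A δ μ ν + w11 δ A μ ν : Matrix (Fin 2) (Fin 2) ℂ)) S
        : Matrix (Fin 2) (Fin 2) ℂ)
      = Matrix.trace (w13 δ (elLin S A) : Matrix (Fin 2) (Fin 2) ℂ) := by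
  simp only [w22, w11, w13, elLin_eq, Matrix.trace_fin_two, Matrix.add_apply,
    Matrix.sub_apply, Matrix.mul_apply, Fin.sum_univ_two]
  ring

theorem pd_trace {F : E4 → Matrix (Fin 2) (Fin 2) ℂ} {y : E4} (hF : DiffM y F) (μ : Fin 4) :
    pd μ (fun z => (F z).trace) y = (pdM μ F y).trace := by
  simp only [Matrix.trace_fin_two]
  exact pd_add (hF 0 0) (hF 1 1) μ

/-- The `3`-form `Tr(δ ∧ Σ)`. -/
noncomputable def trDeltaSigma (Ψ : C2Form) (δ : M2Form) (μ ν ρ : Fin 4) (y : E4) : ℂ :=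
  Matrix.trace (w12 (δ y) (sigma Ψ y) μ ν ρ : Matrix (Fin 2) (Fin 2) ℂ)

theorem pd_trDeltaSigma {Ψ : C2Form} {δ : M2Form} {y : E4} (hδ : ∀ μ, DiffM y fun z => δ z μ)
    (hS : ∀ μ ν, DiffM y fun z => sigma Ψ z μ ν) (κ μ ν ρ : Fin 4) :
    pd κ (trDeltaSigma Ψ δ μ ν ρ) y
      = Matrix.trace ((pdM κ (fun z => δ z μ) y * sigma Ψ y ν ρ
            + δ y μ * pdM κ (fun z => sigma Ψ z ν ρ) y)
          - (pdM κ (fun z => δ z ν) y * sigma Ψ y μ ρ + δ y ν * pdM κ (fun z => sigma Ψ z μ ρ) y)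
          + (pdM κ (fun z => δ z ρ) y * sigma Ψ y μ ν + δ y ρ * pdM κ (fun z => sigma Ψ z μ ν) y)) := by
  have hm : ∀ μ ν ρ, DiffM y fun z => δ z μ * sigma Ψ z ν ρ := fun μ ν ρ i j => by
    simp only [Matrix.mul_apply]
    exact DifferentiableAt.fun_sum fun k _ => (hδ μ i k).mul (hS ν ρ k j)
  have ht : ∀ μ ν ρ, DifferentiableAt ℝ (fun z => (δ z μ * sigma Ψ z ν ρ).trace) y :=
    fun μ ν ρ => by
      simp only [Matrix.trace_fin_two]
      exact (hm μ ν ρ 0 0).add (hm μ ν ρ 1 1)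
  have e : trDeltaSigma Ψ δ μ ν ρ = fun z => (δ z μ * sigma Ψ z ν ρ).trace
      - (δ z ν * sigma Ψ z μ ρ).trace + (δ z ρ * sigma Ψ z μ ν).trace := by
    funext z
    simp only [trDeltaSigma, w12, Matrix.trace_add, Matrix.trace_sub]
  rw [e, pd_add ((ht _ _ _).fun_sub (ht _ _ _)) (ht _ _ _), pd_sub (ht _ _ _) (ht _ _ _),
    pd_trace (hm _ _ _), pd_trace (hm _ _ _), pd_trace (hm _ _ _), pdM_mul (hδ _) (hS _ _),
    pdM_mul (hδ _) (hS _ _), pdM_mul (hδ _) (hS _ _)]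
  simp only [Matrix.trace_add, Matrix.trace_sub]

/-- `Tr(dδ ∧ Σ) = d Tr(δ ∧ Σ) + Tr(δ ∧ dΣ)`. -/
theorem trace_d1M_sigma {Ψ : C2Form} {δ : M2Form} {y : E4} (hδ : ∀ μ, DiffM y fun z => δ z μ)
    (hS : ∀ μ ν, DiffM y fun z => sigma Ψ z μ ν) :
    Matrix.trace (w22 (d1M δ y) (sigma Ψ y) : Matrix (Fin 2) (Fin 2) ℂ)
      = (pd 0 (trDeltaSigma Ψ δ 1 2 3) y - pd 1 (trDeltaSigma Ψ δ 0 2 3) y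
          + pd 2 (trDeltaSigma Ψ δ 0 1 3) y - pd 3 (trDeltaSigma Ψ δ 0 1 2) y)
        + Matrix.trace (w13 (δ y) (d2M (sigma Ψ) y) : Matrix (Fin 2) (Fin 2) ℂ) := by
  simp only [pd_trDeltaSigma hδ hS, w22, w13, d1M_eq, d2M_eq, Matrix.trace_add, Matrix.trace_sub,
    Matrix.mul_add, Matrix.mul_sub, Matrix.sub_mul]
  ring

/-! ### Integration over a gauge patch -/

section Integration

variable {V : Set E4} {Ψ : C2Form}

/-- The determinant of the coframe is continuous and nonzero, so its sign is locally constant and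
passes through derivatives. -/
theorem IsSmoothCoframe.orient_eventually (h : IsSmoothCoframe V Ψ) {y : E4} (hy : y ∈ V) :
    ∀ᶠ z in nhds y, orient Ψ z = orient Ψ y := by
  have hc : ContinuousAt (volForm Ψ) y :=
    (h.smooth_coframe.det.continuousOn).continuousAt (h.isOpen.mem_nhds hy)
  rcases lt_or_gt_of_ne (show volForm Ψ y ≠ 0 from h.nondeg y hy) with hn | hp
  · filter_upwards [hc.eventually_lt continuousAt_const hn] with z hz
    rw [orient, orient, Real.sign_of_neg hz, Real.sign_of_neg hn]
  · filter_upwards [continuousAt_const.eventually_lt hc hp] with z hz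
    rw [orient, orient, Real.sign_of_pos hz, Real.sign_of_pos hp]

/-- The extension by zero of `± f`, with the sign of the orientation. -/
noncomputable def orientExt (V : Set E4) (Ψ : C2Form) (f : E4 → ℂ) : E4 → ℂ :=
  V.indicator fun y => (orient Ψ y : ℂ) * f y

variable {K : Set E4} {f : E4 → ℂ}

theorem orientExt_eventually (h : IsSmoothCoframe V Ψ) (f : E4 → ℂ) {y : E4} (hy : y ∈ V) :
    orientExt V Ψ f =ᶠ[nhds y] fun z => (orient Ψ y : ℂ) * f z := by
  filter_upwards [h.isOpen.mem_nhds hy, h.orient_eventually hy] with z hz hz'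
  rw [orientExt, Set.indicator_of_mem hz, hz']

theorem orientExt_eq_zero (hf : ∀ y ∈ V, y ∉ K → f y = 0) {y : E4} (hy : y ∉ K) :
    orientExt V Ψ f y = 0 := by
  by_cases hV : y ∈ V
  · rw [orientExt, Set.indicator_of_mem hV, hf y hV hy, mul_zero]
  · rw [orientExt, Set.indicator_of_notMem hV]

/-- The open sets `V` and the complement of `K` cover the space: on the first the function is
locally a constant times `f`, on the second it is zero. -/
theorem contDiff_orientExt (h : IsSmoothCoframe V Ψ) (hK : IsCompact K) (hKV : K ⊆ V)
    (hs : ContDiffOn ℝ ∞ f V) (hf : ∀ y ∈ V, y ∉ K → f y = 0) :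
    ContDiff ℝ ∞ (orientExt V Ψ f) := by
  rw [contDiff_iff_contDiffAt]
  intro y
  by_cases hy : y ∈ V
  · exact (contDiffAt_const.mul (hs.contDiffAt (h.isOpen.mem_nhds hy))).congr_of_eventuallyEq
      (orientExt_eventually h f hy)
  · refine (contDiffAt_const (c := (0 : ℂ))).congr_of_eventuallyEq ?_
    filter_upwards [hK.isClosed.isOpen_compl.mem_nhds fun hk => hy (hKV hk)] with z hz
    exact orientExt_eq_zero hf hz

theorem hasCompactSupport_orientExt (hK : IsCompact K) (hf : ∀ y ∈ V, y ∉ K → f y = 0) :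
    HasCompactSupport (orientExt V Ψ f) :=
  HasCompactSupport.intro hK fun _ hy => orientExt_eq_zero hf hy

theorem integrable_orientExt (h : IsSmoothCoframe V Ψ) (hK : IsCompact K) (hKV : K ⊆ V)
    (hs : ContDiffOn ℝ ∞ f V) (hf : ∀ y ∈ V, y ∉ K → f y = 0) :
    Integrable (orientExt V Ψ f) :=
  (contDiff_orientExt h hK hKV hs hf).continuous.integrable_of_hasCompactSupport
    (hasCompactSupport_orientExt hK hf)

theorem integrableOn_orient (h : IsSmoothCoframe V Ψ) (hK : IsCompact K) (hKV : K ⊆ V)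
    (hs : ContDiffOn ℝ ∞ f V) (hf : ∀ y ∈ V, y ∉ K → f y = 0) :
    IntegrableOn (fun y => (orient Ψ y : ℂ) * f y) V :=
  (integrable_indicator_iff h.isOpen.measurableSet).1 (integrable_orientExt h hK hKV hs hf)

theorem integral_pd_eq_zero {g : E4 → ℂ} (hg : ContDiff ℝ ∞ g) (hc : HasCompactSupport g)
    (μ : Fin 4) : ∫ y, pd μ g y = 0 := by
  have hint : Integrable g := hg.continuous.integrable_of_hasCompactSupport hc
  have hint' : Integrable (pd μ g) := by
    have hcont : Continuous (pd μ g) :=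
      ((hg.fderiv_right (m := ∞) (by simp)).clm_apply contDiff_const).continuous
    exact hcont.integrable_of_hasCompactSupport (hc.fderiv_apply ℝ _)
  -- Integration by parts against the constant function `1`.
  have := integral_mul_fderiv_eq_neg_fderiv_mul_of_integrable (𝕜 := ℂ) (μ := (volume : Measure E4))
    (f := fun _ => (1 : ℂ)) (g := g) (v := EuclideanSpace.single μ 1)
    (by simp) (by simp only [one_mul]; exact hint') (by simpa using hint)
    (fun _ _ => differentiableAt_const _) (fun _ _ => hg.differentiable (by simp) _)
  simpa [pd] using this

/-- Stokes on a gauge patch: the signed derivative, extended by zero, is the derivative of a smooth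
compactly supported function on all of `ℝ⁴`. -/
theorem integral_orient_pd (h : IsSmoothCoframe V Ψ) (hK : IsCompact K) (hKV : K ⊆ V)
    (hs : ContDiffOn ℝ ∞ f V) (hf : ∀ y ∈ V, y ∉ K → f y = 0) (μ : Fin 4) :
    ∫ y in V, (orient Ψ y : ℂ) * pd μ f y = 0 := by
  rw [← integral_pd_eq_zero (contDiff_orientExt h hK hKV hs hf)
    (hasCompactSupport_orientExt hK hf) μ, ← integral_indicator h.isOpen.measurableSet]
  congr 1
  funext y
  by_cases hy : y ∈ V
  · rw [Set.indicator_of_mem hy, pd_congr (orientExt_eventually h f hy),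
      pd_const_mul _ (differentiableAt_of_contDiffOn hs h.isOpen hy)]
  · rw [Set.indicator_of_notMem hy]
    have : orientExt V Ψ f =ᶠ[nhds y] fun _ => 0 := by
      filter_upwards [hK.isClosed.isOpen_compl.mem_nhds fun hk => hy (hKV hk)] with z hz
      exact orientExt_eq_zero hf hz
    rw [pd_congr this, pd_const]

end Integration

/-! ### The first variation of the action -/

section Variation

variable {V : Set E4} {Ψ : C2Form} {A δ : M2Form}

/-- The covariant derivative `dδ + A ∧ δ + δ ∧ A`. -/
noncomputable def covD (A δ : M2Form) (y : E4) (μ ν : Fin 4) : Matrix (Fin 2) (Fin 2) ℂ :=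
  d1M δ y μ ν + (w11 (A y) (δ y) μ ν + w11 (δ y) (A y) μ ν)

theorem curv_add {y : E4} (hA : ∀ μ, DiffM y fun z => A z μ) (hδ : ∀ μ, DiffM y fun z => δ z μ) (t : ℂ)
    (μ ν : Fin 4) :
    curv (fun z μ => A z μ + t • δ z μ) y μ ν
      = curv A y μ ν + t • covD A δ y μ ν + t ^ 2 • w11 (δ y) (δ y) μ ν := by
  have hp : ∀ μ ν, pdM μ (fun z => A z ν + t • δ z ν) y
      = pdM μ (fun z => A z ν) y + t • pdM μ (fun z => δ z ν) y := fun μ ν => by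
    ext i j
    exact (pd_add (hA ν i j) ((hδ ν i j).const_mul t) μ).trans
      (congrArg _ (pd_const_mul t (hδ ν i j) μ))
  simp only [curv, covD, d1M_eq, hp, w11, Matrix.add_mul, Matrix.mul_add, Matrix.smul_mul,
    Matrix.mul_smul, smul_add, smul_sub, smul_smul, sq]
  abel

theorem trace_curv (hV : IsOpen V) {y : E4} (hy : y ∈ V) (hA : ∀ z ∈ V, ∀ μ, IsSu2 (A z μ))
    (hd : ∀ μ, DiffM y fun z => A z μ) (μ ν : Fin 4) : (curv A y μ ν).trace = 0 := by
  have h1 := fun μ ν => (isSu2_pdM hV hy (hd ν) (fun z hz => hA z hz ν) μ).2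
  rw [curv, d1M_eq, Matrix.trace_add, Matrix.trace_sub, h1, h1, w11,
    ((hA y hy μ).comm (hA y hy ν)).2]
  simp

/-- The terms with `μ` and `ν` do not involve the `SU(2)` connection, and the first term is `-λ Tr(F
∧ Σ)`. -/
theorem lagrangian_sub (lam mu nu : ℝ) (Ψ : C2Form) (a : E4 → Fin 4 → ℂ) (A B : M2Form) (y : E4)
    (hA : ∀ μ ν, (curv A y μ ν).trace = 0) (hB : ∀ μ ν, (curv B y μ ν).trace = 0) :
    lagrangian lam mu nu Ψ a B y - lagrangian lam mu nu Ψ a A y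
      = -(lam : ℂ) * (Matrix.trace (w22 (curv B y) (sigma Ψ y) : Matrix (Fin 2) (Fin 2) ℂ)
        - Matrix.trace (w22 (curv A y) (sigma Ψ y) : Matrix (Fin 2) (Fin 2) ℂ)) := by
  have h1 := trace_psi_F_psi Ψ y _ hA
  have h2 := trace_psi_F_psi Ψ y _ hB
  simp only [lagrangian, psiFpsi, Matrix.trace_add, Matrix.trace_smul, h1, h2, smul_eq_mul]
  ring

theorem trace_w22_add_smul (F G H S : Fin 4 → Fin 4 → Matrix (Fin 2) (Fin 2) ℂ) (t : ℂ) :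
    Matrix.trace (w22 (fun μ ν => F μ ν + t • G μ ν + t ^ 2 • H μ ν) S : Matrix (Fin 2) (Fin 2) ℂ)
      = Matrix.trace (w22 F S : Matrix (Fin 2) (Fin 2) ℂ)
        + t * Matrix.trace (w22 G S : Matrix (Fin 2) (Fin 2) ℂ)
        + t ^ 2 * Matrix.trace (w22 H S : Matrix (Fin 2) (Fin 2) ℂ) := by
  simp only [w22, Matrix.add_mul, Matrix.smul_mul, Matrix.trace_add, Matrix.trace_sub,
    Matrix.trace_smul, smul_eq_mul]
  ring

/-- `A` is a smooth `𝔰𝔲(2)`-valued form on `V`. -/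
structure IsSmoothSu2 (V : Set E4) (A : M2Form) : Prop where
  smooth : ∀ μ, SmoothM V fun y => A y μ
  su2 : ∀ y ∈ V, ∀ μ, IsSu2 (A y μ)

theorem IsVariation.isSmoothSu2 (h : IsVariation V δ) : IsSmoothSu2 V δ :=
  ⟨fun μ c d => (h.1 μ c d).contDiffOn, fun y _ μ => h.2.1 y μ⟩

theorem IsSmoothCoframe.smooth_sigma (h : IsSmoothCoframe V Ψ) (μ ν : Fin 4) :
    SmoothM V fun y => sigma Ψ y μ ν := by
  have hs : ∀ μ c, ContDiffOn ℝ ∞ (fun y => star (Ψ y μ c 0)) V := fun μ c =>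
    (Complex.conjCLE : ℂ →L[ℝ] ℂ).contDiff.comp_contDiffOn (h.smooth μ c)
  intro i j
  simp only [sigma_apply, Fin.sum_univ_two]
  exact ((((h.smooth _ _).mul (hs _ _)).sub ((h.smooth _ _).mul (hs _ _)))).add
    ((contDiffOn_const.mul ((((hs _ _).mul (h.smooth _ _)).sub ((hs _ _).mul (h.smooth _ _))).add
      (((hs _ _).mul (h.smooth _ _)).sub ((hs _ _).mul (h.smooth _ _))))).mul contDiffOn_const)

theorem contDiffOn_trace {F : E4 → Matrix (Fin 2) (Fin 2) ℂ} (hF : SmoothM V F) :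
    ContDiffOn ℝ ∞ (fun y => (F y).trace) V := by
  simp only [Matrix.trace_fin_two]
  exact (hF 0 0).add (hF 1 1)

theorem smoothM_w11 {A B : M2Form} (hA : ∀ μ, SmoothM V fun y => A y μ)
    (hB : ∀ μ, SmoothM V fun y => B y μ) (μ ν : Fin 4) :
    SmoothM V fun y => (w11 (A y) (B y) μ ν : Matrix (Fin 2) (Fin 2) ℂ) :=
  ((hA μ).mul (hB ν)).sub ((hA ν).mul (hB μ))

theorem smoothM_w22 {σ τ : E4 → Fin 4 → Fin 4 → Matrix (Fin 2) (Fin 2) ℂ}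
    (hσ : ∀ μ ν, SmoothM V fun y => σ y μ ν) (hτ : ∀ μ ν, SmoothM V fun y => τ y μ ν) :
    SmoothM V fun y => (w22 (σ y) (τ y) : Matrix (Fin 2) (Fin 2) ℂ) :=
  have hm := fun μ ν ρ κ => (hσ μ ν).mul (hτ ρ κ)
  ((((((hm 0 1 2 3).sub (hm 0 2 1 3)).add (hm 0 3 1 2)).add (hm 1 2 0 3)).sub
    (hm 1 3 0 2)).add (hm 2 3 0 1))

theorem smoothM_w13 {α : M2Form} {θ : E4 → Fin 4 → Fin 4 → Fin 4 → Matrix (Fin 2) (Fin 2) ℂ}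
    (hα : ∀ μ, SmoothM V fun y => α y μ) (hθ : ∀ μ ν ρ, SmoothM V fun y => θ y μ ν ρ) :
    SmoothM V fun y => (w13 (α y) (θ y) : Matrix (Fin 2) (Fin 2) ℂ) :=
  have hm := fun κ μ ν ρ => (hα κ).mul (hθ μ ν ρ)
  ((((hm 0 1 2 3).sub (hm 1 0 2 3)).add (hm 2 0 1 3)).sub (hm 3 0 1 2))

theorem smoothM_elForm (h : IsSmoothCoframe V Ψ) (hA : ∀ μ, SmoothM V fun y => A y μ)
    (μ ν ρ : Fin 4) : SmoothM V fun y => elForm Ψ y (A y) μ ν ρ := by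
  have hS := h.smooth_sigma
  have hd := fun κ μ ν => (hS μ ν).pdM h.isOpen κ
  have h1 := (((hd μ ν ρ).sub (hd ν μ ρ)).add (hd ρ μ ν))
  have h2 := ((((hA μ).mul (hS ν ρ)).sub ((hA ν).mul (hS μ ρ))).add ((hA ρ).mul (hS μ ν)))
  have h3 := ((((hS μ ν).mul (hA ρ)).sub ((hS μ ρ).mul (hA ν))).add ((hS ν ρ).mul (hA μ)))
  exact (h1.add h2).sub h3

theorem smooth_trDeltaSigma (h : IsSmoothCoframe V Ψ) (hδ : ∀ μ, SmoothM V fun y => δ y μ)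
    (μ ν ρ : Fin 4) : ContDiffOn ℝ ∞ (trDeltaSigma Ψ δ μ ν ρ) V :=
  have hS := h.smooth_sigma
  contDiffOn_trace ((((hδ μ).mul (hS ν ρ)).sub ((hδ ν).mul (hS μ ρ))).add ((hδ ρ).mul (hS μ ν)))

/-- `Tr(d_A δ ∧ Σ) = d Tr(δ ∧ Σ) + Tr(δ ∧ (dΣ + A ∧ Σ - Σ ∧ A))`. -/
theorem trace_covD_sigma (h : IsSmoothCoframe V Ψ) (hδ : ∀ μ, SmoothM V fun y => δ y μ) {y : E4}
    (hy : y ∈ V) :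
    Matrix.trace (w22 (covD A δ y) (sigma Ψ y) : Matrix (Fin 2) (Fin 2) ℂ)
      = (pd 0 (trDeltaSigma Ψ δ 1 2 3) y - pd 1 (trDeltaSigma Ψ δ 0 2 3) y
          + pd 2 (trDeltaSigma Ψ δ 0 1 3) y - pd 3 (trDeltaSigma Ψ δ 0 1 2) y)
        + Matrix.trace (w13 (δ y) (elForm Ψ y (A y)) : Matrix (Fin 2) (Fin 2) ℂ) := by
  have e1 : Matrix.trace (w22 (covD A δ y) (sigma Ψ y) : Matrix (Fin 2) (Fin 2) ℂ)
      = Matrix.trace (w22 (d1M δ y) (sigma Ψ y) : Matrix (Fin 2) (Fin 2) ℂ)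
        + Matrix.trace (w22 (fun μ ν => (w11 (A y) (δ y) μ ν + w11 (δ y) (A y) μ ν
          : Matrix (Fin 2) (Fin 2) ℂ)) (sigma Ψ y) : Matrix (Fin 2) (Fin 2) ℂ) := by
    simp only [w22, covD, Matrix.add_mul, Matrix.trace_add, Matrix.trace_sub]
    ring
  have e2 : Matrix.trace (w13 (δ y) (elForm Ψ y (A y)) : Matrix (Fin 2) (Fin 2) ℂ)
      = Matrix.trace (w13 (δ y) (d2M (sigma Ψ) y) : Matrix (Fin 2) (Fin 2) ℂ)
        + Matrix.trace (w13 (δ y) (elLin (sigma Ψ y) (A y)) : Matrix (Fin 2) (Fin 2) ℂ) := by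
    simp only [w13, elForm_eq, Matrix.mul_add, Matrix.trace_add, Matrix.trace_sub]
    ring
  rw [e1, e2, trace_d1M_sigma (fun μ => (hδ μ).diffM h.isOpen hy)
    (fun μ ν => (h.smooth_sigma μ ν).diffM h.isOpen hy), trace_w22_w13]
  ring

theorem integral_linear_combination {X : Type*} [MeasurableSpace X] {m : Measure X}
    {p q r₁ r₂ r₃ r₄ : X → ℂ} (hp : Integrable p m) (hq : Integrable q m) (h₁ : Integrable r₁ m)
    (h₂ : Integrable r₂ m) (h₃ : Integrable r₃ m) (h₄ : Integrable r₄ m) (s t c : ℂ) :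
    ∫ x, (s * p x + t * q x + c * (r₁ x - r₂ x + r₃ x - r₄ x)) ∂m
      = s * ∫ x, p x ∂m + t * ∫ x, q x ∂m
        + c * (∫ x, r₁ x ∂m - ∫ x, r₂ x ∂m + ∫ x, r₃ x ∂m - ∫ x, r₄ x ∂m) := by
  have i1 : Integrable (fun x => s * p x) m := hp.const_mul s
  have i2 : Integrable (fun x => t * q x) m := hq.const_mul t
  have i3 : Integrable (fun x => s * p x + t * q x) m := i1.add i2
  have i4 : Integrable (fun x => r₁ x - r₂ x) m := h₁.sub h₂
  have i5 : Integrable (fun x => r₁ x - r₂ x + r₃ x) m := i4.add h₃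
  have i6 : Integrable (fun x => r₁ x - r₂ x + r₃ x - r₄ x) m := i5.sub h₄
  have i7 : Integrable (fun x => c * (r₁ x - r₂ x + r₃ x - r₄ x)) m := i6.const_mul c
  rw [integral_add i3 i7, integral_add i1 i2, integral_const_mul, integral_const_mul,
    integral_const_mul, integral_sub i5 h₄, integral_add i4 h₃, integral_sub h₁ h₂]

/-- The curvature is exactly quadratic in `t`, so there is no remainder to estimate: the derivative
at `t = 0` is the linear coefficient, after the exact term `d Tr(δ ∧ Σ)` integrates to zero. -/
theorem actionChange_eq (lam mu nu : ℝ) (a : E4 → Fin 4 → ℂ) (h : IsSmoothCoframe V Ψ)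
    (hA : IsSmoothSu2 V A) (hδ : IsVariation V δ) (t : ℝ) :
    actionChange lam mu nu V Ψ a A (fun y μ => (t : ℂ) • δ y μ)
      = t * (∫ y in V, (orient Ψ y : ℂ) * (-(lam : ℂ) * Matrix.trace
          (w13 (δ y) (elForm Ψ y (A y)) : Matrix (Fin 2) (Fin 2) ℂ)))
        + t ^ 2 * ∫ y in V, (orient Ψ y : ℂ) * (-(lam : ℂ) * Matrix.trace
          (w22 (w11 (δ y) (δ y) : Fin 4 → Fin 4 → Matrix (Fin 2) (Fin 2) ℂ) (sigma Ψ y)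
            : Matrix (Fin 2) (Fin 2) ℂ)) := by
  obtain ⟨K, hK, hKV, hδK⟩ := hδ.2.2
  have hδs := hδ.isSmoothSu2
  have hdA := fun y (hy : y ∈ V) μ => (hA.smooth μ).diffM h.isOpen hy
  have hdδ := fun y (hy : y ∈ V) μ => (hδs.smooth μ).diffM h.isOpen hy
  set θ := trDeltaSigma Ψ δ
  set E := fun y => Matrix.trace (w13 (δ y) (elForm Ψ y (A y)) : Matrix (Fin 2) (Fin 2) ℂ)
  set Q := fun y => Matrix.trace
    (w22 (w11 (δ y) (δ y) : Fin 4 → Fin 4 → Matrix (Fin 2) (Fin 2) ℂ) (sigma Ψ y)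
      : Matrix (Fin 2) (Fin 2) ℂ)
  have hE : ContDiffOn ℝ ∞ E V :=
    contDiffOn_trace (smoothM_w13 hδs.smooth (smoothM_elForm h hA.smooth))
  have hQ : ContDiffOn ℝ ∞ Q V :=
    contDiffOn_trace (smoothM_w22 (smoothM_w11 hδs.smooth hδs.smooth) h.smooth_sigma)
  have hθ : ∀ μ ν ρ, ContDiffOn ℝ ∞ (θ μ ν ρ) V := smooth_trDeltaSigma h hδs.smooth
  have zE : ∀ y ∈ V, y ∉ K → E y = 0 := fun y _ hy => by
    simp [E, w13, hδK y hy]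
  have zQ : ∀ y ∈ V, y ∉ K → Q y = 0 := fun y _ hy => by
    simp [Q, w22, w11, hδK y hy]
  have zθ : ∀ μ ν ρ, ∀ y ∈ V, y ∉ K → θ μ ν ρ y = 0 := fun μ ν ρ y _ hy => by
    simp [θ, trDeltaSigma, w12, hδK y hy]
  -- `V \ K` is open, so vanishing there passes to derivatives.
  have zpθ : ∀ κ μ ν ρ, ∀ y ∈ V, y ∉ K → pd κ (θ μ ν ρ) y = 0 := fun κ μ ν ρ y hy hyK => by
    rw [pd_congr_on (h.isOpen.inter hK.isClosed.isOpen_compl)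
      (fun z hz => zθ μ ν ρ z hz.1 hz.2) ⟨hy, hyK⟩, pd_const]
  -- The integrand split into the Euler-Lagrange term, the quadratic term and the exact term.
  have hpoint : ∀ y ∈ V, (orient Ψ y : ℂ) * (lagrangian lam mu nu Ψ a
        (fun z μ => A z μ + (t : ℂ) • δ z μ) y - lagrangian lam mu nu Ψ a A y)
      = (t : ℂ) * ((orient Ψ y : ℂ) * (-(lam : ℂ) * E y))
        + (t : ℂ) ^ 2 * ((orient Ψ y : ℂ) * (-(lam : ℂ) * Q y))
        + (-(lam : ℂ) * t) * ((orient Ψ y : ℂ) * pd 0 (θ 1 2 3) y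
          - (orient Ψ y : ℂ) * pd 1 (θ 0 2 3) y + (orient Ψ y : ℂ) * pd 2 (θ 0 1 3) y
          - (orient Ψ y : ℂ) * pd 3 (θ 0 1 2) y) := by
    intro y hy
    have hc := fun μ ν => curv_add (hdA y hy) (hdδ y hy) (t : ℂ) μ ν
    have hsu : ∀ z ∈ V, ∀ μ, IsSu2 (A z μ + (t : ℂ) • δ z μ) := fun z hz μ => by
      have := (hδs.su2 z hz μ).real_smul t
      exact (hA.su2 z hz μ).add this
    have hdt : ∀ μ, DiffM y fun z => A z μ + (t : ℂ) • δ z μ := fun μ i j =>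
      (hdA y hy μ i j).add ((hdδ y hy μ i j).const_mul (t : ℂ))
    rw [lagrangian_sub lam mu nu Ψ a _ _ y (trace_curv h.isOpen hy hA.su2 (hdA y hy))
      (trace_curv h.isOpen hy hsu hdt)]
    have hc' : curv (fun z μ => A z μ + (t : ℂ) • δ z μ) y = fun μ ν =>
      curv A y μ ν + (t : ℂ) • covD A δ y μ ν + (t : ℂ) ^ 2 • w11 (δ y) (δ y) μ ν := by
      funext μ ν; exact hc μ ν
    rw [hc', trace_w22_add_smul, trace_covD_sigma h hδs.smooth hy]
    change _ = (t : ℂ) * ((orient Ψ y : ℂ) * (-(lam : ℂ) * Matrix.trace (w13 (δ y)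
      (elForm Ψ y (A y)) : Matrix (Fin 2) (Fin 2) ℂ))) + (t : ℂ) ^ 2 * ((orient Ψ y : ℂ) *
      (-(lam : ℂ) * Matrix.trace (w22 (w11 (δ y) (δ y) : Fin 4 → Fin 4 →
        Matrix (Fin 2) (Fin 2) ℂ) (sigma Ψ y) : Matrix (Fin 2) (Fin 2) ℂ))) + _
    ring
  have iE := integrableOn_orient h hK hKV (contDiffOn_const (c := -(lam : ℂ)) |>.mul hE)
    fun y hy hyK => by rw [zE y hy hyK, mul_zero]
  have iQ := integrableOn_orient h hK hKV (contDiffOn_const (c := -(lam : ℂ)) |>.mul hQ)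
    fun y hy hyK => by rw [zQ y hy hyK, mul_zero]
  have iθ := fun κ μ ν ρ => integrableOn_orient h hK hKV
    (contDiffOn_pd (hθ μ ν ρ) h.isOpen κ) (zpθ κ μ ν ρ)
  have sθ := fun κ μ ν ρ => integral_orient_pd h hK hKV (hθ μ ν ρ) (zθ μ ν ρ) κ
  rw [actionChange, setIntegral_congr_fun h.isOpen.measurableSet hpoint]
  rw [integral_linear_combination iE iQ (iθ 0 1 2 3) (iθ 1 0 2 3) (iθ 2 0 1 3) (iθ 3 0 1 2), sθ, sθ,
    sθ, sθ]
  simp only [sub_zero, add_zero, mul_zero]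
  rfl

theorem hasDerivAt_actionChange (lam mu nu : ℝ) (a : E4 → Fin 4 → ℂ) (h : IsSmoothCoframe V Ψ)
    (hA : IsSmoothSu2 V A) (hδ : IsVariation V δ) :
    HasDerivAt (fun t : ℝ => actionChange lam mu nu V Ψ a A (fun y μ => (t : ℂ) • δ y μ))
      (∫ y in V, (orient Ψ y : ℂ) * (-(lam : ℂ) * Matrix.trace
        (w13 (δ y) (elForm Ψ y (A y)) : Matrix (Fin 2) (Fin 2) ℂ))) 0 := by
  rw [funext fun t => actionChange_eq lam mu nu a h hA hδ t]
  have h1 : HasDerivAt (fun t : ℝ => (t : ℂ)) 1 0 := Complex.ofRealCLM.hasDerivAt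
  generalize (∫ y in V, (orient Ψ y : ℂ) * (-(lam : ℂ) * Matrix.trace
        (w13 (δ y) (elForm Ψ y (A y)) : Matrix (Fin 2) (Fin 2) ℂ))) = I1
  have := (h1.mul_const I1).add ((h1.pow 2).mul_const (∫ y in V, (orient Ψ y : ℂ) * (-(lam : ℂ) *
    Matrix.trace (w22 (w11 (δ y) (δ y) : Fin 4 → Fin 4 → Matrix (Fin 2) (Fin 2) ℂ) (sigma Ψ y)
            : Matrix (Fin 2) (Fin 2) ℂ))))
  refine (this.congr_deriv ?_).congr_of_eventuallyEq (Filter.Eventually.of_forall fun t => ?_)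
  · simp
  · simp

/-! ### The Euler-Lagrange equation -/

/-- Test variations with a single nonzero component, a scalar bump times a constant `X`; they reduce
the variational equation to one about scalar test functions. -/
theorem isVariation_bump {φ : E4 → ℝ} (hφ : ContDiff ℝ ∞ φ) (hc : HasCompactSupport φ)
    (hs : tsupport φ ⊆ V) (κ : Fin 4) {X : Matrix (Fin 2) (Fin 2) ℂ} (hX : IsSu2 X) :
    IsVariation V fun y μ => φ y • (if μ = κ then X else 0) := by
  refine ⟨fun μ c d => ?_, fun y μ => ?_, tsupport φ, hc, hs, fun y hy μ => ?_⟩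
  · exact hφ.smul contDiff_const
  · refine IsSu2.real_smul ?_ _
    split_ifs
    exacts [hX, isSu2_zero]
  · simp only [image_eq_zero_of_notMem_tsupport hy, zero_smul]

/-- The fundamental lemma of the calculus of variations makes the trace of `X` against each
component of the Euler-Lagrange form vanish for every `X ∈ 𝔰𝔲(2)`. The components lie in `𝔰𝔲(2)`
themselves, where the trace form is definite. -/
theorem elForm_eq_zero_of_integral (lam : ℝ) (hlam : lam ≠ 0) (h : IsSmoothCoframe V Ψ)
    (hA : IsSmoothSu2 V A)
    (hint : ∀ δ, IsVariation V δ → ∫ y in V, (orient Ψ y : ℂ) * (-(lam : ℂ) * Matrix.trace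
        (w13 (δ y) (elForm Ψ y (A y)) : Matrix (Fin 2) (Fin 2) ℂ)) = 0) {y : E4} (hy : y ∈ V) :
    elForm Ψ y (A y) = 0 := by
  have hsu : ∀ μ ν ρ, IsSu2 (elForm Ψ y (A y) μ ν ρ) := fun μ ν ρ => by
    have hd := fun κ μ ν => isSu2_pdM h.isOpen hy ((h.smooth_sigma μ ν).diffM h.isOpen hy)
      (fun z _ => sigma_isSu2 Ψ z μ ν) κ
    rw [elForm_eq, d2M_eq]
    exact (((hd _ _ _).sub (hd _ _ _)).add (hd _ _ _)).add
      (elLin_isSu2 (sigma_isSu2 Ψ y) (hA.su2 y hy) _ _ _)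
  have key : ∀ (κ : Fin 4) (X : Matrix (Fin 2) (Fin 2) ℂ), IsSu2 X →
      Matrix.trace (w13 (fun μ => if μ = κ then X else 0) (elForm Ψ y (A y))
        : Matrix (Fin 2) (Fin 2) ℂ) = 0 := by
    intro κ X hX
    have hsm : ContDiffOn ℝ ∞ (fun y => Matrix.trace (w13 (fun μ => if μ = κ then X else 0)
        (elForm Ψ y (A y)) : Matrix (Fin 2) (Fin 2) ℂ)) V :=
      contDiffOn_trace (smoothM_w13 (α := fun _ μ => if μ = κ then X else 0)
        (fun μ i j => contDiffOn_const) (smoothM_elForm h hA.smooth))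
    have horient : ContinuousOn (fun y => (orient Ψ y : ℂ)) V := fun z hz =>
      ((continuousAt_const (y := (orient Ψ z : ℂ))).congr
        ((h.orient_eventually hz).mono fun w hw => by rw [hw])).continuousWithinAt
    have hf : ContinuousOn (fun y => (orient Ψ y : ℂ) * (-(lam : ℂ) * Matrix.trace
        (w13 (fun μ => if μ = κ then X else 0) (elForm Ψ y (A y))
          : Matrix (Fin 2) (Fin 2) ℂ))) V :=
      horient.mul (continuousOn_const.mul hsm.continuousOn)
    have hae := h.isOpen.ae_eq_zero_of_integral_contDiff_smul_eq_zero
      (μ := (volume : Measure E4)) (hf.locallyIntegrableOn h.isOpen.measurableSet) ?_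
    -- Test functions give vanishing almost everywhere; continuity of the integrand on the open set
    -- `V` gives it at `y`.
    · have heq := Measure.eqOn_open_of_ae_eq
        ((ae_restrict_iff' h.isOpen.measurableSet).2 hae) h.isOpen hf continuousOn_const hy
      have ho : (orient Ψ y : ℂ) ≠ 0 := by
        rw [Complex.ofReal_ne_zero, orient, Ne, Real.sign_eq_zero_iff]
        exact h.nondeg y hy
      have hl : (-(lam : ℂ)) ≠ 0 := neg_ne_zero.2 (Complex.ofReal_ne_zero.2 hlam)
      exact (mul_eq_zero.1 ((mul_eq_zero.1 heq).resolve_left ho)).resolve_left hl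
    · intro φ hφ hc hs
      rw [← hint _ (isVariation_bump hφ hc hs κ hX), ← setIntegral_eq_integral_of_forall_compl_eq_zero
        (s := V)]
      · congr 1
        funext z
        simp only [w13, Matrix.smul_mul, Matrix.trace_add, Matrix.trace_sub, Matrix.trace_smul,
          Complex.real_smul]
        ring
      · intro z hz
        rw [image_eq_zero_of_notMem_tsupport fun hz' => hz (hs hz'), zero_smul]
  obtain ⟨a1, a2⟩ := elForm_antisymm Ψ y (A y)
  refine eq_zero_of_antisymm a1 a2 ?_ ?_ ?_ ?_
  -- With `y` fixed, the constant `X` may be the component at `y` itself. The direction `κ` is the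
  -- index missing from that component, since `w13` pairs complementary indices.
  · refine (hsu 0 1 2).eq_zero_of_trace_sq ?_
    simpa [w13, Matrix.trace_neg] using key 3 _ (hsu 0 1 2)
  · refine (hsu 0 1 3).eq_zero_of_trace_sq ?_
    simpa [w13, Matrix.trace_neg] using key 2 _ (hsu 0 1 3)
  · refine (hsu 0 2 3).eq_zero_of_trace_sq ?_
    simpa [w13, Matrix.trace_neg] using key 1 _ (hsu 0 2 3)
  · refine (hsu 1 2 3).eq_zero_of_trace_sq ?_
    simpa [w13, Matrix.trace_neg] using key 0 _ (hsu 1 2 3)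

end Variation

section GlobalVariation

variable {M : Type*} [TopologicalSpace M] [ChartedSpace E4 M] (P : U2Structure M)

theorem IsSU2Connection.isSmoothSu2 {P : U2Structure M} {A : ℕ → M2Form}
    (hA : IsSU2Connection P A) (i : ℕ) : IsSmoothSu2 (P.chart i).target (A i) :=
  ⟨fun μ c d => hA.1 i μ c d, hA.2.1 i⟩

theorem isStationary_iff (lam mu nu : ℝ) (hlam : lam ≠ 0) (a : ℕ → E4 → Fin 4 → ℂ)
    {A : ℕ → M2Form} (hA : IsSU2Connection P A) :
    IsStationary lam mu nu P a A ↔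
      ∀ i, ∀ y ∈ (P.chart i).target, elForm (P.Psi i) y (A i y) = 0 := by
  have hd := fun i δ (hδ : IsVariation (P.chart i).target δ) =>
    hasDerivAt_actionChange lam mu nu (a i) (P.isSmoothCoframe i) (hA.isSmoothSu2 i) hδ
  constructor
  · intro hs i y hy
    exact elForm_eq_zero_of_integral lam hlam (P.isSmoothCoframe i) (hA.isSmoothSu2 i)
      (fun δ hδ => (hd i δ hδ).unique (hs i δ hδ)) hy
  · intro h0 i δ hδ
    convert hd i δ hδ using 1
    rw [setIntegral_congr_fun (g := fun _ => (0 : ℂ)) (P.chart i).open_target.measurableSet]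
    · simp
    · intro y hy
      simp [h0 i y hy, w13]

end GlobalVariation

/-! ### The curvature of the anti-self-dual connection -/

theorem pdM_hodge {W : E4 → Matrix (Fin 4) (Fin 4) ℝ} {y : E4} (μ : Fin 4) :
    pdM μ (fun z => hodge (W z)) y = hodge (pdM μ W y) := by
  ext i j
  fin_cases i <;> fin_cases j <;>
  first
  | exact pd_const μ (0 : ℝ) y
  | exact pd_neg _ _ _
  | rfl

theorem pdM_toComplex {W : E4 → Matrix (Fin 4) (Fin 4) ℝ} {y : E4} (hW : DiffM y W) (μ : Fin 4) :
    pdM μ (fun z => toComplex (W z)) y = toComplex (pdM μ W y) := by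
  have h1 : ∀ i j, DifferentiableAt ℝ (fun z => ((W z i j : ℝ) : ℂ)) y := fun i j =>
    Complex.ofRealCLM.differentiableAt.comp y (hW i j)
  have h : ∀ i j k l, pd μ (fun z => ((W z i j : ℝ) : ℂ) + Complex.I * ((W z k l : ℝ) : ℂ)) y
      = ((pdM μ W y i j : ℝ) : ℂ) + Complex.I * ((pdM μ W y k l : ℝ) : ℂ) := fun i j k l => by
    rw [pd_add (h1 i j) ((h1 k l).const_mul _), pd_const_mul _ (h1 k l), pd_ofReal (hW i j),
      pd_ofReal (hW k l)]
    rfl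
  apply matrix_ext_two <;> exact h _ _ _ _

theorem DiffM.hodge {W : E4 → Matrix (Fin 4) (Fin 4) ℝ} {y : E4} (hW : DiffM y W) :
    DiffM y fun z => hodge (W z) := by
  intro i j
  fin_cases i <;> fin_cases j <;>
  first
  | exact differentiableAt_const (0 : ℝ)
  | exact hW _ _
  | exact (hW _ _).neg

theorem pdM_asd {W : E4 → Matrix (Fin 4) (Fin 4) ℝ} {y : E4} (hW : DiffM y W) (μ : Fin 4) :
    pdM μ (fun z => asd (W z)) y = asd (pdM μ W y) := by
  have hs : DiffM y fun z => W z - U2Gravity.hodge (W z) := fun i j => (hW i j).sub (hW.hodge i j)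
  have hs' : DiffM y fun z => (1 / 2 : ℝ) • (W z - U2Gravity.hodge (W z)) := fun i j =>
    (hs i j).const_mul (1 / 2 : ℝ)
  simp only [asd]
  rw [pdM_toComplex hs', ← pdM_hodge, ← pdM_sub hW hW.hodge]
  congr 1
  ext i j
  exact pd_const_mul (1 / 2 : ℝ) (hs i j) μ

theorem asd_add (X Y : Matrix (Fin 4) (Fin 4) ℝ) : asd (X + Y) = asd X + asd Y := by
  apply matrix_ext_two <;> simp [asd, toComplex, hodge] <;> ring

theorem asd_sub (X Y : Matrix (Fin 4) (Fin 4) ℝ) : asd (X - Y) = asd X - asd Y := by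
  apply matrix_ext_two <;> simp [asd, toComplex, hodge] <;> ring

theorem skew_comm {X Y : Matrix (Fin 4) (Fin 4) ℝ} (hX : Xᵀ = -X) (hY : Yᵀ = -Y) :
    (X * Y - Y * X)ᵀ = -(X * Y - Y * X) := by
  rw [Matrix.transpose_sub, Matrix.transpose_mul, Matrix.transpose_mul, hX, hY]
  simp

/-- `𝔰𝔬(4)` is the direct sum of its self-dual and anti-self-dual ideals, so the projection onto the
second respects brackets. -/
theorem asd_comm {X Y : Matrix (Fin 4) (Fin 4) ℝ} (hX : Xᵀ = -X) (hY : Yᵀ = -Y) :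
    asd (X * Y - Y * X) = asd X * asd Y - asd Y * asd X := by
  have sX := skew_apply hX
  have dX := skew_diag hX
  have sY := skew_apply hY
  have dY := skew_diag hY
  have hI : Complex.I ^ 2 = -1 := Complex.I_sq
  rw [asd_eq (skew_comm hX hY), asd_eq hX, asd_eq hY]
  apply matrix_ext_two <;>
  · simp only [Matrix.sub_apply, Matrix.mul_apply, Fin.sum_univ_two, Fin.sum_univ_four,
      Matrix.of_apply, Matrix.cons_val', Matrix.cons_val_zero, Matrix.cons_val_one,
      Matrix.cons_val_fin_one, dX, dY, sX 1 0, sX 2 0, sX 2 1, sX 3 1, sX 3 2, sY 1 0,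
      sY 2 0, sY 2 1, sY 3 1, sY 3 2]
    push_cast
    ring_nf <;> simp only [hI] <;> ring

namespace IsSmoothCoframe

variable {U : Set E4} {Ψ : C2Form} (h : IsSmoothCoframe U Ψ)
include h

/-- The projection has constant coefficients, hence commutes with `d`, and it respects brackets;
therefore it commutes with taking curvature. -/
theorem curv_asdLeviCivita {y : E4} (hy : y ∈ U) (μ ν : Fin 4) :
    curv (asdLeviCivita Ψ) y μ ν = asd (lcCurvM Ψ y μ ν) := by
  have hd := fun μ => (h.smooth_leviCivita μ).diffM h.isOpen hy
  have hp : ∀ μ ν, pdM μ (fun z => asdLeviCivita Ψ z ν) y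
      = asd (pdM μ (fun z => leviCivita Ψ z ν) y) := fun μ ν => pdM_asd (hd ν) μ
  rw [curv, d1M_eq, hp, hp, lcCurvM_eq, asd_add, asd_sub,
    asd_comm (h.leviCivita_skew hy μ) (h.leviCivita_skew hy ν)]
  rfl

end IsSmoothCoframe

/-! ### Volume form and Kähler form in the coframe -/

/-- Laplace expansion along the first two rows, the form that matches the wedge product of two
`2`-forms in `w22`. -/
theorem det_fin_four (e : Matrix (Fin 4) (Fin 4) ℝ) : e.det =
    (e 0 0 * e 1 1 - e 0 1 * e 1 0) * (e 2 2 * e 3 3 - e 2 3 * e 3 2)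
    - (e 0 0 * e 1 2 - e 0 2 * e 1 0) * (e 2 1 * e 3 3 - e 2 3 * e 3 1)
    + (e 0 0 * e 1 3 - e 0 3 * e 1 0) * (e 2 1 * e 3 2 - e 2 2 * e 3 1)
    + (e 0 1 * e 1 2 - e 0 2 * e 1 1) * (e 2 0 * e 3 3 - e 2 3 * e 3 0)
    - (e 0 1 * e 1 3 - e 0 3 * e 1 1) * (e 2 0 * e 3 2 - e 2 2 * e 3 0)
    + (e 0 2 * e 1 3 - e 0 3 * e 1 2) * (e 2 0 * e 3 1 - e 2 1 * e 3 0) := by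
  rw [Matrix.det_succ_row_zero]
  simp [Fin.sum_univ_succ, Matrix.det_fin_three, Fin.succAbove]
  ring

theorem omega_coframe (Ψ : C2Form) (y : E4) (μ ν : Fin 4) :
    omega Ψ y μ ν = ee Ψ y 0 1 μ ν + ee Ψ y 2 3 μ ν := by
  simp [omega, ee, w11, coframe, Fin.sum_univ_two]
  ring

theorem w22_omega (Ψ : C2Form) (y : E4) : w22 (omega Ψ y) (omega Ψ y) = 2 * volForm Ψ y := by
  rw [volForm, det_fin_four]
  simp only [w22, omega_coframe, ee, w11]
  ring

theorem volForm_eq {Ψ : C2Form} (y : E4) :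
    volForm Ψ y = Real.sign (w22 (omega Ψ y) (omega Ψ y)) * Real.sqrt (metric Ψ y).det := by
  rw [w22_omega, det_metric, Real.sqrt_sq_eq_abs]
  change volForm Ψ y = Real.sign (2 * volForm Ψ y) * |volForm Ψ y|
  rcases lt_trichotomy (volForm Ψ y) 0 with hn | h0 | hp
  · rw [Real.sign_of_neg (by linarith), abs_of_neg hn]; ring
  · simp [h0]
  · rw [Real.sign_of_pos (by linarith), abs_of_pos hp]; ring

theorem omega_dagPsi (Ψ : C2Form) (y : E4) (μ ν : Fin 4) :
    (omega Ψ y μ ν : ℂ) = 1 / (2 * Complex.I) * dagPsi Ψ y μ ν 0 0 := by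
  apply Complex.ext
  · simp [omega, dagPsi, dag, w11, Matrix.mul_apply, Fin.sum_univ_two]
    ring
  · simp [dagPsi, dag, w11, Matrix.mul_apply, Fin.sum_univ_two]
    ring

theorem dagPsi_omega (Ψ : C2Form) (y : E4) (μ ν : Fin 4) :
    dagPsi Ψ y μ ν 0 0 = 2 * Complex.I * omega Ψ y μ ν := by
  rw [omega_dagPsi]
  field_simp

theorem trace_dagPsi_sq (Ψ : C2Form) (y : E4) :
    Matrix.trace (w22 (dagPsi Ψ y) (dagPsi Ψ y) : Matrix (Fin 1) (Fin 1) ℂ)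
      = -8 * (volForm Ψ y : ℂ) := by
  have h := congrArg (fun x : ℝ => (x : ℂ)) (w22_omega Ψ y)
  simp only [w22] at h
  push_cast at h
  simp only [w22, Matrix.trace_fin_one, Matrix.add_apply, Matrix.sub_apply, Matrix.mul_apply,
    Fin.isValue, dagPsi_omega, Finset.univ_unique, Fin.default_eq_zero,
    Finset.sum_singleton]
  linear_combination 4 * Complex.I ^ 2 * h + 8 * (volForm Ψ y : ℂ) * Complex.I_sq

theorem trace_da_dagPsi (Ψ : C2Form) (y : E4) (f : Fin 4 → Fin 4 → ℂ) :
    Matrix.trace (w22 (fun μ ν => !![f μ ν]) (dagPsi Ψ y) : Matrix (Fin 1) (Fin 1) ℂ)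
      = 2 * w22 (fun κ ι => (omega Ψ y κ ι : ℂ)) (fun κ ι => Complex.I * f κ ι) := by
  simp only [w22, Matrix.trace_fin_one, Matrix.add_apply, Matrix.sub_apply, Matrix.mul_apply,
    Fin.isValue, dagPsi_omega, Finset.univ_unique, Fin.default_eq_zero,
    Finset.sum_singleton, Matrix.of_apply, Matrix.cons_val', Matrix.cons_val_fin_one]
  ring

/-! ### Scalar curvature -/

/-- The `4`-form `¼ ε_{IJKL} R^{IJ} ∧ e^K ∧ e^L`. -/
noncomputable def epsCurv (Ψ : C2Form) (y : E4) (R : Fin 4 → Fin 4 → Fin 4 → Fin 4 → ℝ) : ℝ :=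
  w22 (R 0 1) (ee Ψ y 2 3) - w22 (R 0 2) (ee Ψ y 1 3) + w22 (R 0 3) (ee Ψ y 1 2)
    + w22 (R 1 2) (ee Ψ y 0 3) - w22 (R 1 3) (ee Ψ y 0 2) + w22 (R 2 3) (ee Ψ y 0 1)

/-- Wedging with `e^K ∧ e^L` extracts the frame component in the two complementary directions; the
signs are those of `ε`. -/
theorem w22_frame (Ψ : C2Form) (y : E4) {t : Matrix (Fin 4) (Fin 4) ℝ} (ht : tᵀ = -t)
    {τ : Fin 4 → Fin 4 → ℝ} (hτ : ∀ μ ν, τ μ ν = ((coframe Ψ y)ᵀ * t * coframe Ψ y) μ ν) :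
    w22 τ (ee Ψ y 2 3) = t 0 1 * volForm Ψ y ∧ w22 τ (ee Ψ y 1 3) = -(t 0 2 * volForm Ψ y) ∧
    w22 τ (ee Ψ y 1 2) = t 0 3 * volForm Ψ y ∧ w22 τ (ee Ψ y 0 3) = t 1 2 * volForm Ψ y ∧
    w22 τ (ee Ψ y 0 2) = -(t 1 3 * volForm Ψ y) ∧ w22 τ (ee Ψ y 0 1) = t 2 3 * volForm Ψ y := by
  have s := skew_apply ht
  have d := skew_diag ht
  rw [volForm, det_fin_four]
  refine ⟨?_, ?_, ?_, ?_, ?_, ?_⟩ <;>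
  · simp only [w22, hτ, ee, w11, Matrix.mul_apply, Fin.sum_univ_four, Matrix.transpose_apply, d,
      s 1 0, s 2 0, s 3 0, s 2 1, s 3 1, s 3 2]
    ring

/-- The sum over `I < J` of `R^{IJ} ∧ e^I ∧ e^J` is, up to sign, half of `∑_I e^I ∧ (R^I_J ∧ e^J)`,
and the inner `3`-form vanishes. -/
theorem w22_bianchi {e : Matrix (Fin 4) (Fin 4) ℝ} {R : Fin 4 → Fin 4 → Matrix (Fin 4) (Fin 4) ℝ}
    (hR : ∀ μ ν, (R μ ν)ᵀ = -R μ ν) (hR' : ∀ μ ν, R μ ν = -R ν μ)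
    (hB : ∀ I μ ν ρ, (R μ ν * e) I ρ + (R ν ρ * e) I μ + (R ρ μ * e) I ν = 0) :
    w22 (fun μ ν => R μ ν 0 1) (w11 (e 0) (e 1)) + w22 (fun μ ν => R μ ν 0 2) (w11 (e 0) (e 2))
      + w22 (fun μ ν => R μ ν 0 3) (w11 (e 0) (e 3)) + w22 (fun μ ν => R μ ν 1 2) (w11 (e 1) (e 2))
      + w22 (fun μ ν => R μ ν 1 3) (w11 (e 1) (e 3))
      + w22 (fun μ ν => R μ ν 2 3) (w11 (e 2) (e 3)) = 0 := by
  have s := fun μ ν => skew_apply (hR μ ν)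
  have d := fun μ ν => skew_diag (hR μ ν)
  have b := fun I => hB I 0 1 2
  have b' := fun I => hB I 0 1 3
  have b'' := fun I => hB I 0 2 3
  have b''' := fun I => hB I 1 2 3
  rw [hR' 2 0] at b
  rw [hR' 3 0] at b' b''
  rw [hR' 3 1] at b'''
  simp only [Matrix.mul_apply, Fin.sum_univ_four, Matrix.neg_apply, Fin.forall_fin_succ] at b b' b'' b'''
  simp [d, fun μ ν => s μ ν 1 0, fun μ ν => s μ ν 2 0, fun μ ν => s μ ν 3 0,
    fun μ ν => s μ ν 2 1, fun μ ν => s μ ν 3 1, fun μ ν => s μ ν 3 2] at b b' b'' b'''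
  obtain ⟨b0, b1, b2, b3⟩ := b
  obtain ⟨c0, c1, c2, c3⟩ := b'
  obtain ⟨d0, d1, d2, d3⟩ := b''
  obtain ⟨e0, e1, e2, e3⟩ := b'''
  simp only [w22, w11]
  -- The coefficients are those of the wedge of `e^I` with a `3`-form, summed over `I`; the factor
  -- `1/2` comes from passing from all index pairs to `I < J`.
  linear_combination (-1 / 2) * (e 0 3 * b0 + e 1 3 * b1 + e 2 3 * b2 + e 3 3 * b3)
    + (1 / 2) * (e 0 2 * c0 + e 1 2 * c1 + e 2 2 * c2 + e 3 2 * c3)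
    - (1 / 2) * (e 0 1 * d0 + e 1 1 * d1 + e 2 1 * d2 + e 3 1 * d3)
    + (1 / 2) * (e 0 0 * e0 + e 1 0 * e1 + e 2 0 * e2 + e 3 0 * e3)

/-- The matrix `e^K ∧ e^L` evaluated on `∂_μ, ∂_ν`. -/
noncomputable def eeM (Ψ : C2Form) (y : E4) (μ ν : Fin 4) : Matrix (Fin 4) (Fin 4) ℝ :=
  Matrix.of fun K L => ee Ψ y K L μ ν

theorem eeM_skew (Ψ : C2Form) (y : E4) (μ ν : Fin 4) : (eeM Ψ y μ ν)ᵀ = -eeM Ψ y μ ν := by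
  ext K L
  simp [eeM, ee, w11]
  ring

/-- Identifies `Σ` with the projection of the matrix of `2`-forms `e^I ∧ e^J`, so that `Tr(F ∧ Σ)`
becomes a pairing of anti-self-dual parts. -/
theorem sigma_eq_asd (Ψ : C2Form) (y : E4) (μ ν : Fin 4) :
    sigma Ψ y μ ν = (2 : ℂ) • asd (eeM Ψ y μ ν) := by
  rw [asd_eq (eeM_skew Ψ y μ ν)]
  apply matrix_ext_two <;>
  · simp [sigma_apply, Fin.sum_univ_two, eeM, ee, w11, coframe, Complex.ext_iff]
    try constructor
    all_goals ring

theorem trace_asd_mul {X Y : Matrix (Fin 4) (Fin 4) ℝ} (hX : Xᵀ = -X) (hY : Yᵀ = -Y) :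
    Matrix.trace (asd X * asd Y) = ((-(1 / 2) * ((X 2 3 - X 0 1) * (Y 2 3 - Y 0 1)
      + (X 0 2 + X 1 3) * (Y 0 2 + Y 1 3) + (X 1 2 - X 0 3) * (Y 1 2 - Y 0 3)) : ℝ) : ℂ) := by
  rw [asd_eq hX, asd_eq hY, Matrix.trace_fin_two]
  apply Complex.ext <;> simp [Matrix.mul_apply, Fin.sum_univ_two] <;> ring

namespace IsSmoothCoframe

variable {U : Set E4} {Ψ : C2Form} (h : IsSmoothCoframe U Ψ)
include h

/-- The pairing of the anti-self-dual parts of `R` and `e∧e` contains terms with complementary index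
pairs, which form the `ε`-contraction, and terms with equal index pairs, which sum to `∑ R^{IJ} ∧
e^I ∧ e^J` and vanish by the first Bianchi identity. -/
theorem trace_psiFpsi {y : E4} (hy : y ∈ U) :
    Matrix.trace (psiFpsi Ψ (asdLeviCivita Ψ) y) = -((epsCurv Ψ y (lcCurv Ψ y) : ℝ) : ℂ) := by
  have hc : curv (asdLeviCivita Ψ) y = fun μ ν => asd (lcCurvM Ψ y μ ν) := by
    funext μ ν; exact h.curv_asdLeviCivita hy μ ν
  have hB := w22_bianchi (fun μ ν => h.lcCurvM_skew hy μ ν) (lcCurvM_antisymm Ψ y)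
    (fun I μ ν ρ => h.bianchi hy I μ ν ρ)
  rw [psiFpsi, hc, trace_psi_F_psi Ψ y _ fun μ ν => (U2Gravity.asd_isSu2 (h.lcCurvM_skew hy μ ν)).2]
  congr 1
  have ht : ∀ μ ν ρ κ, Matrix.trace (asd (lcCurvM Ψ y μ ν) * sigma Ψ y ρ κ) = _ := fun μ ν ρ κ => by
    rw [sigma_eq_asd, Matrix.mul_smul, Matrix.trace_smul,
      trace_asd_mul (h.lcCurvM_skew hy μ ν) (eeM_skew Ψ y ρ κ)]
  simp only [w22, Matrix.trace_add, Matrix.trace_sub, ht, smul_eq_mul]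
  have hB' := congrArg (fun x : ℝ => (x : ℂ)) hB
  simp only [w22, w11] at hB'
  simp only [epsCurv, w22, eeM, ee, w11, Matrix.of_apply, lcCurvM] at hB' ⊢
  push_cast at hB' ⊢
  linear_combination (-1) * hB'

/-- The `ε`-contraction selects the frame components `R^{IJ}_{IJ}` with `I < J`. Skewness in each
index pair makes their sum half of the full double trace, which is the trace of the Ricci tensor. -/
theorem scalarCurv_mul_volForm {y : E4} (hy : y ∈ U) :
    scalarCurv (metric Ψ) y * volForm Ψ y = epsCurv Ψ y (lcCurv Ψ y) := by
  set e := coframe Ψ y with he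
  have h1 : e * e⁻¹ = 1 := h.mul_inv hy
  have h2 : e⁻¹ * e = 1 := h.inv_mul hy
  -- The components of the `2`-form `R^{IJ}` in the coframe.
  set t : Fin 4 → Fin 4 → Matrix (Fin 4) (Fin 4) ℝ := fun I J =>
    (e⁻¹)ᵀ * (Matrix.of fun μ ν => lcCurvM Ψ y μ ν I J) * e⁻¹ with ht
  have htτ : ∀ I J μ ν, lcCurv Ψ y I J μ ν = (eᵀ * t I J * e) μ ν := by
    intro I J μ ν
    have : eᵀ * t I J * e = Matrix.of fun μ ν => lcCurvM Ψ y μ ν I J := by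
      rw [ht]
      simp only []
      rw [Matrix.mul_assoc, Matrix.mul_assoc _ e⁻¹, h2, Matrix.mul_one, ← Matrix.mul_assoc,
        ← Matrix.transpose_mul, h2, Matrix.transpose_one, Matrix.one_mul]
    rw [this]
    rfl
  have hts : ∀ I J, (t I J)ᵀ = -t I J := by
    intro I J
    have hq : (Matrix.of fun μ ν => lcCurvM Ψ y μ ν I J)ᵀ
        = -(Matrix.of fun μ ν => lcCurvM Ψ y μ ν I J) := by
      ext μ ν
      change lcCurvM Ψ y ν μ I J = -lcCurvM Ψ y μ ν I J
      rw [lcCurvM_antisymm]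
      rfl
    rw [ht]
    simp only [Matrix.transpose_mul, Matrix.transpose_transpose, hq]
    rw [Matrix.neg_mul, Matrix.mul_neg, Matrix.mul_assoc]
  have hw := fun I J => w22_frame Ψ y (hts I J) (htτ I J)
  have hskew : ∀ I J, t I J = -t J I := by
    intro I J
    have : (Matrix.of fun μ ν => lcCurvM Ψ y μ ν I J) = -(Matrix.of fun μ ν => lcCurvM Ψ y μ ν J I) := by
      ext μ ν
      exact skew_apply (h.lcCurvM_skew hy μ ν) I J
    simp only [ht]
    rw [this, Matrix.mul_neg, Matrix.neg_mul]
  -- Here `g⁻¹ = e⁻¹ (e⁻¹)ᵀ` and the Riemann matrix is `e⁻¹ R e`, so the coordinate trace becomes a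
  -- frame trace.
  have htr : traceRicci (metric Ψ) y = ∑ K, ∑ I, t K I K I := by
    have hg : e * (metric Ψ y)⁻¹ = (e⁻¹)ᵀ := by
      rw [metric_eq, Matrix.mul_inv_rev, ← Matrix.mul_assoc, h1, Matrix.one_mul,
        Matrix.transpose_nonsing_inv]
    have hgs : ∀ σ ν, (metric Ψ y)⁻¹ σ ν = (metric Ψ y)⁻¹ ν σ := fun σ ν => by
      conv_lhs => rw [← metric_symm, ← Matrix.transpose_nonsing_inv]
      rfl
    have hr : ∀ μ ν, riemM (metric Ψ) μ ν y * (metric Ψ y)⁻¹ = e⁻¹ * lcCurvM Ψ y μ ν * (e⁻¹)ᵀ := by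
      intro μ ν
      rw [← hg, ← Matrix.mul_assoc, Matrix.mul_assoc e⁻¹, h.lcCurvM_mul_coframe hy,
        ← Matrix.mul_assoc, h2, Matrix.one_mul]
    have h3 : traceRicci (metric Ψ) y
        = ∑ ν, ∑ ρ, (riemM (metric Ψ) ρ ν y * (metric Ψ y)⁻¹) ρ ν := by
      simp only [traceRicci, ricci, Matrix.mul_apply, Finset.mul_sum]
      rw [Finset.sum_comm]
      refine Finset.sum_congr rfl fun ν _ => ?_
      rw [Finset.sum_comm]
      exact Finset.sum_congr rfl fun ρ _ => Finset.sum_congr rfl fun σ _ => mul_comm _ _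
    have hE : ∀ ν ρ, (e⁻¹ * lcCurvM Ψ y ρ ν * (e⁻¹)ᵀ) ρ ν
        = ∑ K, ∑ I, e⁻¹ ρ K * lcCurvM Ψ y ρ ν K I * e⁻¹ ν I := by
      intro ν ρ
      simp only [Matrix.mul_apply, Finset.sum_mul, Matrix.transpose_apply]
      rw [Finset.sum_comm]
    have hT : ∀ K I, t K I K I = ∑ ν, ∑ ρ, e⁻¹ ρ K * lcCurvM Ψ y ρ ν K I * e⁻¹ ν I := by
      intro K I
      simp only [ht, Matrix.mul_apply, Finset.sum_mul, Matrix.transpose_apply, Matrix.of_apply]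
    rw [h3]
    simp only [hr, hE, hT]
    rw [Finset.sum_congr rfl fun ν _ => Finset.sum_comm, Finset.sum_comm]
    refine Finset.sum_congr rfl fun K _ => ?_
    rw [Finset.sum_congr rfl fun ν _ => Finset.sum_comm, Finset.sum_comm]
  have hdiag : ∀ K, t K K K K = 0 := fun K => skew_diag (hts K K) K
  have hsw : ∀ K I, t I K I K = t K I K I := fun K I => by
    rw [hskew I K, Matrix.neg_apply, skew_apply (hts K I) I K, neg_neg]
  rw [scalarCurv, htr]
  simp only [Fin.sum_univ_four, hdiag, hsw 0 1, hsw 0 2, hsw 0 3, hsw 1 2, hsw 1 3, hsw 2 3]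
  obtain ⟨a1, -⟩ := hw 0 1
  obtain ⟨-, a2, -⟩ := hw 0 2
  obtain ⟨-, -, a3, -⟩ := hw 0 3
  obtain ⟨-, -, -, a4, -⟩ := hw 1 2
  obtain ⟨-, -, -, -, a5, -⟩ := hw 1 3
  obtain ⟨-, -, -, -, -, a6⟩ := hw 2 3
  rw [epsCurv, a1, a2, a3, a4, a5, a6]
  ring

theorem lagrangian_asd (lam mu nu : ℝ) (hlam : lam ≠ 0) (hrel : 3 * lam - mu + 4 * nu = 0)
    (a : E4 → Fin 4 → ℂ) {y : E4} (hy : y ∈ U) :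
    lagrangian lam mu nu Ψ a (asdLeviCivita Ψ) y
      = -(lam : ℂ) * ((volForm Ψ y : ℂ)
          * ((scalarCurv (metric Ψ) y + 2 * (mu / lam) - 6 : ℝ) : ℂ)
        - 2 * ((mu / lam : ℝ) : ℂ) * w22 (fun κ ι => (omega Ψ y κ ι : ℂ))
            (fun κ ι => Complex.I * d1 a y κ ι)) := by
  have hl : (lam : ℂ) ≠ 0 := Complex.ofReal_ne_zero.2 hlam
  have hr : 3 * (lam : ℂ) - mu + 4 * nu = 0 := by exact_mod_cast hrel
  rw [lagrangian, Matrix.trace_add, Matrix.trace_add, Matrix.trace_smul, Matrix.trace_smul,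
    Matrix.trace_smul, h.trace_psiFpsi hy, ← h.scalarCurv_mul_volForm hy, trace_dagPsi_sq,
    trace_da_dagPsi]
  push_cast
  simp only [smul_eq_mul]
  field_simp
  -- The relation in the form `8ν = 2μ - 6λ` turns `-8ν dV` into `-λ(2μ̃ - 6) dV`.
  linear_combination (-2 * (volForm Ψ y : ℂ)) * hr

end IsSmoothCoframe

/-! ### Compatible pairs `(g, ω)` and `U(2)`-structures -/

section Uniqueness

/-- The components of `Ψ` at a point as a `2 × 4` matrix. -/
def psiMatrix (Ψ : C2Form) (y : E4) : Matrix (Fin 2) (Fin 4) ℂ :=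
  Matrix.of fun c μ => Ψ y μ c 0

theorem psiMatrix_gram (Ψ : C2Form) (y : E4) :
    (psiMatrix Ψ y)ᴴ * psiMatrix Ψ y = (herm Ψ y)ᵀ := by
  ext μ ν
  simp [psiMatrix, herm, Matrix.mul_apply]

/-- The dual frame vectors with indices `0` and `2` are sent by `Ψ` to the standard basis of `ℂ²`.
-/
theorem exists_rightInverse {Ψ : C2Form} {y : E4} (hdet : (coframe Ψ y).det ≠ 0) :
    ∃ R : Matrix (Fin 4) (Fin 2) ℂ, psiMatrix Ψ y * R = 1 := by
  refine ⟨Matrix.of fun μ c => ((coframe Ψ y)⁻¹ μ (![0, 2] c) : ℂ), ?_⟩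
  have h : ∀ i j, (psiMatrix Ψ y * Matrix.of fun μ c => ((coframe Ψ y)⁻¹ μ (![0, 2] c) : ℂ)) i j
      = stdVec (![0, 2] j) i := by
    intro i j
    rw [← sum_inv_mul_Psi hdet, Matrix.mul_apply]
    exact Finset.sum_congr rfl fun μ _ => mul_comm _ _
  apply matrix_ext_two <;> rw [h] <;> simp [stdVec]

-- With `p`, `q` the component matrices and `R` a right inverse of `q`, the only candidate is `u =
-- pR`. Equality of the Gram matrices gives both `u†u = 1` and `(p - uq)†(p - uq) = 0`.
open scoped ComplexOrder in
theorem exists_unitary_of_herm_eq {Ψ Φ : C2Form} {y : E4} (hΦ : (coframe Φ y).det ≠ 0)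
    (h : herm Ψ y = herm Φ y) :
    ∃ u ∈ Matrix.unitaryGroup (Fin 2) ℂ, ∀ μ, Ψ y μ = u * Φ y μ := by
  obtain ⟨R, hR⟩ := exists_rightInverse hΦ
  have hg : (psiMatrix Ψ y)ᴴ * psiMatrix Ψ y = (psiMatrix Φ y)ᴴ * psiMatrix Φ y := by
    rw [psiMatrix_gram, psiMatrix_gram, h]
  set p := psiMatrix Ψ y with hp
  set q := psiMatrix Φ y with hq
  have hRt : Rᴴ * qᴴ = 1 := by
    rw [← Matrix.conjTranspose_mul, hR, Matrix.conjTranspose_one]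
  have hu : (p * R)ᴴ * (p * R) = 1 := by
    rw [Matrix.conjTranspose_mul, Matrix.mul_assoc, ← Matrix.mul_assoc pᴴ, hg, Matrix.mul_assoc, hR,
      Matrix.mul_one, hRt]
  have hup : (p * R)ᴴ * p = q := by
    rw [Matrix.conjTranspose_mul, Matrix.mul_assoc, hg, ← Matrix.mul_assoc, hRt, Matrix.one_mul]
  have hpu : pᴴ * (p * R) = qᴴ := by
    rw [← hup, Matrix.conjTranspose_mul, Matrix.conjTranspose_conjTranspose]
  have hz : (p - p * R * q)ᴴ * (p - p * R * q) = 0 := by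
    have e1 : (p * R * q)ᴴ * (p * R * q) = qᴴ * q := by
      rw [Matrix.conjTranspose_mul, Matrix.mul_assoc, ← Matrix.mul_assoc (p * R)ᴴ, hu,
        Matrix.one_mul]
    have e2 : (p * R * q)ᴴ * p = qᴴ * q := by
      rw [Matrix.conjTranspose_mul, Matrix.mul_assoc, hup]
    have e3 : pᴴ * (p * R * q) = qᴴ * q := by
      rw [← Matrix.mul_assoc, hpu]
    rw [Matrix.conjTranspose_sub, Matrix.sub_mul, Matrix.mul_sub, Matrix.mul_sub, e1, e2, e3, hg]
    abel
  have hpq : p = p * R * q := sub_eq_zero.1 (Matrix.conjTranspose_mul_self_eq_zero.1 hz)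
  refine ⟨p * R, Matrix.mem_unitaryGroup_iff'.2 hu, fun μ => ?_⟩
  ext c d
  fin_cases d
  have := congrFun₂ hpq c μ
  rw [Matrix.mul_apply] at this ⊢
  exact this

theorem metric_omega_eq_iff {Ψ Φ : C2Form} {y : E4} (hΦ : (coframe Φ y).det ≠ 0) :
    (metric Ψ y = metric Φ y ∧ omega Ψ y = omega Φ y) ↔
      ∃ u ∈ Matrix.unitaryGroup (Fin 2) ℂ, ∀ μ, Ψ y μ = u * Φ y μ := by
  rw [herm_eq_iff]
  exact ⟨exists_unitary_of_herm_eq hΦ, fun ⟨_, hu, h⟩ =>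
    herm_unitary (Matrix.mem_unitaryGroup_iff'.1 hu) h⟩

end Uniqueness

section Compatible

/-- The matrix of `e^1 ∧ e^2 + e^3 ∧ e^4`. -/
def stdOmega : Matrix (Fin 4) (Fin 4) ℝ :=
  !![0, 1, 0, 0; -1, 0, 0, 0; 0, 0, 0, 1; 0, 0, -1, 0]

theorem omega_eq (Ψ : C2Form) (y : E4) :
    omega Ψ y = (coframe Ψ y)ᵀ * stdOmega * coframe Ψ y := by
  ext μ ν
  rw [omega_coframe]
  simp [ee, w11, Matrix.mul_apply, Fin.sum_univ_four, stdOmega]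
  ring

theorem stdOmega_sq : stdOmega * stdOmega = -1 := by
  ext i j
  fin_cases i <;> fin_cases j <;> simp [stdOmega]

theorem stdOmega_skew : stdOmegaᵀ = -stdOmega := by
  ext i j
  fin_cases i <;> fin_cases j <;> simp [stdOmega]

theorem IsSmoothCoframe.isCompatiblePair {U : Set E4} {Ψ : C2Form} (h : IsSmoothCoframe U Ψ) :
    IsCompatiblePair U (metric Ψ) (omega Ψ) := by
  have hs := h.smooth_coframe
  refine ⟨h.smooth_metric, fun μ ν => ?_, fun y hy => ?_, fun y _ => ?_, fun y hy => ?_⟩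
  · simp only [omega_coframe, ee, w11]
    exact ((((hs _ _).mul (hs _ _)).sub ((hs _ _).mul (hs _ _))).add
      (((hs _ _).mul (hs _ _)).sub ((hs _ _).mul (hs _ _))))
  · rw [metric_eq, ← Matrix.conjTranspose_eq_transpose_of_trivial]
    exact Matrix.PosDef.conjTranspose_mul_self _ (Matrix.mulVec_injective_of_isUnit
      ((Matrix.isUnit_iff_isUnit_det _).2 (isUnit_iff_ne_zero.2 (h.nondeg y hy))))
  · rw [omega_eq, Matrix.transpose_mul, Matrix.transpose_mul, stdOmega_skew,
      Matrix.transpose_transpose, Matrix.neg_mul, Matrix.mul_neg, ← Matrix.mul_assoc]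
  · have h1 := h.mul_inv hy
    have h2 : ((coframe Ψ y)ᵀ)⁻¹ * (coframe Ψ y)ᵀ = 1 := by
      rw [← Matrix.transpose_nonsing_inv, ← Matrix.transpose_mul, h1, Matrix.transpose_one]
    rw [metric_eq, omega_eq, Matrix.mul_inv_rev]
    set e := coframe Ψ y
    calc eᵀ * stdOmega * e * (e⁻¹ * eᵀ⁻¹) * (eᵀ * stdOmega * e)
        = eᵀ * stdOmega * (e * e⁻¹) * (eᵀ⁻¹ * eᵀ) * stdOmega * e := by
          simp only [Matrix.mul_assoc]
      _ = eᵀ * (stdOmega * stdOmega) * e := by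
          rw [h1, h2, Matrix.mul_one, Matrix.mul_one, Matrix.mul_assoc eᵀ]
      _ = -(eᵀ * e) := by
          rw [stdOmega_sq, Matrix.mul_neg, Matrix.mul_one, Matrix.neg_mul]

end Compatible

/-! ### Local existence of a coframe for a compatible pair -/

section Cholesky

variable {n : Type*} [Fintype n] [DecidableEq n]

/-- One step of the Cholesky decomposition. -/
noncomputable def cholStep (K : Matrix n n ℂ) (k : n) : Matrix n n ℂ :=
  K - (K k k)⁻¹ • (K * Matrix.single k k 1 * K)

theorem mul_single_mul_apply (K : Matrix n n ℂ) (k μ ν : n) :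
    (K * Matrix.single k k (1 : ℂ) * K : Matrix n n ℂ) μ ν = K μ k * K k ν := by
  simp [Matrix.mul_apply, Matrix.single_apply, Finset.sum_ite_eq, ite_and]

theorem cholStep_apply (K : Matrix n n ℂ) (k μ ν : n) :
    cholStep K k μ ν = K μ ν - (K k k)⁻¹ * (K μ k * K k ν) := by
  rw [cholStep, Matrix.sub_apply, Matrix.smul_apply, mul_single_mul_apply, smul_eq_mul]

theorem cholStep_isHermitian {K : Matrix n n ℂ} (hK : Kᴴ = K) (k : n) :
    (cholStep K k)ᴴ = cholStep K k := by
  have h : ∀ i j, star (K i j) = K j i := fun i j => congrFun₂ hK j i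
  ext i j
  rw [Matrix.conjTranspose_apply, cholStep_apply, cholStep_apply]
  simp only [star_sub, star_mul, star_inv₀, h]
  ring

/-- The hypothesis makes `½ G K` idempotent. The subtracted rank-one term gives a sub-idempotent, so
the difference is idempotent again and the relation survives the step. -/
theorem cholStep_mul {K G : Matrix n n ℂ} (hKG : K * G * K = (2 : ℂ) • K) {k : n}
    (hk : K k k ≠ 0) : cholStep K k * G * cholStep K k = (2 : ℂ) • cholStep K k := by
  set S : Matrix n n ℂ := Matrix.single k k 1 with hS
  have hSKS : S * K * S = K k k • S := by
    rw [hS]; simp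
  have a1 : K * G * (K * S * K) = (2 : ℂ) • (K * S * K) := by
    rw [← Matrix.mul_assoc, ← Matrix.mul_assoc, hKG]; simp
  have a2 : K * S * K * G * K = (2 : ℂ) • (K * S * K) := by
    rw [Matrix.mul_assoc (K * S), Matrix.mul_assoc (K * S), hKG]; simp
  have a3 : K * S * K * G * (K * S * K) = (2 * K k k) • (K * S * K) := by
    calc K * S * K * G * (K * S * K) = (K * S * K * G * K) * S * K := by
          simp only [Matrix.mul_assoc]
      _ = (2 : ℂ) • (K * (S * K * S) * K) := by
          rw [a2]; simp only [Matrix.smul_mul, Matrix.mul_assoc]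
      _ = _ := by
          rw [hSKS]; simp only [Matrix.mul_smul, Matrix.smul_mul, smul_smul]
  have hc : cholStep K k = K - (K k k)⁻¹ • (K * S * K) := rfl
  rw [hc]
  simp only [Matrix.sub_mul, Matrix.mul_sub, Matrix.smul_mul, Matrix.mul_smul, a1, a2, a3, hKG,
    smul_sub, smul_smul]
  match_scalars
  · ring
  · field_simp
    ring

/-- The trace of `G K` is twice the rank of the idempotent `½ G K`, and the step lowers that rank by
one. -/
theorem trace_cholStep {K G : Matrix n n ℂ} (hKG : K * G * K = (2 : ℂ) • K) {k : n}
    (hk : K k k ≠ 0) : (G * cholStep K k).trace = (G * K).trace - 2 := by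
  have h1 : (G * (K * Matrix.single k k 1 * K)).trace = 2 * K k k := by
    rw [Matrix.trace_mul_comm, Matrix.mul_assoc (K * Matrix.single k k 1),
      Matrix.mul_assoc K, Matrix.trace_mul_comm, Matrix.mul_assoc, hKG]
    rw [Matrix.mul_smul, Matrix.trace_smul, Matrix.trace_mul_comm, smul_eq_mul]
    simp [Matrix.trace_mul_single]
  rw [cholStep, Matrix.mul_sub, Matrix.trace_sub, Matrix.mul_smul, Matrix.trace_smul, h1,
    smul_eq_mul]
  field_simp

-- The relation exhibits `K` as `½ (BK)†(BK)`.
open scoped ComplexOrder in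
theorem posSemidef_of_mul {m : Type*} [Fintype m] {K B : Matrix m m ℂ} (hK : Kᴴ = K)
    (hKG : K * (Bᴴ * B) * K = (2 : ℂ) • K) : K.PosSemidef := by
  have h : K = (1 / 2 : ℂ) • ((B * K)ᴴ * (B * K)) := by
    rw [Matrix.conjTranspose_mul, hK]
    have : K * Bᴴ * (B * K) = K * (Bᴴ * B) * K := by simp only [Matrix.mul_assoc]
    rw [this, hKG, smul_smul]
    norm_num
  rw [h]
  refine (Matrix.posSemidef_conjTranspose_mul_self _).smul ?_
  rw [Complex.le_def]
  norm_num

-- Supplies a pivot: a positive semidefinite matrix whose diagonal has no positive entry has trace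
-- zero and vanishes.
open scoped ComplexOrder in
theorem exists_diag_pos {m : Type*} [Fintype m] {K B : Matrix m m ℂ} (hK : Kᴴ = K)
    (hKG : K * (Bᴴ * B) * K = (2 : ℂ) • K) (hne : K ≠ 0) : ∃ k, 0 < (K k k).re := by
  have hp := posSemidef_of_mul hK hKG
  by_contra! hcon
  refine hne (hp.trace_eq_zero_iff.1 (Finset.sum_eq_zero fun k _ => ?_))
  have h0 : 0 ≤ K k k := hp.diag_nonneg
  rw [Complex.le_def] at h0
  exact Complex.ext (le_antisymm (hcon k) h0.1) h0.2.symm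

-- The Hermitian matrix `N = B K B†` satisfies `N†N = 2N`, so trace zero forces `N = 0`; then `4K =
-- (K B†) N (B K)` gives `K = 0`. No invertibility of `B` is needed.
open scoped ComplexOrder in
theorem eq_zero_of_trace {K B : Matrix n n ℂ} (hK : Kᴴ = K)
    (hKG : K * (Bᴴ * B) * K = (2 : ℂ) • K) (ht : (Bᴴ * B * K).trace = 0) : K = 0 := by
  have hN : B * K * Bᴴ = 0 := by
    have hNh : (B * K * Bᴴ)ᴴ = B * K * Bᴴ := by
      rw [Matrix.conjTranspose_mul, Matrix.conjTranspose_mul, Matrix.conjTranspose_conjTranspose,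
        hK, Matrix.mul_assoc]
    have h1 : (B * K * Bᴴ)ᴴ * (B * K * Bᴴ) = (2 : ℂ) • (B * K * Bᴴ) := by
      rw [hNh]
      calc B * K * Bᴴ * (B * K * Bᴴ) = B * (K * (Bᴴ * B) * K) * Bᴴ := by
            simp only [Matrix.mul_assoc]
        _ = _ := by rw [hKG]; simp
    have h2 : ((B * K * Bᴴ)ᴴ * (B * K * Bᴴ)).trace = 0 := by
      rw [h1, Matrix.trace_smul, Matrix.trace_mul_comm, ← Matrix.mul_assoc, ht, smul_zero]
    exact Matrix.trace_conjTranspose_mul_self_eq_zero_iff.1 h2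
  have h4 : (4 : ℂ) • K = K * Bᴴ * (B * K * Bᴴ) * (B * K) := by
    calc (4 : ℂ) • K = (2 : ℂ) • (K * (Bᴴ * B) * K) := by rw [hKG, smul_smul]; norm_num
      _ = K * (Bᴴ * B) * ((2 : ℂ) • K) := by rw [Matrix.mul_smul]
      _ = _ := by rw [← hKG]; simp only [Matrix.mul_assoc]
  rw [hN, Matrix.mul_zero, Matrix.zero_mul] at h4
  exact (smul_eq_zero.1 h4).resolve_left (by norm_num)

open scoped MatrixOrder in
theorem exists_real_sqrt {g : Matrix n n ℝ} (hg : g.PosDef) :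
    ∃ B : Matrix n n ℂ, g⁻¹.map Complex.ofReal = Bᴴ * B := by
  obtain ⟨C, hC⟩ := CStarAlgebra.nonneg_iff_eq_star_mul_self.mp hg.inv.posSemidef.nonneg
  refine ⟨C.map Complex.ofReal, ?_⟩
  rw [hC]
  ext i j
  simp [Matrix.mul_apply, Matrix.star_eq_conjTranspose]

end Cholesky

/-! ### Rank-two factorisation of `g - iω` for a compatible pair. -/

section Existence

/-- The Hermitian matrix `g - i ω`. -/
noncomputable def hermOf (g om : Matrix (Fin 4) (Fin 4) ℝ) : Matrix (Fin 4) (Fin 4) ℂ :=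
  Matrix.of fun μ ν => (g μ ν : ℂ) - Complex.I * om μ ν

theorem hermOf_eq (g om : Matrix (Fin 4) (Fin 4) ℝ) :
    hermOf g om = g.map Complex.ofReal - Complex.I • om.map Complex.ofReal := by
  ext μ ν
  simp [hermOf]

variable {V : Set E4} {g om : E4 → Matrix (Fin 4) (Fin 4) ℝ}

namespace IsCompatiblePair

variable (h : IsCompatiblePair V g om)
include h

theorem symm_g {y : E4} (hy : y ∈ V) : (g y)ᵀ = g y := by
  have := (h.posDef y hy).isHermitian
  rwa [Matrix.IsHermitian, Matrix.conjTranspose_eq_transpose_of_trivial] at this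

theorem hermOf_isHermitian {y : E4} (hy : y ∈ V) :
    (hermOf (g y) (om y))ᴴ = hermOf (g y) (om y) := by
  have hg : ∀ i j, g y j i = g y i j := fun i j => congrFun₂ (h.symm_g hy) i j
  have ho := skew_apply (h.skew y hy)
  ext i j
  simp only [hermOf, Matrix.conjTranspose_apply, Matrix.of_apply, hg i j, ho i j]
  apply Complex.ext <;> simp

/-- With `J = g⁻¹ω`, compatibility is `J² = -1`. Since `g - iω = g(1 - iJ)`, the claim is `(1 - iJ)²
= 2(1 - iJ)`. -/
theorem hermOf_mul {y : E4} (hy : y ∈ V) :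
    hermOf (g y) (om y) * (g y)⁻¹.map Complex.ofReal * hermOf (g y) (om y)
      = (2 : ℂ) • hermOf (g y) (om y) := by
  have hu : IsUnit (g y).det := isUnit_iff_ne_zero.2 (h.posDef y hy).det_pos.ne'
  have hm : ∀ X Y : Matrix (Fin 4) (Fin 4) ℝ,
      X.map Complex.ofReal * Y.map Complex.ofReal = (X * Y).map Complex.ofReal := fun X Y =>
    (Matrix.map_mul (f := Complex.ofRealHom)).symm
  have hneg : (-g y).map Complex.ofReal = -(g y).map Complex.ofReal := by
    ext i j; simp
  rw [hermOf_eq]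
  simp only [Matrix.sub_mul, Matrix.mul_sub, Matrix.smul_mul, Matrix.mul_smul, hm]
  rw [h.compat y hy, Matrix.mul_nonsing_inv _ hu, Matrix.one_mul, Matrix.one_mul,
    Matrix.mul_assoc (om y), Matrix.nonsing_inv_mul _ hu, Matrix.mul_one, hneg]
  simp only [smul_sub, smul_neg, smul_smul, Complex.I_mul_I, neg_smul, one_smul]
  module

/-- The trace of a symmetric times a skew matrix vanishes, leaving the trace of the identity. The
value `4` means rank two, hence exactly two Cholesky steps. -/
theorem trace_hermOf {y : E4} (hy : y ∈ V) :
    ((g y)⁻¹.map Complex.ofReal * hermOf (g y) (om y)).trace = 4 := by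
  have hu : IsUnit (g y).det := isUnit_iff_ne_zero.2 (h.posDef y hy).det_pos.ne'
  have hm : ∀ X Y : Matrix (Fin 4) (Fin 4) ℝ,
      X.map Complex.ofReal * Y.map Complex.ofReal = (X * Y).map Complex.ofReal := fun X Y =>
    (Matrix.map_mul (f := Complex.ofRealHom)).symm
  have ht : ((g y)⁻¹ * om y).trace = 0 := by
    have h1 : ((g y)⁻¹ * om y).trace = -((g y)⁻¹ * om y).trace := by
      conv_lhs => rw [← Matrix.trace_transpose, Matrix.transpose_mul, h.skew y hy,
        Matrix.transpose_nonsing_inv, h.symm_g hy, Matrix.neg_mul, Matrix.trace_neg,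
        Matrix.trace_mul_comm]
    linarith
  have htm : ∀ X : Matrix (Fin 4) (Fin 4) ℝ, (X.map Complex.ofReal).trace = (X.trace : ℂ) :=
    fun X => by simp [Matrix.trace]
  rw [hermOf_eq, Matrix.mul_sub, Matrix.mul_smul, hm, hm, Matrix.nonsing_inv_mul _ hu,
    Matrix.trace_sub, Matrix.trace_smul, htm, htm, ht]
  simp

/-- Two Cholesky steps exhaust `H = g - iω`, and the two normalised pivot columns are the components
of `α` and `β`. They are smooth wherever the pivots stay positive. -/
theorem exists_coframe (hV : IsOpen V) {y₀ : E4} (hy₀ : y₀ ∈ V) :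
    ∃ V' : Set E4, ∃ Ψ : C2Form, IsOpen V' ∧ y₀ ∈ V' ∧ V' ⊆ V ∧
      (∀ μ c, ContDiffOn ℝ ∞ (fun y => Ψ y μ c 0) V') ∧
      ∀ y ∈ V', (coframe Ψ y).det ≠ 0 ∧ metric Ψ y = g y ∧ omega Ψ y = om y := by
  set H : E4 → Matrix (Fin 4) (Fin 4) ℂ := fun y => hermOf (g y) (om y) with hH
  set K : E4 → Matrix (Fin 4) (Fin 4) ℂ := fun y => cholStep (H y) 0 with hK
  have hHs : SmoothM V H := fun i j =>
    (Complex.ofRealCLM.contDiff.comp_contDiffOn (h.smooth_g i j)).sub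
      (contDiffOn_const.mul (Complex.ofRealCLM.contDiff.comp_contDiffOn (h.smooth_om i j)))
  have hHd : ∀ y ∈ V, ∀ k, H y k k = ((g y k k : ℝ) : ℂ) := fun y hy k => by
    simp [hH, hermOf, skew_diag (h.skew y hy)]
  have hH0 : ∀ y ∈ V, H y 0 0 ≠ 0 := fun y hy => by
    rw [hHd y hy, Complex.ofReal_ne_zero]
    exact (h.posDef y hy).diag_pos.ne'
  have hKs : SmoothM V K := fun i j => by
    simp only [hK, cholStep_apply]
    exact (hHs i j).sub (((hHs 0 0).inv hH0).mul ((hHs i 0).mul (hHs 0 j)))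
  have hKh : ∀ y ∈ V, (K y)ᴴ = K y := fun y hy => cholStep_isHermitian (h.hermOf_isHermitian hy) 0
  have hKm : ∀ y ∈ V, K y * (g y)⁻¹.map Complex.ofReal * K y = (2 : ℂ) • K y := fun y hy =>
    cholStep_mul (h.hermOf_mul hy) (hH0 y hy)
  have hKt : ∀ y ∈ V, ((g y)⁻¹.map Complex.ofReal * K y).trace = 2 := fun y hy => by
    rw [hK, trace_cholStep (h.hermOf_mul hy) (hH0 y hy), h.trace_hermOf hy]
    norm_num
  -- The first pivot `H 0 0 = g 0 0` is positive throughout `V`. The index of the second depends on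
  -- `y₀`, and one exists because the remaining trace is `2`, so `K y₀ ≠ 0`.
  obtain ⟨k, hk⟩ : ∃ k, 0 < (K y₀ k k).re := by
    obtain ⟨B, hB⟩ := exists_real_sqrt (h.posDef y₀ hy₀)
    refine exists_diag_pos (hKh y₀ hy₀) (B := B) (by rw [← hB]; exact hKm y₀ hy₀) fun h0 => ?_
    have := hKt y₀ hy₀
    rw [h0] at this
    simp at this
  have hre : ContDiffOn ℝ ∞ (fun y => (K y k k).re) V :=
    Complex.reCLM.contDiff.comp_contDiffOn (hKs k k)
  -- Positivity of the chosen pivot is an open condition; it alone restricts the neighbourhood.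
  set V' : Set E4 := V ∩ (fun y => (K y k k).re) ⁻¹' Set.Ioi 0 with hV'
  have hsub : V' ⊆ V := Set.inter_subset_left
  set Ψ : C2Form := fun y μ => !![H y μ 0 / (Real.sqrt (g y 0 0) : ℂ);
    K y μ k / (Real.sqrt (K y k k).re : ℂ)] with hΨ
  have hKr : ∀ y ∈ V', K y k k = (((K y k k).re : ℝ) : ℂ) := fun y hy => by
    have : star (K y k k) = K y k k := congrFun₂ (hKh y hy.1) k k
    exact (Complex.conj_eq_iff_re.1 this).symm
  have hK0 : ∀ y ∈ V', K y k k ≠ 0 := fun y hy => by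
    rw [hKr y hy, Complex.ofReal_ne_zero]
    exact ne_of_gt hy.2
  -- The trace has dropped from `4` to `2` to `0`, so nothing is left after the second step.
  have hdecomp : ∀ y ∈ V', cholStep (K y) k = 0 := fun y hy => by
    obtain ⟨B, hB⟩ := exists_real_sqrt (h.posDef y hy.1)
    refine eq_zero_of_trace (cholStep_isHermitian (hKh y hy.1) k) (B := B) ?_ ?_
    · rw [← hB]
      exact cholStep_mul (hKm y hy.1) (hK0 y hy)
    · rw [← hB, trace_cholStep (hKm y hy.1) (hK0 y hy), hKt y hy.1, sub_self]
  have hherm : ∀ y ∈ V', herm Ψ y = H y := fun y hy => by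
    ext μ ν
    have hs1 : ((Real.sqrt (g y 0 0) : ℝ) : ℂ) * (Real.sqrt (g y 0 0) : ℝ) = H y 0 0 := by
      rw [hHd y hy.1, ← Complex.ofReal_mul, Real.mul_self_sqrt (h.posDef y hy.1).diag_pos.le]
    have hs2 : ((Real.sqrt (K y k k).re : ℝ) : ℂ) * (Real.sqrt (K y k k).re : ℝ) = K y k k := by
      rw [← Complex.ofReal_mul, Real.mul_self_sqrt (le_of_lt hy.2), ← hKr y hy]
    have c1 : star (H y ν 0) = H y 0 ν := congrFun₂ (h.hermOf_isHermitian hy.1) 0 ν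
    have c2 : star (K y ν k) = K y k ν := congrFun₂ (hKh y hy.1) k ν
    have d1 := cholStep_apply (H y) 0 μ ν
    have d2 := cholStep_apply (K y) k μ ν
    rw [hdecomp y hy, Matrix.zero_apply] at d2
    have e1 : herm Ψ y μ ν = star (H y ν 0 / (Real.sqrt (g y 0 0) : ℂ))
          * (H y μ 0 / (Real.sqrt (g y 0 0) : ℂ))
        + star (K y ν k / (Real.sqrt (K y k k).re : ℂ))
          * (K y μ k / (Real.sqrt (K y k k).re : ℂ)) := by
      simp [herm, hΨ, Matrix.mul_apply]
    rw [e1, star_div₀, star_div₀, c1, c2]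
    simp only [Complex.star_def, Complex.conj_ofReal]
    rw [div_mul_div_comm, div_mul_div_comm, hs1, hs2, div_eq_inv_mul, div_eq_inv_mul]
    have d1' : K y μ ν = _ := d1
    linear_combination d2 + d1'
  refine ⟨V', Ψ, hre.continuousOn.isOpen_inter_preimage hV isOpen_Ioi, ⟨hy₀, hk⟩, hsub,
    fun μ c => ?_, fun y hy => ?_⟩
  · have hs1 : ContDiffOn ℝ ∞ (fun y => ((Real.sqrt (g y 0 0) : ℝ) : ℂ)) V' :=
      Complex.ofRealCLM.contDiff.comp_contDiffOn (((h.smooth_g 0 0).mono hsub).sqrt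
        fun y hy => (h.posDef y hy.1).diag_pos.ne')
    have hs2 : ContDiffOn ℝ ∞ (fun y => ((Real.sqrt (K y k k).re : ℝ) : ℂ)) V' :=
      Complex.ofRealCLM.contDiff.comp_contDiffOn ((hre.mono hsub).sqrt fun y hy => ne_of_gt hy.2)
    fin_cases c
    · change ContDiffOn ℝ ∞ (fun y => H y μ 0 / (Real.sqrt (g y 0 0) : ℂ)) V'
      simp only [div_eq_mul_inv]
      exact ((hHs μ 0).mono hsub).mul <| hs1.inv fun y hy =>
        Complex.ofReal_ne_zero.2 (Real.sqrt_pos.2 (h.posDef y hy.1).diag_pos).ne'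
    · change ContDiffOn ℝ ∞ (fun y => K y μ k / (Real.sqrt (K y k k).re : ℂ)) V'
      simp only [div_eq_mul_inv]
      exact ((hKs μ k).mono hsub).mul <| hs2.inv fun y hy =>
        Complex.ofReal_ne_zero.2 (Real.sqrt_pos.2 hy.2).ne'
  · have hm : metric Ψ y = g y := by
      ext μ ν
      rw [metric_eq_re, hherm y hy]
      simp [hH, hermOf]
    -- Nondegeneracy of the coframe is free: `det g` is the square of its determinant and is
    -- positive.
    refine ⟨fun h0 => ?_, hm, ?_⟩
    · have := det_metric Ψ y
      rw [hm, h0] at this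
      exact (h.posDef y hy.1).det_pos.ne' (by simpa using this)
    · ext μ ν
      rw [omega_eq_im, hherm y hy]
      simp [hH, hermOf]

end IsCompatiblePair

end Existence

/-! ### The action on the anti-self-dual part of Levi-Civita -/

section Action

variable {M : Type*} [TopologicalSpace M]

/-- A countable union of slices, each an open set minus finitely many open overlaps. Measurability
lets integrands be compared on the pieces only, inside the chart targets. -/
theorem measurableSet_atlasPieces (chart : ℕ → OpenPartialHomeomorph M E4) :
    MeasurableSet {p : ℕ × E4 | p.2 ∈ (chart p.1).target ∧
      ∀ m < p.1, (chart p.1).symm p.2 ∉ (chart m).source} := by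
  have h : {p : ℕ × E4 | p.2 ∈ (chart p.1).target ∧
      ∀ m < p.1, (chart p.1).symm p.2 ∉ (chart m).source}
      = ⋃ i : ℕ, ({i} : Set ℕ) ×ˢ ((chart i).target \ ⋃ m ∈ Set.Iio i, overlap chart i m) := by
    ext ⟨i, y⟩
    simp only [Set.mem_ofPred_eq, Set.mem_iUnion, Set.mem_prod, Set.mem_singleton_iff,
      Set.mem_sdiff, overlap, Set.mem_Iio, exists_prop, not_exists, not_and]
    constructor
    · rintro ⟨h1, h2⟩
      exact ⟨i, rfl, h1, fun m hm _ => h2 m hm⟩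
    · rintro ⟨j, rfl, h1, h2⟩
      exact ⟨h1, fun m hm => h2 m hm h1⟩
  rw [h]
  exact .iUnion fun i => (measurableSet_singleton i).prod <| (chart i).open_target.measurableSet.diff
    (.biUnion (Set.to_countable _) fun m _ => (isOpen_overlap chart i m).measurableSet)

theorem atlasIntegral_congr {chart : ℕ → OpenPartialHomeomorph M E4} {f f' : ℕ → E4 → ℂ}
    (h : ∀ i, ∀ y ∈ (chart i).target, f i y = f' i y) :
    atlasIntegral chart f = atlasIntegral chart f' :=
  setIntegral_congr_fun (measurableSet_atlasPieces chart) fun p hp => h p.1 p.2 hp.1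

theorem atlasIntegral_const_mul (chart : ℕ → OpenPartialHomeomorph M E4) (c : ℂ)
    (f : ℕ → E4 → ℂ) :
    (atlasIntegral chart fun i y => c * f i y) = c * atlasIntegral chart f :=
  integral_const_mul c _

theorem sign_w22_omega (Ψ : C2Form) (y : E4) :
    Real.sign (w22 (omega Ψ y) (omega Ψ y)) = orient Ψ y := by
  rw [w22_omega, orient]
  rcases lt_trichotomy (volForm Ψ y) 0 with hn | h0 | hp
  · rw [Real.sign_of_neg (by linarith), Real.sign_of_neg hn]
  · rw [h0, mul_zero]
  · rw [Real.sign_of_pos (by linarith), Real.sign_of_pos hp]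

theorem orient_mul_volForm (Ψ : C2Form) (y : E4) :
    orient Ψ y * volForm Ψ y = Real.sqrt (metric Ψ y).det := by
  rw [det_metric, Real.sqrt_sq_eq_abs]
  change Real.sign (volForm Ψ y) * volForm Ψ y = |volForm Ψ y|
  rcases lt_trichotomy (volForm Ψ y) 0 with hn | h0 | hp
  · rw [Real.sign_of_neg hn, abs_of_neg hn]; ring
  · simp [h0]
  · rw [Real.sign_of_pos hp, abs_of_pos hp]; ring

variable [ChartedSpace E4 M] (P : U2Structure M)

theorem action_asd (lam mu nu : ℝ) (hlam : lam ≠ 0) (hrel : 3 * lam - mu + 4 * nu = 0)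
    (a : ℕ → E4 → Fin 4 → ℂ) :
    action lam mu nu P a (fun i => asdLeviCivita (P.Psi i))
      = gwAction P.chart lam (mu / lam) (fun i => metric (P.Psi i)) (fun i => omega (P.Psi i)) a := by
  rw [action, gwAction, ← atlasIntegral_const_mul]
  refine atlasIntegral_congr fun i y hy => ?_
  rw [(P.isSmoothCoframe i).lagrangian_asd lam mu nu hlam hrel (a i) hy, sign_w22_omega,
    ← orient_mul_volForm]
  push_cast
  ring

theorem U2Structure.metric_omega_overlap {i j : ℕ} {y : E4} (hy : y ∈ overlap P.chart i j) :
    metric (P.Psi i) y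
        = Matrix.of (pull2 (transition P.chart i j) (fun z => metric (P.Psi j) z) y) ∧
      omega (P.Psi i) y
        = Matrix.of (pull2 (transition P.chart i j) (fun z => omega (P.Psi j) z) y) := by
  rw [← metric_pull, ← omega_pull, herm_eq_iff]
  exact P.herm_overlap hy

end Action

end U2Gravity

/-! ### The assembled theorem. -/

theorem proposition2 {M : Type*} [TopologicalSpace M] [T2Space M] [SecondCountableTopology M]
    [ChartedSpace U2Gravity.E4 M] [IsManifold (𝓡 4) ∞ M]
    (P : U2Gravity.U2Structure M) (a : ℕ → U2Gravity.E4 → Fin 4 → ℂ)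
    (ha : U2Gravity.IsU1Connection P a)
    (lam mu nu : ℝ) (hlam : lam ≠ 0) (hrel : 3 * lam - mu + 4 * nu = 0) :
    -- the first variation: the Euler-Lagrange expression is `dΣ + A ∧ Σ - Σ ∧ A`
    (∀ A, U2Gravity.IsSU2Connection P A →
      ∀ i δ, U2Gravity.IsVariation (P.chart i).target δ →
        HasDerivAt
          (fun t : ℝ => U2Gravity.actionChange lam mu nu (P.chart i).target (P.Psi i) (a i) (A i)
            (fun y μ => (t : ℂ) • δ y μ))
          (∫ y in (P.chart i).target, (U2Gravity.orient (P.Psi i) y : ℂ) *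
            (-(lam : ℂ) * Matrix.trace
              (U2Gravity.w13 (δ y) (U2Gravity.elForm (P.Psi i) y (A i y)) :
                Matrix (Fin 2) (Fin 2) ℂ))) 0) ∧
    -- the Euler-Lagrange equation is an algebraic equation for the values of `A`
    (∀ A, U2Gravity.IsSU2Connection P A →
      (U2Gravity.IsStationary lam mu nu P a A ↔
        ∀ i, ∀ y ∈ (P.chart i).target, U2Gravity.elForm (P.Psi i) y (A i y) = 0)) ∧
    -- it is uniquely solved, point by point, by the anti-self-dual part of Levi-Civita
    (∀ i, ∀ y ∈ (P.chart i).target, ∀ B : Fin 4 → Matrix (Fin 2) (Fin 2) ℂ,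
      (∀ μ, U2Gravity.IsSu2 (B μ)) →
      (U2Gravity.elForm (P.Psi i) y B = 0 ↔ B = U2Gravity.asdLeviCivita (P.Psi i) y)) ∧
    -- the anti-self-dual part of Levi-Civita is a connection, and is the only stationary one
    U2Gravity.IsSU2Connection P (fun i => U2Gravity.asdLeviCivita (P.Psi i)) ∧
    (∀ A, U2Gravity.IsSU2Connection P A →
      (U2Gravity.IsStationary lam mu nu P a A ↔
        ∀ i, ∀ y ∈ (P.chart i).target, A i y = U2Gravity.asdLeviCivita (P.Psi i) y)) ∧
    -- the pair `(g, ω)`: a compatible pair of tensors on `M`, with `ω = (1/2i) Ψ†Ψ`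
    (∀ i, U2Gravity.IsCompatiblePair (P.chart i).target
      (U2Gravity.metric (P.Psi i)) (U2Gravity.omega (P.Psi i))) ∧
    (∀ i j, ∀ y ∈ U2Gravity.overlap P.chart i j,
      U2Gravity.metric (P.Psi i) y = Matrix.of (U2Gravity.pull2
        (U2Gravity.transition P.chart i j) (fun z => U2Gravity.metric (P.Psi j) z) y) ∧
      U2Gravity.omega (P.Psi i) y = Matrix.of (U2Gravity.pull2
        (U2Gravity.transition P.chart i j) (fun z => U2Gravity.omega (P.Psi j) z) y)) ∧
    (∀ i, ∀ y ∈ (P.chart i).target, ∀ μ ν,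
      (U2Gravity.omega (P.Psi i) y μ ν : ℂ)
        = 1 / (2 * Complex.I) * U2Gravity.dagPsi (P.Psi i) y μ ν 0 0) ∧
    -- the volume form, the scalar curvature, and the two identities used in the substitution
    (∀ i, ∀ y ∈ (P.chart i).target,
      U2Gravity.volForm (P.Psi i) y
        = Real.sign (U2Gravity.w22 (U2Gravity.omega (P.Psi i) y) (U2Gravity.omega (P.Psi i) y))
          * Real.sqrt (U2Gravity.metric (P.Psi i) y).det ∧
      U2Gravity.scalarCurv (U2Gravity.metric (P.Psi i)) y * U2Gravity.volForm (P.Psi i) y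
        = U2Gravity.w22 (U2Gravity.lcCurv (P.Psi i) y 0 1) (U2Gravity.ee (P.Psi i) y 2 3)
          - U2Gravity.w22 (U2Gravity.lcCurv (P.Psi i) y 0 2) (U2Gravity.ee (P.Psi i) y 1 3)
          + U2Gravity.w22 (U2Gravity.lcCurv (P.Psi i) y 0 3) (U2Gravity.ee (P.Psi i) y 1 2)
          + U2Gravity.w22 (U2Gravity.lcCurv (P.Psi i) y 1 2) (U2Gravity.ee (P.Psi i) y 0 3)
          - U2Gravity.w22 (U2Gravity.lcCurv (P.Psi i) y 1 3) (U2Gravity.ee (P.Psi i) y 0 2)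
          + U2Gravity.w22 (U2Gravity.lcCurv (P.Psi i) y 2 3) (U2Gravity.ee (P.Psi i) y 0 1) ∧
      Matrix.trace
          (U2Gravity.psiFpsi (P.Psi i) (U2Gravity.asdLeviCivita (P.Psi i)) y)
        = -((U2Gravity.scalarCurv (U2Gravity.metric (P.Psi i)) y
            * U2Gravity.volForm (P.Psi i) y : ℝ) : ℂ) ∧
      Matrix.trace (U2Gravity.w22 (U2Gravity.dagPsi (P.Psi i) y) (U2Gravity.dagPsi (P.Psi i) y) :
          Matrix (Fin 1) (Fin 1) ℂ)
        = -8 * (U2Gravity.volForm (P.Psi i) y : ℂ) ∧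
      -- the Lagrangian at `A = 𝐰`, as a `4`-form
      U2Gravity.lagrangian lam mu nu (P.Psi i) (a i) (U2Gravity.asdLeviCivita (P.Psi i)) y
        = -(lam : ℂ) *
          ((U2Gravity.volForm (P.Psi i) y : ℂ)
            * ((U2Gravity.scalarCurv (U2Gravity.metric (P.Psi i)) y + 2 * (mu / lam) - 6 : ℝ) : ℂ)
          - 2 * ((mu / lam : ℝ) : ℂ) * U2Gravity.w22
              (fun κ ι => (U2Gravity.omega (P.Psi i) y κ ι : ℂ))
              (fun κ ι => Complex.I * U2Gravity.d1 (a i) y κ ι))) ∧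
    -- the action at `A = 𝐰` is the functional of `(g, ω, a)`
    U2Gravity.action lam mu nu P a (fun i => U2Gravity.asdLeviCivita (P.Psi i))
      = U2Gravity.gwAction P.chart lam (mu / lam) (fun i => U2Gravity.metric (P.Psi i))
          (fun i => U2Gravity.omega (P.Psi i)) a ∧
    -- `U(2)`-structures are the same as compatible pairs
    (∀ (Ψ Φ : U2Gravity.C2Form) (y : U2Gravity.E4),
      (U2Gravity.coframe Ψ y).det ≠ 0 → (U2Gravity.coframe Φ y).det ≠ 0 →
      ((U2Gravity.metric Ψ y = U2Gravity.metric Φ y ∧ U2Gravity.omega Ψ y = U2Gravity.omega Φ y) ↔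
        ∃ u ∈ Matrix.unitaryGroup (Fin 2) ℂ, ∀ μ, Ψ y μ = u * Φ y μ)) ∧
    (∀ (V : Set U2Gravity.E4) (g om : U2Gravity.E4 → Matrix (Fin 4) (Fin 4) ℝ), IsOpen V →
      U2Gravity.IsCompatiblePair V g om → ∀ y₀ ∈ V, ∃ V' : Set U2Gravity.E4, ∃ Ψ : U2Gravity.C2Form,
        IsOpen V' ∧ y₀ ∈ V' ∧ V' ⊆ V ∧
        (∀ μ c, ContDiffOn ℝ ∞ (fun y => Ψ y μ c 0) V') ∧
        ∀ y ∈ V', (U2Gravity.coframe Ψ y).det ≠ 0 ∧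
          U2Gravity.metric Ψ y = g y ∧ U2Gravity.omega Ψ y = om y) := by
  have hst := fun A (hA : U2Gravity.IsSU2Connection P A) =>
    U2Gravity.isStationary_iff P lam mu nu hlam a hA
  refine ⟨fun A hA i δ hδ => U2Gravity.hasDerivAt_actionChange lam mu nu (a i)
      (P.isSmoothCoframe i) (hA.isSmoothSu2 i) hδ, hst,
    fun i y hy B hB => (P.isSmoothCoframe i).elForm_eq_zero_iff hy hB, P.isSU2Connection_asd,
    fun A hA => (hst A hA).trans (forall_congr' fun i => forall₂_congr fun y hy =>
      (P.isSmoothCoframe i).elForm_eq_zero_iff hy (hA.2.1 i y hy)),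
    fun i => (P.isSmoothCoframe i).isCompatiblePair,
    fun i j y hy => P.metric_omega_overlap hy,
    fun i y _ μ ν => U2Gravity.omega_dagPsi _ y μ ν,
    fun i y hy => ⟨U2Gravity.volForm_eq y, (P.isSmoothCoframe i).scalarCurv_mul_volForm hy, ?_,
      U2Gravity.trace_dagPsi_sq _ y,
      (P.isSmoothCoframe i).lagrangian_asd lam mu nu hlam hrel (a i) hy⟩,
    U2Gravity.action_asd P lam mu nu hlam hrel a,
    fun Ψ Φ y _ hΦ => U2Gravity.metric_omega_eq_iff hΦ,
    fun V g om hV h y₀ hy₀ => h.exists_coframe hV hy₀⟩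
  rw [(P.isSmoothCoframe i).scalarCurv_mul_volForm hy]
  exact (P.isSmoothCoframe i).trace_psiFpsi hy
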